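/- Let $p$ be a prime, $F$ a field of characteristic $p$, $n\ge 1$, $D$ a cyclic group of order $p^n$, $E\le \mathrm{Aut}(D)$ a $p'$-subgroup, $G=D\rtimes E$, and $\hat E=\mathrm{Hom}(E,F^\times)$. An $(FG,FG)$-bimodule is viewed as a left $F[G\times G]$-module via $(g,h)m=gmh^{-1}$. Let $T^\Delta(FG,FG)$ be the free abelian group on the isomorphism classes $[M]$ of indecomposable $p$-permutation $F[G\times G]$-modules with twisted diagonal vertices, i.e. vertices of the form $\{(\varphi(y),y)\mid y\in Q\}$ with $\varphi:Q\to P$ an isomorphism between $p$-subgroups of $G$; put $[M\oplus N]=[M]+[N]$ and $[M]\cdot[N]=[M\otimes_{FG}N]$ (equivalently, $T^\Delta(FG,FG)$ is the span of these classes in the split Grothendieck ring of finitely generated $(FG,FG)$-bimodules). Let $T^\Delta_i$ be the span of the classes of those modules whose vertices have order $p^i$, and $Pr$ the span of the classes of projective indecomposable modules. For $0\le i\le n$ let $D_i$ be the subgroup of $D$ of order $p^i$, $\pi_i:\mathrm{Aut}(D)\to\mathrm{Aut}(D_i)$ the restriction map, and $m_i=(p^{n-i}-1)/|E|$, which is an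 integer; moreover $|\hat E|=|E|$. For $\lambda,\mu\in\hat E$ put $P_\lambda=\mathrm{Ind}_E^G(F_\lambda)$ and $P_{\lambda,\mu}=P_\lambda\otimes_F P_{\mu^{-1}}$. For $1\le i\le n$, $\alpha\in\mathrm{Aut}(D_i)$ and $\lambda\in\hat E$ let $M_{i,\alpha,\lambda}$ be induced to $G\times G$ from the one-dimensional module of the subgroup $\{(\alpha(x)\rho,x\rho)\mid x\in D_i,\rho\in E\}$ on which $(\alpha(x)\rho,x\rho)$ acts as $\lambda(\rho)$. For a ring $R$ and $c\in R$, let $R_c$ be $R$ with the multiplication $a\cdot_c b=acb$. Then: (1) The $P_{\lambda,\mu}$ are, up to isomorphism, exactly the projective indecomposable $F[G\times G]$-modules, and $P_{\lambda,\mu}\cong P_{\lambda',\mu'}$ iff $\lambda=\lambda'$ and $\mu=\mu'$. (2) $M_{i,\alpha,\lambda}$ is an indecomposable $p$-permutation module with vertex $\{(\alpha(x),x)\mid x\in D_i\}$; every non-projective indecomposable $p$-permutation $F[G\times G]$-module with twisted diagonal vertex is isomorphic to some $M_{i,\alpha,\lambda}$; and $M_{i,\alpha,\lambda}\cong M_{j,\beta,\mu}$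 iff $i=j$, $\alpha=\beta\circ\rho|_{D_i}$ for some $\rho\in E$, and $\lambda=\mu$. Hence the classes $[P_{\lambda,\mu}]$, for $\lambda,\mu\in\hat E$, and $[M_{i,\alpha,\lambda}]$, for $1\le i\le n$, $\alpha\pi_i(E)\in\mathrm{Aut}(D_i)/\pi_i(E)$ and $\lambda\in\hat E$, form a $\mathbb Z$-basis of $T^\Delta(FG,FG)$. (3) For all $\lambda,\mu,\lambda',\mu'\in\hat E$, $1\le i,j\le n$, $\alpha\in\mathrm{Aut}(D_i)$ and $\beta\in\mathrm{Aut}(D_j)$, with $k=\min\{i,j\}$ and $l=\max\{i,j\}$: $$[P_{\lambda,\mu}]\cdot[P_{\lambda',\mu'}]=\begin{cases}(m_0+1)[P_{\lambda,\mu'}]&\text{if }\mu=\lambda',\\ m_0[P_{\lambda,\mu'}]&\text{if }\mu\ne\lambda',\end{cases}$$ $$[P_{\lambda,\mu}]\cdot[M_{j,\beta,\mu'}]=[P_{\lambda,\mu\mu'^{-1}}]+\sum_{\nu\in\hat E}m_j[P_{\lambda,\nu}],$$ $$[M_{i,\alpha,\lambda}]\cdot[P_{\lambda',\mu'}]=[P_{\lambda\lambda',\mu'}]+\sum_{\nu\in\hat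 E}m_i[P_{\nu,\mu'}],$$ $$[M_{i,\alpha,\lambda}]\cdot[M_{j,\beta,\mu}]=[M_{k,\alpha|_{D_k}\circ\beta|_{D_k},\lambda\mu}]+\sum_{\nu\in\hat E}m_l[M_{k,\alpha|_{D_k}\circ\beta|_{D_k},\nu}].$$ Moreover $[M_{n,\mathrm{id},1}]=[FG]$ is the identity element. (4) $T^\Delta(FG,FG)$ is a unital ring in which $Pr$ is an ideal, the quotient ring $T^\Delta(FG,FG)/Pr$ is commutative, $T^\Delta_i$ is multiplicatively closed for $0\le i\le n$, and $T^\Delta_0=Pr$. The map $[P_{\lambda,\mu}]\mapsto E_{\lambda,\mu}$ (the matrix unit) defines a ring isomorphism $Pr\cong\mathrm{Mat}_{|E|}(\mathbb Z)_C$, where the rows and columns are indexed by $\hat E$ and $C$ has entries $m_0+1$ on the diagonal and $m_0$ off the diagonal. The map $[M_{n,\alpha,\lambda}]\mapsto(\alpha E,\lambda)$ defines a ring isomorphism $T^\Delta_n\cong\mathbb Z[\mathrm{Aut}(D)/E\times\hat E]$. For $1\le i\le n$, the map $[M_{i,\alpha,\lambda}]\mapsto(\alpha\pi_i(E),\lambda)$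 defines a ring isomorphism $T^\Delta_i\cong\mathbb Z[\mathrm{Aut}(D_i)/\pi_i(E)\times\hat E]_{c_i}$, where $c_i=(1,1)+m_i\sum_{\lambda\in\hat E}(1,\lambda)$. -/

import Mathlib

universe u v

namespace TrivialSource

noncomputable section

open scoped TensorProduct

/-! ### Finite-dimensional representations -/

/-- A finitely generated `FΓ`-module, given as a finite-dimensional `F`-linear representation. -/
structure FinRep (F : Type u) (Γ : Type v) [Field F] [Group Γ] where
  V : Type (max u v)
  [addCommGroup : AddCommGroup V]
  [module : Module F V]
  [finite : Module.Finite F V]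
  ρ : Representation F Γ V

attribute [instance] FinRep.addCommGroup FinRep.module FinRep.finite

section FinRep

variable {F : Type u} {Γ : Type v} [Field F] [Group Γ]

/-- Isomorphism of `FΓ`-modules. -/
def FinRep.Iso (M N : FinRep F Γ) : Prop := Nonempty (M.ρ.Equiv N.ρ)

/-- The direct sum of two `FΓ`-modules. -/
def FinRep.sum (M N : FinRep F Γ) : FinRep F Γ where
  V := M.V × N.V
  ρ := M.ρ.prod N.ρ

/-- A module is indecomposable if it is nonzero and is not the direct sum of two nonzero
submodules. -/
def FinRep.Indecomposable (M : FinRep F Γ) : Prop :=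
  Nontrivial M.V ∧ ∀ U W : Subrepresentation M.ρ,
    IsCompl U.toSubmodule W.toSubmodule → U.toSubmodule = ⊥ ∨ W.toSubmodule = ⊥

/-- Projectivity as a module over the group algebra `FΓ`. -/
def FinRep.Projective (M : FinRep F Γ) : Prop :=
  Module.Projective (MonoidAlgebra F Γ) M.ρ.asModule

/-- A `p`-permutation module: for every `p`-subgroup `P` there is a `P`-stable `F`-basis. -/
def FinRep.PPermutation (p : ℕ) (M : FinRep F Γ) : Prop :=
  ∀ P : Subgroup Γ, IsPGroup p P →
    ∃ (ι : Type) (b : Module.Basis ι F M.V), ∀ g ∈ P, ∀ i, ∃ j, M.ρ g (b i) = b j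

/-- `M` is relatively `Q`-projective: it is isomorphic to a direct summand of
`Ind_Q^Γ (Res_Q M)`. -/
def FinRep.RelProjective (M : FinRep F Γ) (Q : Subgroup Γ) : Prop :=
  ∃ (i : M.ρ.IntertwiningMap (Representation.ind Q.subtype (M.ρ.comp Q.subtype)))
    (r : (Representation.ind Q.subtype (M.ρ.comp Q.subtype)).IntertwiningMap M.ρ),
    r.comp i = Representation.IntertwiningMap.id M.ρ

/-- `Q` is a vertex of (the indecomposable module) `M`: a minimal subgroup relative to which `M`
is projective. -/
def FinRep.IsVertex (M : FinRep F Γ) (Q : Subgroup Γ) : Prop :=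
  M.RelProjective Q ∧ ∀ R : Subgroup Γ, R ≤ Q → M.RelProjective R → R = Q

/-- The one-dimensional representation `F_χ` attached to a linear character `χ : Γ → Fˣ`. -/
def charRep {Δ : Type*} [Group Δ] (χ : Δ →* Fˣ) : Representation F Δ F :=
  (Algebra.lmul F F).toMonoidHom.comp ((Units.coeHom F).comp χ)

/-- `Ind_H^Γ (F_χ)` for a homomorphism `φ : H → Γ` (an inclusion in all applications)
and a linear character `χ` of `H`. -/
def indChar {H : Type v} [Group H] [Finite Γ] (φ : H →* Γ) (χ : H →* Fˣ) : FinRep F Γ where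
  V := Representation.IndV φ (charRep χ)
  ρ := Representation.ind φ (charRep χ)

/-- The outer tensor product `M ⊗_F N` of an `FG`-module and an `FH`-module, as an
`F[G × H]`-module. -/
def outerTensor {H : Type v} [Group H] (M : FinRep F Γ) (N : FinRep F H) :
    FinRep F (Γ × H) where
  V := M.V ⊗[F] N.V
  ρ := Representation.tprod (M.ρ.comp (MonoidHom.fst Γ H)) (N.ρ.comp (MonoidHom.snd Γ H))

lemma FinRep.Iso.refl (M : FinRep F Γ) : M.Iso M := ⟨.refl _⟩

lemma FinRep.Iso.symm {M N : FinRep F Γ} (h : M.Iso N) : N.Iso M := ⟨h.some.symm⟩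

lemma FinRep.Iso.trans {M N K : FinRep F Γ} (h : M.Iso N) (h' : N.Iso K) : M.Iso K :=
  ⟨h.some.trans h'.some⟩

end FinRep

/-! ### Bimodules and their tensor product

An `(FG, FG)`-bimodule is an `F[G × G]`-module via `(g, h) m = g m h⁻¹`. -/

section Bimodule

variable {F : Type u} {G : Type v} [Field F] [Group G]

/-- The diagonal action `h ↦ (m ⊗ n ↦ m h⁻¹ ⊗ h n)` of `G` on `M ⊗_F N`. -/
abbrev midRep (M N : FinRep F (G × G)) : Representation F G (M.V ⊗[F] N.V) :=
  Representation.tprod (M.ρ.comp (MonoidHom.inr G G)) (N.ρ.comp (MonoidHom.inl G G))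

/-- The tensor product `M ⊗_{FG} N` of bimodules: the quotient of `M ⊗_F N` by the span of all
`m h⁻¹ ⊗ h n - m ⊗ n`, with `(g, k) (m ⊗ n) = g m ⊗ n k⁻¹`. -/
def tensor (M N : FinRep F (G × G)) : FinRep F (G × G) where
  V := (midRep M N).Coinvariants
  ρ :=
    { toFun := fun x => Representation.Coinvariants.map _ _
        ⟨TensorProduct.map (M.ρ (x.1, 1)) (N.ρ (1, x.2)), fun h => by
          ext m n
          simp [← Module.End.mul_apply, ← map_mul]⟩
      map_one' := by
        ext m n
        simp [← Prod.one_eq_mk]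
      map_mul' := fun x y => by
        ext m n
        simp only [TensorProduct.AlgebraTensorModule.curry_apply, TensorProduct.curry_apply,
          LinearMap.restrictScalars_apply, LinearMap.comp_apply, Module.End.mul_apply,
          Representation.Coinvariants.map_mk]
        have e1 : M.ρ ((x * y).1, 1) m = M.ρ (x.1, 1) (M.ρ (y.1, 1) m) := by
          rw [← Module.End.mul_apply, ← map_mul]; simp
        have e2 : N.ρ (1, (x * y).2) n = N.ρ (1, x.2) (N.ρ (1, y.2) n) := by
          rw [← Module.End.mul_apply, ← map_mul]; simp
        exact congrArg (Representation.Coinvariants.mk (midRep M N))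
          (congrArg₂ (fun a b => a ⊗ₜ[F] b) e1 e2) }

/-- The regular bimodule `FG`. -/
def regular (F : Type u) (G : Type v) [Field F] [Group G] [Finite G] : FinRep F (G × G) where
  V := MonoidAlgebra F G
  ρ :=
    { toFun := fun x => MonoidAlgebra.mapDomainLinearMap F F fun y => x.1 * y * x.2⁻¹
      map_one' := by ext; simp
      map_mul' := fun x y => by ext; simp [mul_assoc] }

/-- The class of `m ⊗ n` in `M ⊗_{FG} N`. -/
def tmk (M N : FinRep F (G × G)) : M.V →ₗ[F] N.V →ₗ[F] (tensor M N).V :=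
  (TensorProduct.mk F M.V N.V).compr₂ (Representation.Coinvariants.mk (midRep M N))

lemma tmk_mid (M N : FinRep F (G × G)) (h : G) (m : M.V) (n : N.V) :
    tmk M N (M.ρ (1, h) m) (N.ρ (h, 1) n) = tmk M N m n :=
  Representation.Coinvariants.mk_self_apply (midRep M N) h (m ⊗ₜ n)

lemma tmk_act (M N : FinRep F (G × G)) (x : G × G) (m : M.V) (n : N.V) :
    (tensor M N).ρ x (tmk M N m n) = tmk M N (M.ρ (x.1, 1) m) (N.ρ (1, x.2) n) := rfl

/-- The universal property of `M ⊗_{FG} N`. -/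
def tlift (M N : FinRep F (G × G)) {W : Type*} [AddCommGroup W] [Module F W]
    (f : M.V →ₗ[F] N.V →ₗ[F] W)
    (hf : ∀ (h : G) (m : M.V) (n : N.V), f (M.ρ (1, h) m) (N.ρ (h, 1) n) = f m n) :
    (tensor M N).V →ₗ[F] W :=
  Representation.Coinvariants.lift (midRep M N) (TensorProduct.lift f) fun h => by
    ext m n
    simpa using hf h m n

lemma tlift_tmk (M N : FinRep F (G × G)) {W : Type*} [AddCommGroup W] [Module F W]
    (f : M.V →ₗ[F] N.V →ₗ[F] W)
    (hf : ∀ (h : G) (m : M.V) (n : N.V), f (M.ρ (1, h) m) (N.ρ (h, 1) n) = f m n)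
    (m : M.V) (n : N.V) : tlift M N f hf (tmk M N m n) = f m n := rfl

lemma tensor_hom_ext {M N : FinRep F (G × G)} {W : Type*} [AddCommGroup W] [Module F W]
    {f g : (tensor M N).V →ₗ[F] W} (h : ∀ m n, f (tmk M N m n) = g (tmk M N m n)) : f = g :=
  Representation.Coinvariants.hom_ext (TensorProduct.ext' h)

/-- Functoriality of `M ⊗_{FG} N`. -/
def tmap {M M' N N' : FinRep F (G × G)} (f : M.ρ.IntertwiningMap M'.ρ)
    (g : N.ρ.IntertwiningMap N'.ρ) : (tensor M N).V →ₗ[F] (tensor M' N').V :=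
  tlift M N ((tmk M' N').compl₁₂ f.toLinearMap g.toLinearMap) fun h m n => by
    have e1 := congrArg (fun l => l m) (f.isIntertwining' (1, h))
    have e2 := congrArg (fun l => l n) (g.isIntertwining' (h, 1))
    simp only [LinearMap.comp_apply] at e1 e2
    simp only [LinearMap.compl₁₂_apply, e1, e2, tmk_mid]

lemma tmap_tmk {M M' N N' : FinRep F (G × G)} (f : M.ρ.IntertwiningMap M'.ρ)
    (g : N.ρ.IntertwiningMap N'.ρ) (m : M.V) (n : N.V) :
    tmap f g (tmk M N m n) = tmk M' N' (f.toLinearMap m) (g.toLinearMap n) := rfl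

lemma equiv_act {Γ : Type v} [Group Γ] {M M' : FinRep F Γ} (e : M.ρ.Equiv M'.ρ)
    (x : Γ) (m : M.V) : e.toIntertwiningMap.toLinearMap (M.ρ x m)
      = M'.ρ x (e.toIntertwiningMap.toLinearMap m) :=
  congrArg (fun l => l m) (e.isIntertwining' x)

lemma equiv_symm_left {Γ : Type v} [Group Γ] {M M' : FinRep F Γ} (e : M.ρ.Equiv M'.ρ)
    (m : M.V) : e.symm.toIntertwiningMap.toLinearMap (e.toIntertwiningMap.toLinearMap m) = m :=
  e.toLinearEquiv.symm_apply_apply m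

lemma equiv_symm_right {Γ : Type v} [Group Γ] {M M' : FinRep F Γ} (e : M.ρ.Equiv M'.ρ)
    (m : M'.V) : e.toIntertwiningMap.toLinearMap (e.symm.toIntertwiningMap.toLinearMap m) = m :=
  e.toLinearEquiv.apply_symm_apply m

lemma tensor_congr {M M' N N' : FinRep F (G × G)} (h : M.Iso M') (h' : N.Iso N') :
    (tensor M N).Iso (tensor M' N') := by
  obtain ⟨e⟩ := h
  obtain ⟨e'⟩ := h'
  refine ⟨.mk (LinearEquiv.ofLinearMap (tmap e.toIntertwiningMap e'.toIntertwiningMap)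
    (tmap e.symm.toIntertwiningMap e'.symm.toIntertwiningMap) ?_ ?_) ?_⟩
  · refine tensor_hom_ext fun m n => ?_
    simp only [LinearMap.comp_apply, tmap_tmk, equiv_symm_right, LinearMap.id_apply]
  · refine tensor_hom_ext fun m n => ?_
    simp only [LinearMap.comp_apply, tmap_tmk, equiv_symm_left, LinearMap.id_apply]
  · intro x
    refine tensor_hom_ext fun m n => ?_
    simp only [LinearMap.comp_apply, LinearEquiv.coe_coe, LinearEquiv.coe_ofLinearMap,
      tmk_act, tmap_tmk, equiv_act]

lemma act_act {Γ : Type v} [Group Γ] (M : FinRep F Γ) (x y : Γ) (m : M.V) :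
    M.ρ x (M.ρ y m) = M.ρ (x * y) m := by
  rw [map_mul]; rfl

lemma act_one {Γ : Type v} [Group Γ] (M : FinRep F Γ) (m : M.V) : M.ρ 1 m = m := by
  rw [map_one]; rfl

lemma act_one' (M : FinRep F (G × G)) (m : M.V) : M.ρ ((1 : G), (1 : G)) m = m :=
  act_one M m

/-- The map `m ⊗ n ↦ (k ↦ m ⊗ (n ⊗ k))`. -/
def assocFwdAux (M N K : FinRep F (G × G)) :
    (tensor M N).V →ₗ[F] K.V →ₗ[F] (tensor M (tensor N K)).V :=
  tlift M N (LinearMap.mk₂ F (fun m n => (tmk M (tensor N K) m).comp (tmk N K n))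
      (fun _ _ _ => by ext; simp) (fun _ _ _ => by ext; simp)
      (fun _ _ _ => by ext; simp) (fun _ _ _ => by ext; simp))
    (fun h m n => by
      ext k
      have := tmk_mid M (tensor N K) h m (tmk N K n k)
      rw [tmk_act, act_one'] at this
      exact this)

lemma assocFwdAux_tmk (M N K : FinRep F (G × G)) (m : M.V) (n : N.V) (k : K.V) :
    assocFwdAux M N K (tmk M N m n) k = tmk M (tensor N K) m (tmk N K n k) := rfl

/-- The map `(m ⊗ n) ⊗ k ↦ m ⊗ (n ⊗ k)`. -/
def assocFwd (M N K : FinRep F (G × G)) :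
    (tensor (tensor M N) K).V →ₗ[F] (tensor M (tensor N K)).V :=
  tlift (tensor M N) K (assocFwdAux M N K) fun h t k => by
    have : (LinearMap.applyₗ (K.ρ (h, 1) k) ∘ₗ assocFwdAux M N K ∘ₗ (tensor M N).ρ (1, h))
        = LinearMap.applyₗ k ∘ₗ assocFwdAux M N K := by
      refine tensor_hom_ext fun m n => ?_
      simp only [LinearMap.comp_apply, LinearMap.applyₗ_apply_apply, tmk_act, act_one',
        assocFwdAux_tmk, tmk_mid]
    exact LinearMap.congr_fun this t

lemma assocFwd_tmk (M N K : FinRep F (G × G)) (m : M.V) (n : N.V) (k : K.V) :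
    assocFwd M N K (tmk (tensor M N) K (tmk M N m n) k)
      = tmk M (tensor N K) m (tmk N K n k) := rfl

/-- The map `m ↦ (n ⊗ k ↦ (m ⊗ n) ⊗ k)`. -/
def assocBwdAux (M N K : FinRep F (G × G)) :
    M.V →ₗ[F] (tensor N K).V →ₗ[F] (tensor (tensor M N) K).V where
  toFun m := tlift N K (tmk (tensor M N) K ∘ₗ tmk M N m) fun h n k => by
    have := tmk_mid (tensor M N) K h (tmk M N m n) k
    rw [tmk_act, act_one'] at this
    exact this
  map_add' m m' := tensor_hom_ext fun n k => by
    simp only [LinearMap.add_apply, tlift_tmk, LinearMap.comp_apply, map_add]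
  map_smul' a m := tensor_hom_ext fun n k => by
    simp only [LinearMap.smul_apply, tlift_tmk, LinearMap.comp_apply, map_smul, RingHom.id_apply]

lemma assocBwdAux_tmk (M N K : FinRep F (G × G)) (m : M.V) (n : N.V) (k : K.V) :
    assocBwdAux M N K m (tmk N K n k) = tmk (tensor M N) K (tmk M N m n) k := rfl

/-- The map `m ⊗ (n ⊗ k) ↦ (m ⊗ n) ⊗ k`. -/
def assocBwd (M N K : FinRep F (G × G)) :
    (tensor M (tensor N K)).V →ₗ[F] (tensor (tensor M N) K).V :=
  tlift M (tensor N K) (assocBwdAux M N K) fun h m t => by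
    have : assocBwdAux M N K (M.ρ (1, h) m) ∘ₗ (tensor N K).ρ (h, 1)
        = assocBwdAux M N K m := by
      refine tensor_hom_ext fun n k => ?_
      simp only [LinearMap.comp_apply, tmk_act, act_one', assocBwdAux_tmk, tmk_mid]
    exact LinearMap.congr_fun this t

lemma assocBwd_tmk (M N K : FinRep F (G × G)) (m : M.V) (n : N.V) (k : K.V) :
    assocBwd M N K (tmk M (tensor N K) m (tmk N K n k))
      = tmk (tensor M N) K (tmk M N m n) k := rfl

lemma tensor_hom_ext_left {M N K : FinRep F (G × G)} {W : Type*} [AddCommGroup W] [Module F W]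
    {f g : (tensor (tensor M N) K).V →ₗ[F] W}
    (h : ∀ m n k, f (tmk _ K (tmk M N m n) k) = g (tmk _ K (tmk M N m n) k)) : f = g := by
  refine tensor_hom_ext fun t k => ?_
  have : (f ∘ₗ (tmk (tensor M N) K).flip k) = g ∘ₗ (tmk (tensor M N) K).flip k :=
    tensor_hom_ext fun m n => h m n k
  exact LinearMap.congr_fun this t

lemma tensor_hom_ext_right {M N K : FinRep F (G × G)} {W : Type*} [AddCommGroup W] [Module F W]
    {f g : (tensor M (tensor N K)).V →ₗ[F] W}
    (h : ∀ m n k, f (tmk M _ m (tmk N K n k)) = g (tmk M _ m (tmk N K n k))) : f = g := by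
  refine tensor_hom_ext fun m t => ?_
  have : (f ∘ₗ tmk M (tensor N K) m) = g ∘ₗ tmk M (tensor N K) m :=
    tensor_hom_ext fun n k => h m n k
  exact LinearMap.congr_fun this t

lemma tensor_assoc (M N K : FinRep F (G × G)) :
    (tensor (tensor M N) K).Iso (tensor M (tensor N K)) := by
  refine ⟨.mk (LinearEquiv.ofLinearMap (assocFwd M N K) (assocBwd M N K) ?_ ?_) ?_⟩
  · refine tensor_hom_ext_right fun m n k => ?_
    simp only [LinearMap.comp_apply, assocBwd_tmk, assocFwd_tmk, LinearMap.id_apply]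
  · refine tensor_hom_ext_left fun m n k => ?_
    simp only [LinearMap.comp_apply, assocBwd_tmk, assocFwd_tmk, LinearMap.id_apply]
  · intro x
    refine tensor_hom_ext_left fun m n k => ?_
    simp only [LinearMap.comp_apply, LinearEquiv.coe_coe, LinearEquiv.coe_ofLinearMap,
      tmk_act, act_one', assocFwd_tmk]

lemma iso_sum_of {Γ : Type v} [Group Γ] {K A B : FinRep F Γ}
    (iA : A.V →ₗ[F] K.V) (iB : B.V →ₗ[F] K.V)
    (pA : K.V →ₗ[F] A.V) (pB : K.V →ₗ[F] B.V)
    (hAA : pA ∘ₗ iA = LinearMap.id) (hBB : pB ∘ₗ iB = LinearMap.id)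
    (hAB : pA ∘ₗ iB = 0) (hBA : pB ∘ₗ iA = 0)
    (hK : iA ∘ₗ pA + iB ∘ₗ pB = LinearMap.id)
    (eA : ∀ x, pA ∘ₗ K.ρ x = A.ρ x ∘ₗ pA) (eB : ∀ x, pB ∘ₗ K.ρ x = B.ρ x ∘ₗ pB) :
    K.Iso (A.sum B) := by
  refine (show Nonempty (K.ρ.Equiv (A.ρ.prod B.ρ)) from ⟨.mk (LinearEquiv.ofLinearMap
    (pA.prod pB) (iA.coprod iB)
      (by rw [LinearMap.prod_comp, LinearMap.comp_coprod, LinearMap.comp_coprod, hAA, hAB, hBA,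
            hBB]
          ext <;> simp)
      (by rw [LinearMap.coprod_comp_prod, hK])) fun x => ?_⟩)
  refine LinearMap.ext fun k => Prod.ext ?_ ?_
  · exact LinearMap.congr_fun (eA x) k
  · exact LinearMap.congr_fun (eB x) k

/-- The first inclusion into a direct sum. -/
def sinl {Γ : Type v} [Group Γ] (M M' : FinRep F Γ) : M.ρ.IntertwiningMap (M.sum M').ρ :=
  Representation.IntertwiningMap.inl F M.ρ M'.ρ

/-- The second inclusion into a direct sum. -/
def sinr {Γ : Type v} [Group Γ] (M M' : FinRep F Γ) : M'.ρ.IntertwiningMap (M.sum M').ρ :=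
  Representation.IntertwiningMap.inr F M.ρ M'.ρ

/-- The first projection from a direct sum. -/
def sfst {Γ : Type v} [Group Γ] (M M' : FinRep F Γ) : (M.sum M').ρ.IntertwiningMap M.ρ :=
  Representation.IntertwiningMap.fst F M.ρ M'.ρ

/-- The second projection from a direct sum. -/
def ssnd {Γ : Type v} [Group Γ] (M M' : FinRep F Γ) : (M.sum M').ρ.IntertwiningMap M'.ρ :=
  Representation.IntertwiningMap.snd F M.ρ M'.ρ

section

variable {Γ : Type v} [Group Γ] (M M' : FinRep F Γ)

lemma sfst_sinl (m : M.V) : (sfst M M').toLinearMap ((sinl M M').toLinearMap m) = m := rfl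

lemma ssnd_sinr (m : M'.V) : (ssnd M M').toLinearMap ((sinr M M').toLinearMap m) = m := rfl

lemma sfst_sinr (m : M'.V) : (sfst M M').toLinearMap ((sinr M M').toLinearMap m) = 0 := rfl

lemma ssnd_sinl (m : M.V) : (ssnd M M').toLinearMap ((sinl M M').toLinearMap m) = 0 := rfl

lemma sum_decomp (t : (M.sum M').V) :
    (sinl M M').toLinearMap ((sfst M M').toLinearMap t)
      + (sinr M M').toLinearMap ((ssnd M M').toLinearMap t) = t :=
  Prod.ext (add_zero _) (zero_add _)

lemma map_act {f : M.ρ.IntertwiningMap M'.ρ} (x : Γ) (m : M.V) :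
    f.toLinearMap (M.ρ x m) = M'.ρ x (f.toLinearMap m) :=
  congrArg (fun l => l m) (f.isIntertwining' x)

end

lemma sum_tensor (M M' N : FinRep F (G × G)) :
    (tensor (M.sum M') N).Iso ((tensor M N).sum (tensor M' N)) := by
  let i : N.ρ.IntertwiningMap N.ρ := .id _
  have hi : ∀ n, i.toLinearMap n = n := fun n => rfl
  refine iso_sum_of (tmap (sinl M M') i) (tmap (sinr M M') i) (tmap (sfst M M') i)
    (tmap (ssnd M M') i) ?_ ?_ ?_ ?_ ?_ ?_ ?_
  all_goals try intro x
  all_goals refine tensor_hom_ext fun m n => ?_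
  all_goals simp only [LinearMap.comp_apply, LinearMap.add_apply, tmap_tmk, tmk_act, map_act, hi,
    sfst_sinl, sfst_sinr, ssnd_sinl, ssnd_sinr, LinearMap.id_apply, map_zero, LinearMap.zero_apply]
  rw [← LinearMap.add_apply, ← map_add, sum_decomp]

lemma tensor_sum (N M M' : FinRep F (G × G)) :
    (tensor N (M.sum M')).Iso ((tensor N M).sum (tensor N M')) := by
  let i : N.ρ.IntertwiningMap N.ρ := .id _
  have hi : ∀ n, i.toLinearMap n = n := fun n => rfl
  refine iso_sum_of (tmap i (sinl M M')) (tmap i (sinr M M')) (tmap i (sfst M M'))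
    (tmap i (ssnd M M')) ?_ ?_ ?_ ?_ ?_ ?_ ?_
  all_goals try intro x
  all_goals refine tensor_hom_ext fun m n => ?_
  all_goals simp only [LinearMap.comp_apply, LinearMap.add_apply, tmap_tmk, tmk_act, map_act, hi,
    sfst_sinl, sfst_sinr, ssnd_sinl, ssnd_sinr, LinearMap.id_apply, map_zero, LinearMap.zero_apply]
  rw [← map_add, sum_decomp]

section Regular

variable [Finite G]

/-- The element `y` of the regular bimodule. -/
def rsingle (F : Type u) {G : Type v} [Field F] [Group G] [Finite G] (y : G) : (regular F G).V :=
  (MonoidAlgebra.single y 1 : MonoidAlgebra F G)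

lemma regular_act (x : G × G) (y : G) :
    (regular F G).ρ x (rsingle F y) = rsingle F (x.1 * y * x.2⁻¹) :=
  MonoidAlgebra.mapDomainLinearMap_single ..

/-- The linear map out of the regular bimodule with prescribed values on group elements. -/
def rlift {W : Type*} [AddCommGroup W] [Module F W] (f : G → W) : (regular F G).V →ₗ[F] W :=
  Finsupp.linearCombination F f ∘ₗ (MonoidAlgebra.coeffLinearEquiv F).toLinearMap

lemma rlift_rsingle {W : Type*} [AddCommGroup W] [Module F W] (f : G → W) (y : G) :
    rlift f (rsingle F y) = f y := by
  change Finsupp.linearCombination F f (Finsupp.single y 1) = f y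
  simp

lemma regular_hom_ext {W : Type*} [AddCommGroup W] [Module F W]
    {f g : (regular F G).V →ₗ[F] W} (h : ∀ y, f (rsingle F y) = g (rsingle F y)) : f = g :=
  MonoidAlgebra.lhom_ext' fun y => LinearMap.ext_ring (h y)

lemma tensor_regular (M : FinRep F (G × G)) : (tensor M (regular F G)).Iso M := by
  let f : M.V →ₗ[F] (regular F G).V →ₗ[F] M.V := (rlift fun x => M.ρ (1, x⁻¹)).flip
  have hf : ∀ m y, f m (rsingle F y) = M.ρ (1, y⁻¹) m := fun m y => by
    simp only [f, LinearMap.flip_apply, rlift_rsingle]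
  have hb : ∀ (h : G) (m : M.V) (n : (regular F G).V),
      f (M.ρ (1, h) m) ((regular F G).ρ (h, 1) n) = f m n := fun h m n => by
    have : f (M.ρ (1, h) m) ∘ₗ (regular F G).ρ (h, 1) = f m := regular_hom_ext fun y => by
      simp only [LinearMap.comp_apply, regular_act, hf, act_act]
      simp
    exact LinearMap.congr_fun this n
  have key : ∀ m y, tmk M (regular F G) (M.ρ (1, y⁻¹) m) (rsingle F 1)
      = tmk M (regular F G) m (rsingle F y) := fun m y => by
    have := tmk_mid M (regular F G) y⁻¹ m (rsingle F y)
    rw [regular_act] at this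
    simpa using this
  refine ⟨.mk (LinearEquiv.ofLinearMap (tlift M (regular F G) f hb)
    ((tmk M (regular F G)).flip (rsingle F 1)) ?_ ?_) fun x => ?_⟩
  · ext m
    simp only [LinearMap.comp_apply, LinearMap.flip_apply, tlift_tmk, hf, inv_one, act_one',
      LinearMap.id_apply]
  · refine tensor_hom_ext fun m n => ?_
    simp only [LinearMap.comp_apply, LinearMap.flip_apply, tlift_tmk, LinearMap.id_apply]
    have : (tmk M (regular F G)).flip (rsingle F 1) ∘ₗ f m = tmk M (regular F G) m :=
      regular_hom_ext fun y => by
        simp only [LinearMap.comp_apply, LinearMap.flip_apply, hf, key]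
    exact LinearMap.congr_fun this n
  · refine tensor_hom_ext fun m n => ?_
    simp only [LinearMap.comp_apply, LinearEquiv.coe_coe, LinearEquiv.coe_ofLinearMap, tmk_act,
      tlift_tmk]
    have : f (M.ρ (x.1, 1) m) ∘ₗ (regular F G).ρ (1, x.2) = M.ρ x ∘ₗ f m :=
      regular_hom_ext fun y => by
        obtain ⟨x₁, x₂⟩ := x
        simp only [LinearMap.comp_apply, regular_act, hf, act_act]
        simp
    exact LinearMap.congr_fun this n

lemma regular_tensor (M : FinRep F (G × G)) : (tensor (regular F G) M).Iso M := by
  let f : (regular F G).V →ₗ[F] M.V →ₗ[F] M.V := rlift fun x => M.ρ (x, 1)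
  have hf : ∀ y m, f (rsingle F y) m = M.ρ (y, 1) m := fun y m => by
    simp only [f, rlift_rsingle]
  have hb : ∀ (h : G) (n : (regular F G).V) (m : M.V),
      f ((regular F G).ρ (1, h) n) (M.ρ (h, 1) m) = f n m := fun h n m => by
    have : f.flip (M.ρ (h, 1) m) ∘ₗ (regular F G).ρ (1, h) = f.flip m :=
      regular_hom_ext fun y => by
        simp only [LinearMap.comp_apply, LinearMap.flip_apply, regular_act, hf, act_act]
        simp
    exact LinearMap.congr_fun this n
  have key : ∀ m y, tmk (regular F G) M (rsingle F 1) (M.ρ (y, 1) m)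
      = tmk (regular F G) M (rsingle F y) m := fun m y => by
    have := tmk_mid (regular F G) M y (rsingle F y) m
    rw [regular_act] at this
    simpa using this
  refine ⟨.mk (LinearEquiv.ofLinearMap (tlift (regular F G) M f hb)
    (tmk (regular F G) M (rsingle F 1)) ?_ ?_) fun x => ?_⟩
  · ext m
    simp only [LinearMap.comp_apply, tlift_tmk, hf, act_one', LinearMap.id_apply]
  · refine tensor_hom_ext fun n m => ?_
    simp only [LinearMap.comp_apply, tlift_tmk, LinearMap.id_apply]
    have : tmk (regular F G) M (rsingle F 1) ∘ₗ f.flip m = (tmk (regular F G) M).flip m :=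
      regular_hom_ext fun y => by
        simp only [LinearMap.comp_apply, LinearMap.flip_apply, hf, key]
    exact LinearMap.congr_fun this n
  · refine tensor_hom_ext fun n m => ?_
    simp only [LinearMap.comp_apply, LinearEquiv.coe_coe, LinearEquiv.coe_ofLinearMap, tmk_act,
      tlift_tmk]
    have : f.flip (M.ρ (1, x.2) m) ∘ₗ (regular F G).ρ (x.1, 1) = M.ρ x ∘ₗ f.flip m :=
      regular_hom_ext fun y => by
        obtain ⟨x₁, x₂⟩ := x
        simp only [LinearMap.comp_apply, LinearMap.flip_apply, regular_act, hf, act_act]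
        simp
    exact LinearMap.congr_fun this n

end Regular

end Bimodule

/-! ### The representation ring of bimodules -/

section GreenRing

variable (F : Type u) (G : Type v) [Field F] [Group G] [Finite G]

instance isoSetoid : Setoid (FinRep F (G × G)) where
  r := FinRep.Iso
  iseqv := ⟨FinRep.Iso.refl, FinRep.Iso.symm, FinRep.Iso.trans⟩

/-- Isomorphism classes of finitely generated `(FG, FG)`-bimodules. -/
def IsoClass : Type (max u v + 1) := Quotient (isoSetoid F G)

/-- The tensor product over `FG` makes the isomorphism classes of bimodules a monoid. -/
instance : Monoid (IsoClass F G) where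
  mul := Quotient.map₂ tensor fun _ _ h _ _ h' => tensor_congr h h'
  one := Quotient.mk _ (regular F G)
  mul_assoc := by
    rintro ⟨M⟩ ⟨N⟩ ⟨K⟩
    exact Quotient.sound (tensor_assoc M N K)
  one_mul := by
    rintro ⟨M⟩
    exact Quotient.sound (regular_tensor M)
  mul_one := by
    rintro ⟨M⟩
    exact Quotient.sound (tensor_regular M)

variable {F G} in
/-- The basis element of `ℤ[iso classes]` given by a bimodule. -/
def preCls (M : FinRep F (G × G)) : FreeAbelianGroup (IsoClass F G) :=
  FreeAbelianGroup.of (Quotient.mk _ M)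

/-- The subgroup generated by all `[M ⊕ N] - [M] - [N]`. -/
def sumRel : AddSubgroup (FreeAbelianGroup (IsoClass F G)) :=
  AddSubgroup.closure {x | ∃ M N : FinRep F (G × G), x = preCls (M.sum N) - preCls M - preCls N}

variable {F G}

lemma preCls_mul (M N : FinRep F (G × G)) : preCls M * preCls N = preCls (tensor M N) :=
  FreeAbelianGroup.of_mul_of ..

lemma preCls_congr {M N : FinRep F (G × G)} (h : M.Iso N) : preCls M = preCls N :=
  congrArg FreeAbelianGroup.of (Quotient.sound h)

lemma preCls_sum_mem (M N : FinRep F (G × G)) :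
    preCls (M.sum N) - preCls M - preCls N ∈ sumRel F G :=
  AddSubgroup.subset_closure ⟨M, N, rfl⟩

lemma sumRel_mul_left (x : FreeAbelianGroup (IsoClass F G)) {y : FreeAbelianGroup (IsoClass F G)}
    (hy : y ∈ sumRel F G) : x * y ∈ sumRel F G := by
  have hof : ∀ c : IsoClass F G, FreeAbelianGroup.of c * y ∈ sumRel F G := by
    rintro ⟨K⟩
    change preCls K * y ∈ _
    induction hy using AddSubgroup.closure_induction with
    | zero => rw [mul_zero]; exact zero_mem _
    | add a b _ _ ha hb => rw [mul_add]; exact add_mem ha hb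
    | neg a _ ha => rw [mul_neg]; exact neg_mem ha
    | mem a ha =>
      obtain ⟨M, N, rfl⟩ := ha
      rw [mul_sub, mul_sub, preCls_mul, preCls_mul, preCls_mul, preCls_congr (tensor_sum K M N)]
      exact preCls_sum_mem _ _
  induction x using FreeAbelianGroup.induction_on with
  | zero => rw [zero_mul]; exact zero_mem _
  | neg x h => rw [neg_mul]; exact neg_mem h
  | of x => exact hof x
  | add x y hx hy => rw [add_mul]; exact add_mem hx hy

lemma sumRel_mul_right {x : FreeAbelianGroup (IsoClass F G)} (hx : x ∈ sumRel F G)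
    (y : FreeAbelianGroup (IsoClass F G)) : x * y ∈ sumRel F G := by
  have hof : ∀ c : IsoClass F G, x * FreeAbelianGroup.of c ∈ sumRel F G := by
    rintro ⟨K⟩
    change x * preCls K ∈ _
    induction hx using AddSubgroup.closure_induction with
    | zero => rw [zero_mul]; exact zero_mem _
    | add a b _ _ ha hb => rw [add_mul]; exact add_mem ha hb
    | neg a _ ha => rw [neg_mul]; exact neg_mem ha
    | mem a ha =>
      obtain ⟨M, N, rfl⟩ := ha
      rw [sub_mul, sub_mul, preCls_mul, preCls_mul, preCls_mul, preCls_congr (sum_tensor M N K)]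
      exact preCls_sum_mem _ _
  induction y using FreeAbelianGroup.induction_on with
  | zero => rw [mul_zero]; exact zero_mem _
  | neg x h => rw [mul_neg]; exact neg_mem h
  | of x => exact hof x
  | add x y hx hy => rw [mul_add]; exact add_mem hx hy

variable (F G)

/-- `sumRel` as a two-sided ideal of `ℤ[iso classes]`. -/
def splitIdeal : TwoSidedIdeal (FreeAbelianGroup (IsoClass F G)) :=
  .mk' (sumRel F G : Set _) (zero_mem _) (fun h h' => add_mem h h') (fun h => neg_mem h)
    (fun {x _} h => sumRel_mul_left x h) (fun {_ y} h => sumRel_mul_right h y)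

/-- The representation ring (split Grothendieck ring) of finitely generated
`(FG, FG)`-bimodules: the abelian group generated by the classes `[M]` with relations
`[M ⊕ N] = [M] + [N]`, and with product `[M] · [N] = [M ⊗_{FG} N]`. By the Krull-Schmidt theorem
its additive group is free on the classes of indecomposable bimodules. -/
def BimodRing : Type (max u v + 1) := (splitIdeal F G).ringCon.Quotient

instance : Ring (BimodRing F G) := inferInstanceAs (Ring (splitIdeal F G).ringCon.Quotient)

variable {F G}

/-- The class `[M]` of a bimodule. -/
def cls (M : FinRep F (G × G)) : BimodRing F G := (splitIdeal F G).ringCon.mk' (preCls M)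

lemma cls_mul (M N : FinRep F (G × G)) : cls M * cls N = cls (tensor M N) := by
  rw [cls, cls, cls, ← preCls_mul, map_mul]; rfl

lemma cls_regular : cls (regular F G) = 1 := map_one (splitIdeal F G).ringCon.mk'

lemma cls_sum (M N : FinRep F (G × G)) : cls (M.sum N) = cls M + cls N := by
  have h : (splitIdeal F G).ringCon (preCls (M.sum N)) (preCls M + preCls N) := by
    rw [TwoSidedIdeal.rel_iff, splitIdeal, TwoSidedIdeal.mem_mk', ← sub_sub]
    exact preCls_sum_mem M N
  exact ((RingCon.eq _).2 h).trans (map_add (splitIdeal F G).ringCon.mk' _ _)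

lemma cls_congr {M N : FinRep F (G × G)} (h : M.Iso N) : cls M = cls N :=
  congrArg (splitIdeal F G).ringCon.mk' (preCls_congr h)

/-- The twisted diagonal `p`-subgroups `Δ(P, φ, Q) = {(φ(y), y) | y ∈ Q}` of `G × G`, for
`p`-subgroups `P, Q` of `G` and an isomorphism `φ : Q → P`. -/
def IsTwistedDiagonal (p : ℕ) (X : Subgroup (G × G)) : Prop :=
  ∃ (P Q : Subgroup G) (φ : Q ≃* P), IsPGroup p P ∧ IsPGroup p Q ∧
    ∀ x : G × G, x ∈ X ↔ ∃ y : Q, x = ((φ y : G), (y : G))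

variable (F G)

/-- `T^Δ(FG, FG)`: the `ℤ`-span of the classes of indecomposable `p`-permutation bimodules with
twisted diagonal vertices. -/
def TDelta (p : ℕ) : AddSubgroup (BimodRing F G) :=
  AddSubgroup.closure {x | ∃ M : FinRep F (G × G), M.Indecomposable ∧ M.PPermutation p ∧
    (∃ X, M.IsVertex X ∧ IsTwistedDiagonal p X) ∧ x = cls M}

/-- `T^Δ_i(FG, FG)`: the `ℤ`-span of the classes of indecomposable `p`-permutation bimodules with
twisted diagonal vertices of order `p ^ i`. -/
def TDeltaLevel (p i : ℕ) : AddSubgroup (BimodRing F G) :=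
  AddSubgroup.closure {x | ∃ M : FinRep F (G × G), M.Indecomposable ∧ M.PPermutation p ∧
    (∃ X, M.IsVertex X ∧ IsTwistedDiagonal p X ∧ Nat.card X = p ^ i) ∧ x = cls M}

/-- `Pr(FG, FG)`: the `ℤ`-span of the classes of projective indecomposable bimodules. -/
def Pr : AddSubgroup (BimodRing F G) :=
  AddSubgroup.closure {x | ∃ M : FinRep F (G × G), M.Indecomposable ∧ M.Projective ∧ x = cls M}

end GreenRing

/-! ### Twisted rings -/

/-- For a ring `R` and `c : R`, the ring `R_c` has the same elements and addition as `R`, and the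
multiplication `a ·_c b = a c b`. -/
def Twisted {R : Type*} [Ring R] (_c : R) : Type _ := R

namespace Twisted

variable {R : Type*} [Ring R] (c : R)

instance : AddCommGroup (Twisted c) := inferInstanceAs (AddCommGroup R)

/-- The identity map `R → R_c`. -/
def of : R ≃+ Twisted c := AddEquiv.refl R

instance : NonUnitalRing (Twisted c) where
  mul a b := of c ((of c).symm a * c * (of c).symm b)
  left_distrib a b d :=
    (show ∀ a b d : R, a * c * (b + d) = a * c * b + a * c * d from fun _ _ _ => mul_add _ _ _)
      a b d
  right_distrib a b d :=
    (show ∀ a b d : R, (a + b) * c * d = a * c * d + b * c * d from fun _ _ _ => by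
      rw [add_mul, add_mul]) a b d
  zero_mul a := (show ∀ a : R, 0 * c * a = 0 from fun _ => by rw [zero_mul, zero_mul]) a
  mul_zero a := (show ∀ a : R, a * c * 0 = 0 from fun _ => mul_zero _) a
  mul_assoc a b d :=
    (show ∀ a b d : R, a * c * b * c * d = a * c * (b * c * d) from fun _ _ _ => by
      simp only [mul_assoc]) a b d

lemma of_mul (a b : R) : of c a * of c b = of c (a * c * b) := rfl

end Twisted

/-- The element `(1, 1) + m ∑_{x ∈ X} (1, x)` of `ℤ[Γ × X]`. -/
def twistElt (Γ X : Type*) [Group Γ] [Group X] [Fintype X] (m : ℤ) : MonoidAlgebra ℤ (Γ × X) :=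
  1 + m • ∑ x : X, MonoidAlgebra.single (1, x) 1

/-- The matrix `I + m E`, where all entries of `E` are `1`. -/
def starCartan (X : Type*) [DecidableEq X] (m : ℤ) : Matrix X X ℤ :=
  1 + m • Matrix.of fun _ _ => 1

/-! ### The group `D ⋊ E` -/

section Special

lemma mulAut_comm {C : Type*} [Group C] [IsCyclic C] (a b : MulAut C) : a * b = b * a :=
  (IsCyclic.mulAutMulEquiv C).injective (by rw [map_mul, map_mul, mul_comm])

instance normal_mulAut {C : Type*} [Group C] [IsCyclic C] (H : Subgroup (MulAut C)) : H.Normal :=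
  ⟨fun a ha g => by rwa [mulAut_comm g a, mul_inv_cancel_right]⟩

variable {D : Type v} [CommGroup D]

/-- `G = D ⋊ E` for `E ≤ Aut(D)`, with `(x, ρ)(y, σ) = (x ρ(y), ρ σ)`. -/
abbrev SD (E : Subgroup (MulAut D)) : Type v := D ⋊[E.subtype] E

instance [Finite D] (E : Subgroup (MulAut D)) : Finite (SD E) :=
  Finite.of_equiv _ SemidirectProduct.equivProd.symm

variable (D) in
/-- `D_i = {x ∈ D | x ^ (p ^ i) = 1}`; for `D` cyclic of order `p ^ n` and `i ≤ n` this is the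
unique subgroup of `D` of order `p ^ i`. -/
def level (p i : ℕ) : Subgroup D := (powMonoidHom (p ^ i)).ker

lemma mem_level {p i : ℕ} {x : D} : x ∈ level D p i ↔ x ^ p ^ i = 1 := Iff.rfl

instance (p i : ℕ) : (level D p i).Characteristic :=
  Subgroup.characteristic_iff_le_comap.2 fun φ x hx => by
    rw [mem_level] at hx
    change φ x ∈ level D p i
    rw [mem_level, ← map_pow, hx, map_one]

lemma level_mono {p k i : ℕ} (h : k ≤ i) : level D p k ≤ level D p i := fun x hx => by
  rw [mem_level] at hx ⊢
  obtain ⟨j, rfl⟩ := Nat.exists_eq_add_of_le h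
  rw [pow_add, pow_mul, hx, one_pow]

/-- The restriction map `π_i : Aut(D) → Aut(D_i)`. -/
def resTop (p i : ℕ) : MulAut D →* MulAut (level D p i) := MulAut.characteristic (level D p i)

lemma aut_mem {p i k : ℕ} (α : MulAut (level D p i)) {x : D} (hi : x ∈ level D p i)
    (hk : x ∈ level D p k) : (α ⟨x, hi⟩ : D) ∈ level D p k := by
  rw [mem_level] at hk ⊢
  have h : (⟨x, hi⟩ : level D p i) ^ p ^ k = 1 := Subtype.ext hk
  have h' := congrArg α h
  rw [map_pow, map_one] at h'
  exact congrArg Subtype.val h'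

/-- The restriction `α|_{D_k}` of `α ∈ Aut(D_i)` for `k ≤ i`. -/
def res {p i k : ℕ} (h : k ≤ i) (α : MulAut (level D p i)) : MulAut (level D p k) where
  toFun x := ⟨α ⟨x, level_mono h x.2⟩, aut_mem α _ x.2⟩
  invFun x := ⟨α⁻¹ ⟨x, level_mono h x.2⟩, aut_mem α⁻¹ _ x.2⟩
  left_inv x := Subtype.ext (by simp)
  right_inv x := Subtype.ext (by simp)
  map_mul' x y := Subtype.ext (congrArg (fun z : level D p i => (z : D))
    (map_mul α ⟨x, level_mono h x.2⟩ ⟨y, level_mono h y.2⟩))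

variable {F : Type u} [Field F] [IsCyclic D] {E : Subgroup (MulAut D)}

/-- The group `Ê = Hom(E, Fˣ)` of linear characters is finite. -/
instance fintypeHat [Finite D] : Fintype (E →* Fˣ) := Fintype.ofFinite _

instance decidableEqHat : DecidableEq (E →* Fˣ) := Classical.decEq _

/-- `Δ(D_i, α, D_i) = {(α(x), x) | x ∈ D_i}` as a subgroup of `G × G`, where `G = D ⋊ E`. -/
def diag (E : Subgroup (MulAut D)) {p i : ℕ} (α : MulAut (level D p i)) :
    Subgroup (SD E × SD E) where
  carrier := {g | ∃ x : level D p i, g = (⟨(α x : D), 1⟩, ⟨(x : D), 1⟩)}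
  one_mem' := ⟨1, by simp; rfl⟩
  mul_mem' := by
    rintro _ _ ⟨x, rfl⟩ ⟨y, rfl⟩
    exact ⟨x * y, by ext <;> simp⟩
  inv_mem' := by
    rintro _ ⟨x, rfl⟩
    exact ⟨x⁻¹, by ext <;> simp⟩

lemma aut_comm {p i : ℕ} (α : MulAut (level D p i)) (ρ : MulAut D) (x : level D p i) :
    (α (resTop p i ρ x) : D) = ρ (α x) :=
  congrArg (fun a : MulAut (level D p i) => (a x : D)) (mulAut_comm α (resTop p i ρ))

/-- `Δ(D_i E, α̃, D_i E) = {(α(x)ρ, xρ) | x ∈ D_i, ρ ∈ E}` as a subgroup of `G × G`, where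
`G = D ⋊ E`. -/
def diagE (E : Subgroup (MulAut D)) {p i : ℕ} (α : MulAut (level D p i)) :
    Subgroup (SD E × SD E) where
  carrier := {g | ∃ (x : level D p i) (ρ : E), g = (⟨(α x : D), ρ⟩, ⟨(x : D), ρ⟩)}
  one_mem' := ⟨1, 1, by simp; rfl⟩
  mul_mem' := by
    rintro _ _ ⟨x, ρ, rfl⟩ ⟨y, σ, rfl⟩
    refine ⟨x * resTop p i ρ y, ρ * σ, ?_⟩
    have := aut_comm α ρ y
    ext <;> simp [this] <;> rfl
  inv_mem' := by
    rintro _ ⟨x, ρ, rfl⟩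
    refine ⟨resTop p i (ρ⁻¹ : E) x⁻¹, ρ⁻¹, ?_⟩
    have := aut_comm α (ρ⁻¹ : E) x⁻¹
    ext
    · rw [this]; simp
    · simp
    · simp; rfl
    · simp

variable [Finite D]

/-- `P_λ = Ind_E^G (F_λ)`. -/
def projOne (lam : E →* Fˣ) : FinRep F (SD E) :=
  indChar (SemidirectProduct.inr : E →* SD E) lam

/-- `P_{λ,μ} = P_λ ⊗_F P_{μ⁻¹}`. -/
def projBi (lam mu : E →* Fˣ) : FinRep F (SD E × SD E) :=
  outerTensor (projOne lam) (projOne mu⁻¹)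

/-- `M_{i,α,λ}`: the module induced to `G × G` from the one-dimensional module of
`Δ(D_i E, α̃, D_i E)` on which `(α(x)ρ, xρ)` acts as `λ(ρ)`. -/
def trivSrc {p i : ℕ} (α : MulAut (level D p i)) (lam : E →* Fˣ) : FinRep F (SD E × SD E) :=
  indChar (diagE E α).subtype
    (lam.comp (SemidirectProduct.rightHom.comp ((MonoidHom.fst _ _).comp (diagE E α).subtype)))

end Special

end

end TrivialSource

/-!
All modules in question are of the form `Ind_H^Γ (F_Θ)` for a linear character `Θ` of a subgroup
`H` of `Γ = G × G` (`monoRep`). A module is recognised as a direct sum of such induced modules by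
exhibiting generators on which the subgroups act through linear characters, together with
functionals separating their translates (`exists_biproduct_mono`); no dimensions are counted.

The source of all local information is the following situation (`Isolates`). Let `S` be a normal
`p`-subgroup of `Γ` and `Q ≤ S ∩ H` a subgroup that lies in no conjugate of `H` other than the
evident ones, by elements of `S H`. Since a `p`-group has nonzero fixed points in characteristic
`p`, proper submodules are killed by nonzero `S`-invariant functionals; and counting orbits of `Q`
shows that on the `Q`-fixed vectors of `Ind_H^Γ (F_Θ)` all `S`-invariant functionals are multiples
of a single one (`functional_eq_zero`, `Isolates.functional_eq`). Hence the module is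
indecomposable, it determines `Θ`, and it determines into which subgroups `Q` can be conjugated
(`Isolates.indecomposable`, `Isolates.char_eq`, `Isolates.exists_conj`). The same functional gives
the multiplicity of the module as a direct summand of any other one, as an additive function on
the representation ring. So the classes of such modules are linearly independent
(`linearIndependent_cls`).

This applies to `S = D × D`, to the twisted diagonal subgroup `Q = {(α(x), x) | x ∈ D_i}`, and to
`H = {(α(x)ρ, xσ) | x ∈ D_i}`, where `ρ` and `σ` are elements of `E` with the same restriction to
`D_i`. For `i = 0` the induced modules are the `P_{λ,μ}`. For `i ≥ 1` the group `E` acts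
faithfully on `D_i`, so that `ρ = σ`, and the induced modules are the `M_{i,α,λ}`. Both families
are treated together as `src α θ`.

A `p`-permutation module that is relatively projective to a twisted diagonal subgroup `Q` is a
direct summand of a sum of modules `Ind_R^Γ F` with `R ≤ Q`. Here `R` is again a twisted diagonal
subgroup. The group `E` is abelian of order prime to `p`, and it has a faithful linear character
over `F`, namely its action on `D / D^p`; so it has `|E|` linear characters, and `Ind_R^Γ F` is a
sum of modules `src α θ` (`exists_biproduct_of_complement`, `CoprimeAction.src_isSummand_and`). An
indecomposable summand of a direct sum of indecomposable modules is isomorphic to one of them, by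
Fitting's lemma; this gives the classification (`CoprimeAction.exists_iso_src`), and then the
vertices.

Tensor products over `FG` are computed by a Mackey formula (`exists_biproduct_tensor`). With `l`
the larger of the two indices involved, the double cosets that occur are the trivial one and the
`E`-orbits of nontrivial elements of `D / D_l`. The action of `E` on the latter is free, because a
nontrivial element of `E` raises the elements of `D` to a power whose exponent is not `1` modulo
`p`. So there are `m_l = (p^(n-l) - 1) / |E|` of these orbits (`CoprimeAction.card_orbits`), and
each contributes the module induced from a smaller group, where the component in the middle factor
`E` is required to be trivial (`CoprimeAction.cls_twRep_mul`). Decomposing these modules further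
yields the product formulas. As the classes multiply like the bases of the twisted matrix and
group rings, the ring isomorphisms are formal (`exists_ringEquiv_of_basis`).
-/

namespace TrivialSource

noncomputable section

set_option linter.unusedSectionVars false

open scoped TensorProduct

/-! ### Modules induced from linear characters -/

section Induced

variable {F : Type u} {Γ : Type v} [Field F] [Group Γ]

lemma charRep_apply {Δ : Type*} [Group Δ] (χ : Δ →* Fˣ) (h : Δ) (a : F) :
    charRep χ h a = (χ h : F) * a := rfl

/-- The universal property of induction: linear maps out of `Ind_φ σ` are families of linear maps
indexed by `Γ` that are compatible with the action of the smaller group. -/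
def indLift {Δ : Type*} [Group Δ] (φ : Δ →* Γ) {A W : Type*} [AddCommGroup A] [Module F A]
    [AddCommGroup W] [Module F W] (σ : Representation F Δ A) (f : Γ → A →ₗ[F] W)
    (hf : ∀ h g, f (φ h * g) ∘ₗ σ h = f g) : Representation.IndV φ σ →ₗ[F] W :=
  Representation.Coinvariants.lift _
    (TensorProduct.lift <| (Finsupp.lift _ _ _ f) ∘ₗ
      (MonoidAlgebra.coeffLinearEquiv F).toLinearMap)
    fun h => by
      ext g x
      have := LinearMap.congr_fun (hf h g) x
      simpa using this

lemma indLift_mk {Δ : Type*} [Group Δ] (φ : Δ →* Γ) {A W : Type*} [AddCommGroup A] [Module F A]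
    [AddCommGroup W] [Module F W] (σ : Representation F Δ A) (f : Γ → A →ₗ[F] W)
    (hf : ∀ h g, f (φ h * g) ∘ₗ σ h = f g) (g : Γ) (a : A) :
    indLift φ σ f hf (Representation.IndV.mk φ σ g a) = f g a := by
  simp [indLift]

lemma indV_mk_mul {Δ : Type*} [Group Δ] (φ : Δ →* Γ) {A : Type*} [AddCommGroup A] [Module F A]
    (σ : Representation F Δ A) (h : Δ) (g : Γ) (a : A) :
    Representation.IndV.mk φ σ (φ h * g) (σ h a) = Representation.IndV.mk φ σ g a := by
  have := Representation.Coinvariants.mk_self_apply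
    (Representation.tprod ((Representation.leftRegular F Γ).comp φ) σ) h
    ((MonoidAlgebra.single g 1) ⊗ₜ a)
  simpa using this

variable [Finite Γ]

/-- The module `Ind_H^Γ (F_Θ)` for a linear character `Θ` of `Γ` restricted to `H`. -/
def monoRep (H : Subgroup Γ) (Θ : Γ →* Fˣ) : FinRep F Γ :=
  indChar H.subtype (Θ.comp H.subtype)

/-- The vector `g ⊗ 1` of `Ind_H^Γ (F_Θ) = FΓ ⊗_{FH} F_Θ`. -/
def ev (H : Subgroup Γ) (Θ : Γ →* Fˣ) (g : Γ) : (monoRep H Θ).V :=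
  Representation.IndV.mk H.subtype (charRep (Θ.comp H.subtype)) g⁻¹ 1

variable (H : Subgroup Γ) (Θ : Γ →* Fˣ)

lemma ev_act (x g : Γ) : (monoRep H Θ).ρ x (ev H Θ g) = ev H Θ (x * g) := by
  unfold ev
  rw [mul_inv_rev]
  exact Representation.ind_mk H.subtype (charRep (Θ.comp H.subtype)) x g⁻¹ 1

lemma act_ev_one (x : Γ) : (monoRep H Θ).ρ x (ev H Θ 1) = ev H Θ x := by
  rw [ev_act, mul_one]

variable {H} in
lemma ev_mul (g : Γ) {h : Γ} (hh : h ∈ H) : ev H Θ (g * h) = (Θ h : F) • ev H Θ g := by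
  have := indV_mk_mul H.subtype (charRep (Θ.comp H.subtype)) ⟨h, hh⟩ (h⁻¹ * g⁻¹) (1 : F)
  unfold ev
  rw [mul_inv_rev, ← this]
  simp only [Subgroup.subtype_apply, mul_inv_cancel_left, charRep_apply]
  rw [← smul_eq_mul, map_smul]
  rfl

variable {H} in
lemma act_ev_of_mem {h : Γ} (hh : h ∈ H) :
    (monoRep H Θ).ρ h (ev H Θ 1) = (Θ h : F) • ev H Θ 1 := by
  rw [act_ev_one, ← one_mul h, ev_mul Θ 1 hh, one_mul]

/-- A linear map out of `Ind_H^Γ (F_Θ)` with prescribed values on the vectors `g ⊗ 1`. -/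
def monoLift {W : Type*} [AddCommGroup W] [Module F W] (f : Γ → W)
    (hf : ∀ g, ∀ h ∈ H, f (g * h) = (Θ h : F) • f g) : (monoRep H Θ).V →ₗ[F] W :=
  indLift H.subtype (charRep (Θ.comp H.subtype))
    (fun g => (LinearMap.toSpanSingleton F W (f g⁻¹))) fun h g => by
      ext
      have := hf (g⁻¹ * (h : Γ)⁻¹) h h.2
      rw [inv_mul_cancel_right] at this
      simp [charRep_apply, this]

lemma monoLift_ev {W : Type*} [AddCommGroup W] [Module F W] (f : Γ → W)
    (hf : ∀ g, ∀ h ∈ H, f (g * h) = (Θ h : F) • f g) (g : Γ) :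
    monoLift H Θ f hf (ev H Θ g) = f g :=
  (indLift_mk H.subtype _ _ _ g⁻¹ 1).trans (by simp)

variable {H Θ} in
lemma mono_hom_ext {W : Type*} [AddCommGroup W] [Module F W] {f g : (monoRep H Θ).V →ₗ[F] W}
    (h : ∀ x, f (ev H Θ x) = g (ev H Θ x)) : f = g := by
  refine Representation.IndV.hom_ext _ _ fun x => ?_
  ext
  have := h x⁻¹
  unfold ev at this
  rwa [inv_inv] at this

lemma monoRep_eq : monoRep H Θ = indChar H.subtype (Θ.comp H.subtype) := rfl

attribute [irreducible] monoRep ev monoLift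

/-- The linear map underlying `monoHom`. -/
def monoHomAux (M : FinRep F Γ) (m : M.V) (hm : ∀ h ∈ H, M.ρ h m = (Θ h : F) • m) :
    (monoRep H Θ).V →ₗ[F] M.V :=
  monoLift H Θ (fun g => M.ρ g m) fun g h hh => by
    rw [← act_act, hm h hh, map_smul]

/-- Frobenius reciprocity: a vector on which `H` acts through `Θ` defines a map out of
`Ind_H^Γ (F_Θ)`. -/
def monoHom (M : FinRep F Γ) (m : M.V) (hm : ∀ h ∈ H, M.ρ h m = (Θ h : F) • m) :
    (monoRep H Θ).ρ.IntertwiningMap M.ρ where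
  toLinearMap := monoHomAux H Θ M m hm
  isIntertwining' x := mono_hom_ext fun g => by
    rw [LinearMap.comp_apply, LinearMap.comp_apply, ev_act, monoHomAux, monoLift_ev, monoLift_ev,
      act_act]

lemma monoHom_ev (M : FinRep F Γ) (m : M.V) (hm : ∀ h ∈ H, M.ρ h m = (Θ h : F) • m) (g : Γ) :
    (monoHom H Θ M m hm).toLinearMap (ev H Θ g) = M.ρ g m :=
  monoLift_ev H Θ (fun g => M.ρ g m) _ g

open Classical in
/-- The coordinate functional of the vector `1 ⊗ 1`. -/
def monoDelta : (monoRep H Θ).V →ₗ[F] F :=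
  monoLift H Θ (fun g => if g ∈ H then (Θ g : F) else 0) fun g h hh => by
    by_cases hg : g ∈ H
    · rw [if_pos (mul_mem hg hh), if_pos hg, map_mul, Units.val_mul, smul_eq_mul, mul_comm]
    · rw [if_neg hg, if_neg (fun h' => hg ((H.mul_mem_cancel_right hh).1 h')), smul_zero]

variable {H} in
lemma monoDelta_of_mem {g : Γ} (hg : g ∈ H) : monoDelta H Θ (ev H Θ g) = Θ g := by
  rw [monoDelta, monoLift_ev, if_pos hg]

variable {H} in
lemma monoDelta_of_notMem {g : Γ} (hg : g ∉ H) : monoDelta H Θ (ev H Θ g) = 0 := by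
  rw [monoDelta, monoLift_ev, if_neg hg]

lemma ev_ne_zero : ev H Θ 1 ≠ 0 := fun h => by
  have := monoDelta_of_mem Θ (one_mem H)
  rw [h, map_zero, map_one] at this
  exact zero_ne_one this

instance : Nontrivial (monoRep H Θ).V := ⟨_, _, ev_ne_zero H Θ⟩

instance fintypeCosets : Fintype (Γ ⧸ H) := Fintype.ofFinite _

/-- The expansion of a vector of `Ind_H^Γ (F_Θ)` in the basis given by coset representatives. -/
lemma mono_expand (m : (monoRep H Θ).V) :
    m = ∑ y : Γ ⧸ H, monoDelta H Θ ((monoRep H Θ).ρ (y.out)⁻¹ m) • ev H Θ y.out := by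
  have : LinearMap.id = ∑ y : Γ ⧸ H, ((monoDelta H Θ) ∘ₗ (monoRep H Θ).ρ (y.out)⁻¹).smulRight
      (ev H Θ y.out) := mono_hom_ext fun g => by
    rw [LinearMap.sum_apply, Finset.sum_eq_single (g : Γ ⧸ H)]
    · obtain ⟨h, hh⟩ := QuotientGroup.mk_out_eq_mul H g
      rw [hh]
      simp only [LinearMap.smulRight_apply, LinearMap.comp_apply, ev_act, LinearMap.id_apply]
      rw [ev_mul Θ g h.2, mul_inv_rev, inv_mul_cancel_right,
        monoDelta_of_mem Θ (inv_mem h.2), smul_smul, ← Units.val_mul, ← map_mul]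
      simp
    · intro y _ hy
      simp only [LinearMap.smulRight_apply, LinearMap.comp_apply, ev_act]
      rw [monoDelta_of_notMem, zero_smul]
      intro h
      apply hy
      rw [← QuotientGroup.eq, QuotientGroup.out_eq'] at h
      exact h
    · simp
  simpa using LinearMap.congr_fun this m

lemma mono_ext {m : (monoRep H Θ).V}
    (h : ∀ g, monoDelta H Θ ((monoRep H Θ).ρ g⁻¹ m) = 0) : m = 0 := by
  rw [mono_expand H Θ m]
  exact Finset.sum_eq_zero fun y _ => by rw [h, zero_smul]

end Induced

/-! ### Finite direct sums -/

section Biproduct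

variable {F : Type u} {Γ : Type v} [Field F] [Group Γ]

/-- The data of an isomorphism between `M` and the direct sum of the finite family `X`. -/
structure Biproduct (M : FinRep F Γ) {ι : Type*} [Fintype ι] (X : ι → FinRep F Γ) where
  inc : ∀ t, (X t).ρ.IntertwiningMap M.ρ
  proj : ∀ t, M.ρ.IntertwiningMap (X t).ρ
  proj_inc_same : ∀ t x, (proj t).toLinearMap ((inc t).toLinearMap x) = x
  proj_inc_ne : ∀ s t, s ≠ t → ∀ x, (proj s).toLinearMap ((inc t).toLinearMap x) = 0
  sum_inc_proj : ∀ m, ∑ t, (inc t).toLinearMap ((proj t).toLinearMap m) = m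

/-- A subrepresentation as a finitely generated module. -/
def subRep {M : FinRep F Γ} (U : Subrepresentation M.ρ) : FinRep F Γ where
  V := U.toSubmodule
  ρ := U.toRepresentation

/-- The direct sum of all but the first summand, as the kernel of the first projection. -/
def Biproduct.tail {k : ℕ} {M : FinRep F Γ} {X : Fin (k + 1) → FinRep F Γ} (b : Biproduct M X) :
    Biproduct (subRep (b.proj 0).ker) (fun t : Fin k => X t.succ) where
  inc t :=
    { toLinearMap := (b.inc t.succ).toLinearMap.codRestrict _ fun x =>
        b.proj_inc_ne 0 t.succ (Fin.succ_ne_zero t).symm x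
      isIntertwining' := fun g => LinearMap.ext fun x => Subtype.ext (map_act _ _ g x) }
  proj t :=
    { toLinearMap := (b.proj t.succ).toLinearMap ∘ₗ Submodule.subtype _
      isIntertwining' := fun g => LinearMap.ext fun x => map_act _ _ g x.1 }
  proj_inc_same t x := b.proj_inc_same t.succ x
  proj_inc_ne s t h x := b.proj_inc_ne s.succ t.succ (fun h' => h (Fin.succ_injective _ h')) x
  sum_inc_proj m := by
    refine Subtype.ext ?_
    have := b.sum_inc_proj m.1
    rw [Fin.sum_univ_succ, show (b.proj 0).toLinearMap m.1 = 0 from m.2, map_zero, zero_add]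
      at this
    refine Eq.trans ?_ this
    exact AddSubmonoidClass.coe_finsetSum _ _

lemma Biproduct.iso_sum_tail {k : ℕ} {M : FinRep F Γ} {X : Fin (k + 1) → FinRep F Γ}
    (b : Biproduct M X) : M.Iso ((X 0).sum (subRep (b.proj 0).ker)) := by
  let pB : M.V →ₗ[F] (subRep (b.proj 0).ker).V :=
    (LinearMap.id - (b.inc 0).toLinearMap ∘ₗ (b.proj 0).toLinearMap).codRestrict
      (b.proj 0).ker.toSubmodule fun m => by
        change (b.proj 0).toLinearMap (m - (b.inc 0).toLinearMap ((b.proj 0).toLinearMap m)) = 0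
        rw [map_sub, b.proj_inc_same, sub_self]
  refine iso_sum_of (K := M) (A := X 0) (B := subRep (b.proj 0).ker) (b.inc 0).toLinearMap
    (Submodule.subtype (b.proj 0).ker.toSubmodule) (b.proj 0).toLinearMap pB
    (LinearMap.ext fun x => b.proj_inc_same 0 x)
    (LinearMap.ext fun x => Subtype.ext ?_)
    (LinearMap.ext fun x => x.2) (LinearMap.ext fun x => Subtype.ext ?_)
    (LinearMap.ext fun x => add_sub_cancel ((b.inc 0).toLinearMap _) x)
    (fun g => LinearMap.ext fun x => map_act _ _ g x)
    (fun g => LinearMap.ext fun x => Subtype.ext ?_)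
  · change x.1 - (b.inc 0).toLinearMap ((b.proj 0).toLinearMap x.1) = x.1
    rw [show (b.proj 0).toLinearMap x.1 = 0 from x.2, map_zero, sub_zero]
  · change (b.inc 0).toLinearMap x - (b.inc 0).toLinearMap ((b.proj 0).toLinearMap _) = 0
    rw [b.proj_inc_same, sub_self]
  · change M.ρ g x - (b.inc 0).toLinearMap ((b.proj 0).toLinearMap (M.ρ g x))
      = M.ρ g (x - (b.inc 0).toLinearMap ((b.proj 0).toLinearMap x))
    rw [map_act, map_act, map_sub]

/-- Transport of a direct sum decomposition along a bijection of the index sets. -/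
def Biproduct.reindex {ι κ : Type*} [Fintype ι] [Fintype κ] {M : FinRep F Γ}
    {X : ι → FinRep F Γ} (b : Biproduct M X) (e : κ ≃ ι) : Biproduct M (fun t => X (e t)) where
  inc t := b.inc (e t)
  proj t := b.proj (e t)
  proj_inc_same t x := b.proj_inc_same (e t) x
  proj_inc_ne s t h x := b.proj_inc_ne _ _ (fun h' => h (e.injective h')) x
  sum_inc_proj m := by
    rw [e.sum_comp fun t => (b.inc t).toLinearMap ((b.proj t).toLinearMap m)]
    exact b.sum_inc_proj m

lemma Biproduct.iso_of_unique {ι : Type*} [Fintype ι] [Unique ι] {M : FinRep F Γ}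
    {X : ι → FinRep F Γ} (b : Biproduct M X) : M.Iso (X default) := by
  refine ⟨.mk (LinearEquiv.ofLinearMap (b.proj default).toLinearMap (b.inc default).toLinearMap
    ?_ ?_) fun g => ?_⟩
  · exact LinearMap.ext fun x => b.proj_inc_same default x
  · refine LinearMap.ext fun x => ?_
    have := b.sum_inc_proj x
    rwa [Fintype.sum_unique] at this
  · exact LinearMap.ext fun x => map_act _ _ g x

lemma cls_eq_zero {G : Type v} [Group G] [Finite G] (M : FinRep F (G × G)) [Subsingleton M.V] :
    cls M = 0 := by
  have : (M.sum M).Iso M := by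
    have : Subsingleton (M.sum M).V := inferInstanceAs (Subsingleton (M.V × M.V))
    exact ⟨.mk (0 : (M.sum M).V ≃ₗ[F] M.V) fun g => LinearMap.ext fun x => Subsingleton.elim _ _⟩
  have h := cls_congr this
  rw [cls_sum] at h
  simpa using h

lemma cls_biproduct_fin {G : Type v} [Group G] [Finite G] : ∀ {k : ℕ} {M : FinRep F (G × G)}
    {X : Fin k → FinRep F (G × G)}, Biproduct M X → cls M = ∑ t, cls (X t)
  | 0, M, X, b => by
    have : Subsingleton M.V := ⟨fun x y => by
      rw [← b.sum_inc_proj x, ← b.sum_inc_proj y]; simp⟩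
    rw [cls_eq_zero]; simp
  | k + 1, M, X, b => by
    rw [cls_congr b.iso_sum_tail, cls_sum, cls_biproduct_fin b.tail, Fin.sum_univ_succ]

lemma Biproduct.cls_eq {G : Type v} [Group G] [Finite G] {ι : Type*} [Fintype ι]
    {M : FinRep F (G × G)} {X : ι → FinRep F (G × G)} (b : Biproduct M X) :
    cls M = ∑ t, cls (X t) := by
  rw [cls_biproduct_fin (b.reindex (Fintype.equivFin ι).symm)]
  exact (Fintype.equivFin ι).symm.sum_comp fun t => cls (X t)

/-- A module generated by vectors `u t` on which the subgroups `H t` act through linear characters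
is the direct sum of the corresponding induced modules as soon as there are functionals `B t`
which separate the translates of the `u t`. -/
theorem exists_biproduct_mono [Finite Γ] (M : FinRep F Γ) {ι : Type*} [Fintype ι]
    (H : ι → Subgroup Γ) (Θ : ι → Γ →* Fˣ) (u : ι → M.V) (B : ι → M.V →ₗ[F] F)
    (hu : ∀ t, ∀ h ∈ H t, M.ρ h (u t) = (Θ t h : F) • u t)
    (hgen : ∀ U : Submodule F M.V, (∀ t g, M.ρ g (u t) ∈ U) → U = ⊤)
    (hB : ∀ s t g, M.ρ g (u s) ∈ LinearMap.ker (B t) ∨ (s = t ∧ g ∈ H t))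
    (hB1 : ∀ t, B t (u t) ≠ 0) :
    Nonempty (Biproduct M fun t => monoRep (H t) (Θ t)) := by
  classical
  let r : ∀ t, (monoRep (H t) (Θ t)).ρ.IntertwiningMap M.ρ := fun t =>
    monoHom (H t) (Θ t) M (u t) (hu t)
  have hr : ∀ t g, (r t).toLinearMap (ev (H t) (Θ t) g) = M.ρ g (u t) := fun t g =>
    monoHom_ev _ _ _ _ _ g
  let e : (∀ t, (monoRep (H t) (Θ t)).V) →ₗ[F] M.V :=
    ∑ t, (r t).toLinearMap ∘ₗ LinearMap.proj t
  have he : ∀ x, e x = ∑ t, (r t).toLinearMap (x t) := fun x => by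
    simp [e, LinearMap.sum_apply]
  -- `B t` composed with a translation reads off the coordinates of the `t`-th component
  have hcoord : ∀ t (g : Γ) (x : ∀ t, (monoRep (H t) (Θ t)).V), B t (M.ρ g⁻¹ (e x))
      = B t (u t) * monoDelta (H t) (Θ t) ((monoRep (H t) (Θ t)).ρ g⁻¹ (x t)) := fun t g x => by
    rw [he, map_sum, map_sum, Finset.sum_eq_single t]
    · have : (B t ∘ₗ M.ρ g⁻¹ ∘ₗ (r t).toLinearMap) = B t (u t) •
          (monoDelta (H t) (Θ t) ∘ₗ (monoRep (H t) (Θ t)).ρ g⁻¹) := mono_hom_ext fun y => by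
        simp only [LinearMap.comp_apply, LinearMap.smul_apply, hr, ev_act, act_act]
        by_cases hy : g⁻¹ * y ∈ H t
        · rw [hu t _ hy, monoDelta_of_mem _ hy, map_smul, smul_eq_mul, smul_eq_mul, mul_comm]
        · rw [monoDelta_of_notMem _ hy, smul_zero]
          exact (hB t t _).resolve_right fun h => hy h.2
      exact LinearMap.congr_fun this (x t)
    · intro s _ hs
      have : (B t ∘ₗ M.ρ g⁻¹ ∘ₗ (r s).toLinearMap) = 0 := mono_hom_ext fun y => by
        simp only [LinearMap.comp_apply, LinearMap.zero_apply, hr, act_act]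
        exact (hB s t _).resolve_right fun h => hs h.1
      exact LinearMap.congr_fun this (x s)
    · simp
  have hinj : Function.Injective e := by
    rw [injective_iff_map_eq_zero]
    refine fun x hx => funext fun t => mono_ext _ _ fun g => ?_
    have := hcoord t g x
    rw [hx, map_zero, map_zero] at this
    exact (mul_eq_zero.1 this.symm).resolve_left (hB1 t)
  have hsingle : ∀ t x, e (Pi.single t x) = (r t).toLinearMap x := fun t x => by
    rw [he, Finset.sum_eq_single t]
    · rw [Pi.single_eq_same]
    · intro s _ hs
      rw [Pi.single_eq_of_ne hs, map_zero]
    · simp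
  have hsurj : Function.Surjective e := by
    rw [← LinearMap.range_eq_top]
    exact hgen _ fun t g => ⟨Pi.single t (ev (H t) (Θ t) g), by rw [hsingle, hr]⟩
  let E := LinearEquiv.ofBijective e ⟨hinj, hsurj⟩
  have hEe : ∀ x, E.symm (e x) = x := fun x => E.symm_apply_apply x
  have heE : ∀ m, e (E.symm m) = m := fun m => E.apply_symm_apply m
  refine ⟨⟨r, fun t => ⟨LinearMap.proj t ∘ₗ E.symm.toLinearMap, fun g => ?_⟩, ?_, ?_, ?_⟩⟩
  · refine LinearMap.ext fun m => ?_
    change E.symm (M.ρ g m) t = (monoRep (H t) (Θ t)).ρ g (E.symm m t)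
    have : M.ρ g m = e fun t => (monoRep (H t) (Θ t)).ρ g (E.symm m t) := by
      conv_lhs => rw [← heE m]
      rw [he, he, map_sum]
      exact Finset.sum_congr rfl fun t _ => (map_act _ _ g _).symm
    rw [this, hEe]
  · intro t x
    change E.symm ((r t).toLinearMap x) t = x
    rw [← hsingle, hEe, Pi.single_eq_same]
  · intro s t hst x
    change E.symm ((r t).toLinearMap x) s = 0
    rw [← hsingle, hEe, Pi.single_eq_of_ne hst]
  · intro m
    conv_rhs => rw [← heE m, he]
    rfl

/-- The case of one summand in `exists_biproduct_mono`. -/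
theorem iso_mono [Finite Γ] (M : FinRep F Γ) (H : Subgroup Γ) (Θ : Γ →* Fˣ) (u : M.V)
    (B : M.V →ₗ[F] F) (hu : ∀ h ∈ H, M.ρ h u = (Θ h : F) • u)
    (hgen : ∀ U : Submodule F M.V, (∀ g, M.ρ g u ∈ U) → U = ⊤)
    (hB : ∀ g, g ∉ H → B (M.ρ g u) = 0) (hB1 : B u ≠ 0) : M.Iso (monoRep H Θ) := by
  obtain ⟨b⟩ := exists_biproduct_mono (ι := Unit) M (fun _ => H) (fun _ => Θ) (fun _ => u)
    (fun _ => B) (fun _ => hu) (fun U hU => hgen U (hU ()))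
    (fun _ _ g => by
      by_cases hg : g ∈ H
      · exact .inr ⟨rfl, hg⟩
      · exact .inl (hB g hg)) (fun _ => hB1)
  exact b.iso_of_unique

end Biproduct

/-! ### Summands of direct sums of indecomposable modules -/

section KrullSchmidt

variable {F : Type u} {Γ : Type v} [Field F] [Group Γ]

/-- Fitting's lemma. -/
lemma FinRep.Indecomposable.isUnit_or_isNilpotent {M : FinRep F Γ} (hM : M.Indecomposable)
    (f : Module.End F M.V) (hf : ∀ g, Commute (M.ρ g) f) : IsUnit f ∨ IsNilpotent f := by
  obtain ⟨k, hk⟩ := (f.eventually_isCompl_ker_pow_range_pow).exists_forall_of_atTop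
  have hk1 := hk (k + 1) k.le_succ
  have hc : ∀ g, Commute (M.ρ g) (f ^ (k + 1)) := fun g => (hf g).pow_right _
  have hcx : ∀ g x, (f ^ (k + 1)) (M.ρ g x) = M.ρ g ((f ^ (k + 1)) x) := fun g x =>
    (LinearMap.congr_fun (hc g) x).symm
  rcases hM.2 ⟨LinearMap.ker (f ^ (k + 1)), fun g x hx => by
      rw [LinearMap.mem_ker] at hx ⊢
      rw [hcx, hx, map_zero]⟩
    ⟨LinearMap.range (f ^ (k + 1)), by
      rintro g _ ⟨x, rfl⟩
      exact ⟨M.ρ g x, hcx g x⟩⟩ hk1 with h | h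
  · left
    have h1 : IsUnit (f ^ (k + 1)) := by
      rw [LinearMap.isUnit_iff_ker_eq_bot]
      exact h
    exact (isUnit_pow_iff k.succ_ne_zero).1 h1
  · right
    exact ⟨k + 1, LinearMap.range_eq_bot.1 h⟩

/-- The endomorphism ring of an indecomposable module is local: a sum of endomorphisms is invertible
only if one of them is. -/
lemma FinRep.Indecomposable.exists_isUnit_of_sum {M : FinRep F Γ} (hM : M.Indecomposable)
    {ι : Type*} (s : Finset ι) : ∀ (f : ι → Module.End F M.V),
    (∀ t g, Commute (M.ρ g) (f t)) → IsUnit (∑ t ∈ s, f t) → ∃ t ∈ s, IsUnit (f t) := by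
  classical
  induction s using Finset.induction_on with
  | empty =>
    intro f _ h
    have := hM.1
    simp at h
  | insert a s ha ih =>
    intro f hf h
    rw [Finset.sum_insert ha] at h
    obtain ⟨w, hw⟩ := h
    have hsum : ∀ g, Commute (M.ρ g) (∑ t ∈ s, f t) := fun g =>
      Commute.sum_right _ _ _ fun t _ => hf t g
    have hwc : ∀ g, Commute (M.ρ g) (w : Module.End F M.V) := fun g => by
      rw [hw]
      exact (hf a g).add_right (hsum g)
    have hwi : ∀ g, Commute (M.ρ g) (↑w⁻¹ : Module.End F M.V) := fun g =>
      (hwc g).units_inv_right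
    rcases hM.isUnit_or_isNilpotent (↑w⁻¹ * f a) fun g => (hwi g).mul_right (hf a g) with h | h
    · refine ⟨a, Finset.mem_insert_self _ _, ?_⟩
      exact (Units.isUnit_units_mul w⁻¹ _).1 h
    · have h1 : (↑w⁻¹ * ∑ t ∈ s, f t) = 1 - ↑w⁻¹ * f a := by
        rw [eq_sub_iff_add_eq, ← mul_add, add_comm, ← hw, Units.inv_mul]
      have h2 : IsUnit (↑w⁻¹ * ∑ t ∈ s, f t) := h1 ▸ h.isUnit_one_sub
      obtain ⟨t, ht, ht'⟩ := ih f hf ((Units.isUnit_units_mul w⁻¹ _).1 h2)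
      exact ⟨t, Finset.mem_insert_of_mem ht, ht'⟩

lemma iso_of_bijective {M N : FinRep F Γ} (f : M.ρ.IntertwiningMap N.ρ)
    (hf : Function.Bijective f.toLinearMap) : M.Iso N :=
  ⟨.mk (LinearEquiv.ofBijective f.toLinearMap hf) f.isIntertwining'⟩

/-- If the composite `M → X → M` is bijective and `X` is indecomposable, then both maps are
isomorphisms. -/
lemma iso_of_comp_bijective {M X : FinRep F Γ} [Nontrivial M.V] (hX : X.Indecomposable)
    (i : M.ρ.IntertwiningMap X.ρ) (r : X.ρ.IntertwiningMap M.ρ)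
    (h : Function.Bijective (r.toLinearMap ∘ₗ i.toLinearMap)) : M.Iso X := by
  have hc : IsCompl (LinearMap.range i.toLinearMap) (LinearMap.ker r.toLinearMap) := by
    refine ⟨Submodule.disjoint_def.2 ?_, codisjoint_iff.2 (Submodule.eq_top_iff'.2 fun x => ?_)⟩
    · rintro _ ⟨m, rfl⟩ hm
      have : m = 0 := h.1 (by rw [map_zero]; exact hm)
      rw [this, map_zero]
    · obtain ⟨m, hm⟩ := h.2 (r.toLinearMap x)
      rw [← add_sub_cancel (i.toLinearMap m) x]
      refine Submodule.add_mem_sup ⟨m, rfl⟩ ?_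
      rw [LinearMap.mem_ker, map_sub, ← hm]
      exact sub_self _
  rcases hX.2 i.range r.ker hc with h' | h'
  · exfalso
    obtain ⟨m, hm⟩ := exists_ne (0 : M.V)
    apply hm
    apply h.1
    have : i.toLinearMap = 0 := LinearMap.range_eq_bot.1 h'
    simp [this]
  · refine (iso_of_bijective r ⟨LinearMap.ker_eq_bot.1 h', ?_⟩).symm
    exact Function.Surjective.of_comp (g := i.toLinearMap) h.2

/-- An indecomposable module that is a summand of a direct sum of indecomposable modules is
isomorphic to one of them. -/
theorem FinRep.Indecomposable.exists_iso {M : FinRep F Γ} (hM : M.Indecomposable)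
    {ι : Type*} [Fintype ι] (X : ι → FinRep F Γ) (hX : ∀ t, (X t).Indecomposable)
    (i : ∀ t, M.ρ.IntertwiningMap (X t).ρ) (r : ∀ t, (X t).ρ.IntertwiningMap M.ρ)
    (h : ∑ t, (r t).toLinearMap ∘ₗ (i t).toLinearMap = LinearMap.id) : ∃ t, M.Iso (X t) := by
  obtain ⟨t, -, ht⟩ := hM.exists_isUnit_of_sum Finset.univ
    (fun t => (r t).toLinearMap ∘ₗ (i t).toLinearMap)
    (fun t g => LinearMap.ext fun x => by
      change M.ρ g ((r t).toLinearMap ((i t).toLinearMap x))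
        = (r t).toLinearMap ((i t).toLinearMap (M.ρ g x))
      rw [map_act, map_act])
    (by rw [h]; exact isUnit_one)
  have := hM.1
  exact ⟨t, iso_of_comp_bijective (hX t) (i t) (r t) ((Module.End.isUnit_iff _).1 ht)⟩

lemma FinRep.Indecomposable.congr {M N : FinRep F Γ} (hM : M.Indecomposable) (h : M.Iso N) :
    N.Indecomposable := by
  obtain ⟨e⟩ := h
  let f := e.toIntertwiningMap
  have hf : Function.Bijective f.toLinearMap := e.toLinearEquiv.bijective
  refine ⟨?_, fun U W hUW => ?_⟩
  · have := hM.1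
    exact hf.1.nontrivial
  · have key : ∀ U : Submodule F N.V, U.comap f.toLinearMap = ⊥ → U = ⊥ := fun U hU => by
      rw [← Submodule.map_comap_eq_of_surjective hf.2 U, hU, Submodule.map_bot]
    refine (hM.2 ⟨U.toSubmodule.comap f.toLinearMap, fun g x hx => ?_⟩
      ⟨W.toSubmodule.comap f.toLinearMap, fun g x hx => ?_⟩ ⟨?_, ?_⟩).imp (key _) (key _)
    · rw [Submodule.mem_comap] at hx ⊢
      rw [map_act]
      exact U.apply_mem_toSubmodule g hx
    · rw [Submodule.mem_comap] at hx ⊢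
      rw [map_act]
      exact W.apply_mem_toSubmodule g hx
    · refine Submodule.disjoint_def.2 fun x hx hx' => ?_
      exact hf.1 ((Submodule.disjoint_def.1 hUW.1 _ hx hx').trans (map_zero _).symm)
    · refine codisjoint_iff.2 (Submodule.eq_top_iff'.2 fun x => ?_)
      have hx : f.toLinearMap x ∈ U.toSubmodule ⊔ W.toSubmodule := by
        rw [codisjoint_iff.1 hUW.2]; trivial
      obtain ⟨a, ha, b, hb, hab⟩ := Submodule.mem_sup.1 hx
      obtain ⟨a, rfl⟩ := hf.2 a
      obtain ⟨b, rfl⟩ := hf.2 b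
      rw [← map_add] at hab
      rw [← hf.1 hab]
      exact Submodule.add_mem_sup ha hb

end KrullSchmidt

/-! ### Actions of `p`-groups in characteristic `p` -/

section PGroup

variable {F : Type u} [Field F] (p : ℕ) [hp : Fact p.Prime] [CharP F p]

/-- A `p`-group acting on a nonzero vector space in characteristic `p` fixes a nonzero vector:
the additive group generated by an orbit is a finite `p`-group. -/
lemma exists_fixed_vector {P V : Type*} [Group P] [Finite P] (hP : IsPGroup p P)
    [AddCommGroup V] [Module F V] [Nontrivial V] (ρ : Representation F P V) :
    ∃ v, v ≠ 0 ∧ ∀ g, ρ g v = v := by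
  obtain ⟨v, hv⟩ := exists_ne (0 : V)
  have hpV : ∀ x : V, p • x = 0 := fun x => by
    rw [← Nat.cast_smul_eq_nsmul F, CharP.cast_eq_zero, zero_smul]
  obtain ⟨_⟩ : Nonempty (Module (ZMod p) V) := ⟨AddCommGroup.zmodModule hpV⟩
  let W : Submodule (ZMod p) V := Submodule.span (ZMod p) (Set.range fun g => ρ g v)
  have := Module.Finite.span_of_finite (ZMod p) (Set.finite_range fun g => ρ g v)
  have : Finite W := Module.finite_of_finite (ZMod p)
  have hW : ∀ g, ∀ x ∈ W, ρ g x ∈ W := fun g x hx => by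
    induction hx using Submodule.span_induction with
    | mem x hx =>
      obtain ⟨k, rfl⟩ := hx
      exact Submodule.subset_span ⟨g * k, LinearMap.congr_fun (map_mul ρ g k) v⟩
    | zero => rw [map_zero]; exact zero_mem _
    | add x y _ _ hx hy => rw [map_add]; exact add_mem hx hy
    | smul a x _ hx =>
      obtain ⟨a, rfl⟩ := ZMod.natCast_zmod_surjective a
      rw [Nat.cast_smul_eq_nsmul, map_nsmul]
      exact nsmul_mem hx _
  let act : MulAction P W :=
    { smul := fun g x => ⟨ρ g x, hW g x x.2⟩
      one_smul := fun x => Subtype.ext (by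
        change ρ 1 x.1 = x.1
        rw [map_one]; rfl)
      mul_smul := fun g k x => Subtype.ext (by
        change ρ (g * k) x.1 = ρ g (ρ k x.1)
        rw [map_mul]; rfl) }
  have hsm : ∀ (g : P) (x : W), ((g • x : W) : V) = ρ g x := fun g x => rfl
  have hvW : v ∈ W := Submodule.subset_span ⟨1, by simp⟩
  have hdvd : p ∣ Nat.card W := by
    have h1 : addOrderOf (⟨v, hvW⟩ : W) = p := addOrderOf_eq_prime
      (Subtype.ext (hpV v)) fun h => hv (congrArg Subtype.val h)
    exact h1.symm.dvd.trans (addOrderOf_dvd_natCard _)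
  obtain ⟨w, hw, hw0⟩ := hP.exists_fixed_point_of_prime_dvd_card_of_fixed_point W hdvd
    (a := 0) fun g => Subtype.ext ((hsm g 0).trans (map_zero _))
  exact ⟨w, fun h => hw0 (Subtype.ext h.symm), fun g => congrArg Subtype.val (hw g)⟩

/-- A function on a `P`-set with values in characteristic `p` that is invariant under the
`p`-group `P` and vanishes on the fixed points has sum zero. -/
lemma sum_eq_zero_of_invariant {P Y : Type*} [Group P] [Finite P] (hP : IsPGroup p P) [Fintype Y]
    [MulAction P Y] (φ : Y → F) (hφ : ∀ (g : P) y, φ (g • y) = φ y)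
    (h0 : ∀ y, (∀ g : P, g • y = y) → φ y = 0) : ∑ y, φ y = 0 := by
  classical
  have := Finset.sum_comp (s := (Finset.univ : Finset Y)) (fun a : F => a) φ
  rw [this]
  refine Finset.sum_eq_zero fun c _ => ?_
  by_cases hc : c = 0
  · rw [hc, smul_zero]
  let Z : SubMulAction P Y := ⟨{y | φ y = c}, fun g y hy => (hφ g y).trans hy⟩
  have h1 := hP.card_modEq_card_fixedPoints (α := Z)
  have h2 : IsEmpty (MulAction.fixedPoints P Z) := ⟨fun y => hc (by
    rw [← show φ y.1.1 = c from y.1.2]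
    exact h0 _ fun g => congrArg Subtype.val (y.2 g))⟩
  rw [Nat.card_of_isEmpty (α := MulAction.fixedPoints P Z)] at h1
  have h3 : Nat.card Z = (Finset.univ.filter fun y => φ y = c).card := by
    rw [← Nat.card_eq_finsetCard]
    exact Nat.card_congr (Equiv.subtypeEquivRight fun y => by
      rw [Finset.mem_filter]
      exact ⟨fun h => ⟨Finset.mem_univ _, h⟩, fun h => h.2⟩)
  rw [h3] at h1
  rw [← Nat.cast_smul_eq_nsmul F, (CharP.cast_eq_zero_iff F p _).2 (Nat.modEq_zero_iff_dvd.1 h1),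
    zero_smul]

/-- A linear character in characteristic `p` is trivial on elements of `p`-power order. -/
lemma char_eq_one {Γ : Type*} [Group Γ] (Θ : Γ →* Fˣ) {P : Subgroup Γ} (hP : IsPGroup p P)
    {g : Γ} (hg : g ∈ P) : Θ g = 1 := by
  obtain ⟨k, hk⟩ := hP ⟨g, hg⟩
  have hk' : g ^ p ^ k = 1 := congrArg Subtype.val hk
  have h : (Θ g : F) ^ p ^ k = 1 := by
    rw [← Units.val_pow_eq_pow_val, ← map_pow, hk', map_one, Units.val_one]
  have hE : ExpChar F p := ExpChar.prime hp.out
  rw [← mul_one (p ^ k), ExpChar.pow_prime_pow_mul_eq_one_iff, pow_one] at h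
  exact Units.ext h

variable {Γ : Type v} [Group Γ] [Finite Γ]

/-- A proper submodule is annihilated by a nonzero functional that is invariant under a given
`p`-subgroup. -/
lemma exists_invariant_functional {M : FinRep F Γ} {S : Subgroup Γ} (hS : IsPGroup p S)
    (U : Submodule F M.V) (hU : ∀ s ∈ S, ∀ x ∈ U, M.ρ s x ∈ U) (hU' : U ≠ ⊤) :
    ∃ ψ : M.V →ₗ[F] F, ψ ≠ 0 ∧ (∀ x ∈ U, ψ x = 0) ∧ ∀ s ∈ S, ∀ m, ψ (M.ρ s m) = ψ m := by
  let σ : Representation F S (Module.Dual F M.V) := Representation.dual (M.ρ.comp S.subtype)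
  have hσ : ∀ s f m, σ s f m = f (M.ρ (s : Γ)⁻¹ m) := fun s f m => rfl
  let A : Subrepresentation σ := ⟨U.dualAnnihilator, fun s f hf => by
    rw [Submodule.mem_dualAnnihilator] at hf ⊢
    exact fun x hx => (hσ s f x).trans (hf _ (hU _ (inv_mem s.2) x hx))⟩
  obtain ⟨f, hf0, hf⟩ := Submodule.exists_le_ker_of_lt_top U (lt_top_iff_ne_top.2 hU')
  have : Nontrivial A.toSubmodule := ⟨⟨f, (Submodule.mem_dualAnnihilator f).2 fun x hx => hf hx⟩,
    0, fun h => hf0 (congrArg Subtype.val h)⟩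
  obtain ⟨ψ, hψ0, hψ⟩ := exists_fixed_vector p (V := A.toSubmodule) hS A.toRepresentation
  refine ⟨ψ.1, fun h => hψ0 (Subtype.ext h), (Submodule.mem_dualAnnihilator _).1 ψ.2,
    fun s hs m => ?_⟩
  have h1 : σ ⟨s, hs⟩ ψ.1 = ψ.1 := congrArg Subtype.val (hψ ⟨s, hs⟩)
  conv_lhs => rw [← h1]
  rw [hσ, act_act, inv_mul_cancel, act_one]

/-- A `Q`-invariant functional on `Ind_H^Γ (F_Θ)` that vanishes on the basis vectors whose lines
are `Q`-stable vanishes on all `Q`-fixed vectors. -/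
theorem functional_eq_zero (H : Subgroup Γ) (Θ : Γ →* Fˣ) {Q : Subgroup Γ} (hQ : IsPGroup p Q)
    (ψ : (monoRep H Θ).V →ₗ[F] F) (hψ : ∀ q ∈ Q, ∀ m, ψ ((monoRep H Θ).ρ q m) = ψ m)
    (m : (monoRep H Θ).V) (hm : ∀ q ∈ Q, (monoRep H Θ).ρ q m = m)
    (h0 : ∀ x, (∀ q ∈ Q, x⁻¹ * q * x ∈ H) → ψ (ev H Θ x) = 0) : ψ m = 0 := by
  let Φ : Γ → F := fun g => monoDelta H Θ ((monoRep H Θ).ρ g⁻¹ m) * ψ (ev H Θ g)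
  have hΦH : ∀ g, ∀ h ∈ H, Φ (g * h) = Φ g := fun g h hh => by
    have h1 : ∀ n, monoDelta H Θ ((monoRep H Θ).ρ h⁻¹ n) = (Θ h : F)⁻¹ * monoDelta H Θ n := by
      intro n
      have : monoDelta H Θ ∘ₗ (monoRep H Θ).ρ h⁻¹ = (Θ h : F)⁻¹ • monoDelta H Θ :=
        mono_hom_ext fun x => by
          rw [LinearMap.comp_apply, ev_act, LinearMap.smul_apply]
          by_cases hx : x ∈ H
          · rw [monoDelta_of_mem Θ hx, monoDelta_of_mem Θ (mul_mem (inv_mem hh) hx), map_mul,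
              map_inv, Units.val_mul, Units.val_inv_eq_inv_val, smul_eq_mul]
          · rw [monoDelta_of_notMem Θ hx, monoDelta_of_notMem Θ fun h' => hx
              ((H.mul_mem_cancel_left (inv_mem hh)).1 h'), smul_zero]
      exact LinearMap.congr_fun this n
    have h2 : (Θ h : F) ≠ 0 := (Θ h).ne_zero
    simp only [Φ]
    rw [mul_inv_rev, ← act_act, h1, ev_mul Θ g hh, map_smul, smul_eq_mul]
    field_simp
  have hΦQ : ∀ q ∈ Q, ∀ g, Φ (q * g) = Φ g := fun q hq g => by
    simp only [Φ]
    rw [mul_inv_rev, ← act_act, hm _ (inv_mem hq), ← ev_act, hψ q hq]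
  have hsum : ψ m = ∑ y : Γ ⧸ H, Φ y.out := by
    conv_lhs => rw [mono_expand H Θ m]
    rw [map_sum]
    exact Finset.sum_congr rfl fun y _ => by rw [map_smul, smul_eq_mul]
  rw [hsum]
  refine sum_eq_zero_of_invariant p hQ (Y := Γ ⧸ H) (fun y => Φ y.out) (fun q y => ?_)
    fun y hy => ?_
  · obtain ⟨h, hh⟩ := QuotientGroup.mk_out_eq_mul H ((q : Γ) * y.out)
    have : (q • y : Γ ⧸ H) = (((q : Γ) * y.out : Γ) : Γ ⧸ H) := by
      conv_lhs => rw [← QuotientGroup.out_eq' y]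
      rfl
    simp only [this]
    rw [hh, hΦH _ _ h.2, hΦQ _ q.2]
  · simp only [Φ]
    rw [h0, mul_zero]
    intro q hq
    have h1 := hy ⟨q, hq⟩⁻¹
    rw [← QuotientGroup.out_eq' y] at h1
    have h2 : ((q⁻¹ * y.out : Γ) : Γ ⧸ H) = ((y.out : Γ) : Γ ⧸ H) := h1
    rw [QuotientGroup.eq] at h2
    simpa [mul_assoc] using h2

end PGroup

/-! ### Induced modules with a local endomorphism ring -/

section Local

/-- The normal `p`-subgroup `S` and the subgroup `Q ≤ S ∩ H` are such that `Q` lies in no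
conjugate of `H` but those by elements of `S H`. For such `H` every `Ind_H^Γ (F_Θ)` has a local
endomorphism ring, and the induced modules for different `Θ` can be told apart. -/
structure Isolates {Γ : Type v} [Group Γ] (p : ℕ) (S Q H : Subgroup Γ) : Prop where
  normal : S.Normal
  pgroup : IsPGroup p S
  le_S : Q ≤ S
  le_H : Q ≤ H
  star : ∀ x, (∀ q ∈ Q, x⁻¹ * q * x ∈ H) → ∃ s ∈ S, ∃ h ∈ H, x = s * h

variable {F : Type u} [Field F] {p : ℕ} [hp : Fact p.Prime] [CharP F p]
variable {Γ : Type v} [Group Γ] [Finite Γ] {S Q H : Subgroup Γ} (Θ : Γ →* Fˣ)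

omit [Finite Γ] in
/-- An `S`-invariant functional on `M` remains so after translation by an element of `Γ`. -/
lemma invariant_comp {M : FinRep F Γ} (hS : S.Normal) {ψ : M.V →ₗ[F] F}
    (hψ : ∀ s ∈ S, ∀ m, ψ (M.ρ s m) = ψ m) (x : Γ) :
    ∀ s ∈ S, ∀ m, (ψ ∘ₗ M.ρ x) (M.ρ s m) = (ψ ∘ₗ M.ρ x) m := fun s hs m => by
  rw [LinearMap.comp_apply, LinearMap.comp_apply, act_act,
    show x * s = (x * s * x⁻¹) * x by group, ← act_act, hψ _ (hS.conj_mem s hs x)]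

include hp in
lemma exists_top (hS : S.Normal) (hSp : IsPGroup p S) : ∃ T : (monoRep H Θ).V →ₗ[F] F,
    T (ev H Θ 1) = 1 ∧ ∀ s ∈ S, ∀ m, T ((monoRep H Θ).ρ s m) = T m := by
  obtain ⟨ψ, hψ0, -, hψ⟩ := exists_invariant_functional p (M := monoRep H Θ) hSp ⊥
    (fun s _ x hx => by
      rw [Submodule.mem_bot] at hx ⊢
      rw [hx, map_zero]) bot_ne_top
  obtain ⟨x, hx⟩ : ∃ x, ψ (ev H Θ x) ≠ 0 := by
    by_contra! h
    exact hψ0 (mono_hom_ext h)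
  refine ⟨(ψ (ev H Θ x))⁻¹ • (ψ ∘ₗ (monoRep H Θ).ρ x), ?_, fun s hs m => ?_⟩
  · rw [LinearMap.smul_apply, LinearMap.comp_apply, act_ev_one, smul_eq_mul, inv_mul_cancel₀ hx]
  · rw [LinearMap.smul_apply, LinearMap.smul_apply, invariant_comp hS hψ x s hs]

/-- An `S`-invariant functional taking the value `1` at `1 ⊗ 1`. -/
def Isolates.top (h : Isolates p S Q H) : (monoRep H Θ).V →ₗ[F] F :=
  (exists_top (H := H) Θ h.normal h.pgroup).choose

variable (h : Isolates p S Q H)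

lemma Isolates.top_ev : h.top Θ (ev H Θ 1) = 1 :=
  (exists_top (H := H) Θ h.normal h.pgroup).choose_spec.1

lemma Isolates.top_act : ∀ s ∈ S, ∀ m, h.top Θ ((monoRep H Θ).ρ s m) = h.top Θ m :=
  (exists_top (H := H) Θ h.normal h.pgroup).choose_spec.2

include h

omit hp [Finite Γ] in
lemma Isolates.pgroup_Q : IsPGroup p Q := h.pgroup.to_le h.le_S

lemma Isolates.ev_fixed (q : Γ) (hq : q ∈ Q) : (monoRep H Θ).ρ q (ev H Θ 1) = ev H Θ 1 := by
  rw [act_ev_of_mem Θ (h.le_H hq), char_eq_one p Θ h.pgroup_Q hq, Units.val_one, one_smul]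

/-- On `Q`-fixed vectors every `S`-invariant functional is a multiple of `top`. -/
lemma Isolates.functional_eq (ψ : (monoRep H Θ).V →ₗ[F] F)
    (hψ : ∀ s ∈ S, ∀ m, ψ ((monoRep H Θ).ρ s m) = ψ m) {m : (monoRep H Θ).V}
    (hm : ∀ q ∈ Q, (monoRep H Θ).ρ q m = m) : ψ m = ψ (ev H Θ 1) * h.top Θ m := by
  have := functional_eq_zero p H Θ h.pgroup_Q (ψ - ψ (ev H Θ 1) • h.top Θ) (fun q hq n => by
    rw [LinearMap.sub_apply, LinearMap.sub_apply, LinearMap.smul_apply, LinearMap.smul_apply,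
      hψ q (h.le_S hq), h.top_act Θ q (h.le_S hq)]) m hm fun x hx => by
    obtain ⟨s, hs, k, hk, rfl⟩ := h.star x hx
    rw [← ev_act, LinearMap.sub_apply, LinearMap.smul_apply, hψ s hs, h.top_act Θ s hs,
      ← act_ev_one, act_ev_of_mem Θ hk, map_smul, map_smul, h.top_ev]
    simp [mul_comm]
  rwa [LinearMap.sub_apply, LinearMap.smul_apply, sub_eq_zero, smul_eq_mul] at this

/-- A `Q`-fixed vector outside of the kernel of `top` generates the whole module. -/
lemma Isolates.generates {m : (monoRep H Θ).V} (hm : ∀ q ∈ Q, (monoRep H Θ).ρ q m = m)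
    (hT : h.top Θ m ≠ 0) (U : Submodule F (monoRep H Θ).V)
    (hU : ∀ g, ∀ x ∈ U, (monoRep H Θ).ρ g x ∈ U) (hmU : m ∈ U) : U = ⊤ := by
  by_contra hne
  obtain ⟨ψ, hψ0, hψU, hψ⟩ := exists_invariant_functional p h.pgroup U (fun s _ => hU s) hne
  apply hψ0
  refine mono_hom_ext fun x => ?_
  have h1 := h.functional_eq Θ _ (invariant_comp h.normal hψ x) hm
  rw [LinearMap.comp_apply, LinearMap.comp_apply, hψU _ (hU x m hmU), act_ev_one] at h1
  exact (mul_eq_zero.1 h1.symm).resolve_right hT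

/-- If `1 ⊗ 1 = a + b` with `a` and `b` in complementary submodules, then `a` and `b` are `Q`-fixed, so
that the one on which `top` does not vanish generates the module. -/
theorem Isolates.indecomposable : (monoRep H Θ).Indecomposable := by
  refine ⟨inferInstance, fun U W hUW => ?_⟩
  -- the components of `1 ⊗ 1` are again `Q`-fixed, and one of them is not killed by `top`
  have hmem : ev H Θ 1 ∈ U.toSubmodule ⊔ W.toSubmodule := by
    rw [codisjoint_iff.1 hUW.2]; trivial
  obtain ⟨a, ha, b, hb, hab⟩ := Submodule.mem_sup.1 hmem
  have hfix : ∀ q ∈ Q, (monoRep H Θ).ρ q a = a ∧ (monoRep H Θ).ρ q b = b := fun q hq => by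
    have h1 := h.ev_fixed Θ q hq
    rw [← hab, map_add] at h1
    have h2 : (monoRep H Θ).ρ q a - a = b - (monoRep H Θ).ρ q b := by
      rw [sub_eq_sub_iff_add_eq_add, h1, add_comm]
    have h3 : (monoRep H Θ).ρ q a - a = 0 := Submodule.disjoint_def.1 hUW.1 _
      (sub_mem (U.apply_mem_toSubmodule q ha) ha)
      (h2 ▸ sub_mem hb (W.apply_mem_toSubmodule q hb))
    exact ⟨sub_eq_zero.1 h3, (sub_eq_zero.1 (h2 ▸ h3)).symm⟩
  have hsum : h.top Θ a + h.top Θ b = 1 := by rw [← map_add, hab, h.top_ev]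
  by_cases hT : h.top Θ a = 0
  · left
    have hT' : h.top Θ b ≠ 0 := fun h' => by rw [hT, h', add_zero] at hsum; exact zero_ne_one hsum
    have := h.generates Θ (fun q hq => (hfix q hq).2) hT' W.toSubmodule
      (fun g x hx => W.apply_mem_toSubmodule g hx) hb
    exact disjoint_top.1 (this ▸ hUW.1)
  · right
    have := h.generates Θ (fun q hq => (hfix q hq).1) hT U.toSubmodule
      (fun g x hx => U.apply_mem_toSubmodule g hx) ha
    exact top_disjoint.1 (this ▸ hUW.1)

/-- The image of `1 ⊗ 1` is `Q`-fixed and generates, so that no nonzero `S`-invariant functional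
kills all its translates; hence `Q` is contained in some conjugate of `H'`. -/
lemma Isolates.exists_conj {H' : Subgroup Γ} {Θ Θ' : Γ →* Fˣ}
    (hiso : (monoRep H Θ).Iso (monoRep H' Θ')) : ∃ x, ∀ q ∈ Q, x⁻¹ * q * x ∈ H' := by
  by_contra! hne
  obtain ⟨e⟩ := hiso
  obtain ⟨ψ, hψ0, -, hψ⟩ := exists_invariant_functional p (M := monoRep H' Θ') h.pgroup ⊥
    (fun s _ x hx => by
      rw [Submodule.mem_bot] at hx ⊢
      rw [hx, map_zero]) bot_ne_top
  apply hψ0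
  have hfix : ∀ q ∈ Q, (monoRep H' Θ').ρ q (e.toLinearMap (ev H Θ 1)) = e.toLinearMap (ev H Θ 1) :=
    fun q hq => by rw [← map_act, h.ev_fixed Θ q hq]
  have h1 : ψ ∘ₗ e.toLinearMap = 0 := mono_hom_ext fun x => by
    rw [LinearMap.comp_apply, ← act_ev_one, map_act]
    have := functional_eq_zero p H' Θ' h.pgroup_Q _
      (fun q hq => invariant_comp h.normal hψ x q (h.le_S hq)) _ hfix fun y hy => by
        obtain ⟨q, hq, hq'⟩ := hne y
        exact absurd (hy q hq) hq'
    exact this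
  refine LinearMap.ext fun m => ?_
  obtain ⟨m, rfl⟩ := e.toLinearEquiv.surjective m
  exact LinearMap.congr_fun h1 m

/-- The linear character can be read off from the induced module. -/
theorem Isolates.char_eq {Θ Θ' : Γ →* Fˣ} (hiso : (monoRep H Θ).Iso (monoRep H Θ')) :
    ∀ k ∈ H, Θ k = Θ' k := by
  obtain ⟨e⟩ := hiso
  let m := e.toLinearMap (ev H Θ 1)
  have hact : ∀ x, e.toLinearMap (ev H Θ x) = (monoRep H Θ').ρ x m := fun x => by
    rw [← act_ev_one, map_act]
  have hfix : ∀ q ∈ Q, (monoRep H Θ').ρ q m = m :=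
    fun q hq => by rw [← map_act, h.ev_fixed Θ q hq]
  have key : ∀ x, h.top Θ' ((monoRep H Θ').ρ x m)
      = h.top Θ' (ev H Θ' x) * h.top Θ' m := fun x => by
    have := h.functional_eq Θ' _ (invariant_comp h.normal (h.top_act Θ') x) hfix
    rwa [LinearMap.comp_apply, LinearMap.comp_apply, act_ev_one] at this
  have hT : h.top Θ' m ≠ 0 := fun h0 => by
    have h1 : h.top Θ' ∘ₗ e.toLinearMap = 0 := mono_hom_ext fun x => by
      rw [LinearMap.comp_apply, hact, key, h0, mul_zero]; rfl
    obtain ⟨n, hn⟩ := e.toLinearEquiv.surjective (ev H Θ' 1)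
    have h2 := LinearMap.congr_fun h1 n
    have h3 : e.toLinearMap n = ev H Θ' 1 := hn
    rw [LinearMap.comp_apply, h3, h.top_ev] at h2
    exact one_ne_zero h2
  intro k hk
  have h1 := key k
  rw [← hact, ← act_ev_one H Θ, ← act_ev_one H Θ', act_ev_of_mem Θ hk, act_ev_of_mem Θ' hk, map_smul,
    map_smul, map_smul, h.top_ev, smul_eq_mul, smul_eq_mul, mul_one] at h1
  exact Units.ext (mul_right_cancel₀ hT h1)

end Local

/-! ### Multiplicities of induced modules as direct summands -/

section Multiplicity

variable {F : Type u} [Field F] {Γ : Type v} [Group Γ]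

/-- The subspace of `M` on which `H` acts through `Θ`, that is, `Hom(Ind_H^Γ (F_Θ), M)`. -/
def eigenspace (H : Subgroup Γ) (Θ : Γ →* Fˣ) (M : FinRep F Γ) : Submodule F M.V where
  carrier := {m | ∀ h ∈ H, M.ρ h m = (Θ h : F) • m}
  zero_mem' := fun h _ => by rw [map_zero, smul_zero]
  add_mem' := fun ha hb h hh => by rw [map_add, ha h hh, hb h hh, smul_add]
  smul_mem' := fun c m hm h hh => by rw [map_smul, hm h hh, smul_comm]

variable [Finite Γ]

/-- The maps from `Ind_H^Γ (F_Θ)` to `M`, viewed as vectors in `M`, that become zero under `T`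
after composition with any map back to `Ind_H^Γ (F_Θ)`. -/
def eigenRad (H : Subgroup Γ) (Θ : Γ →* Fˣ) (T : (monoRep H Θ).V →ₗ[F] F) (M : FinRep F Γ) :
    Submodule F M.V where
  carrier := {m | m ∈ eigenspace H Θ M ∧
    ∀ f : M.ρ.IntertwiningMap (monoRep H Θ).ρ, T (f.toLinearMap m) = 0}
  zero_mem' := ⟨zero_mem _, fun f => by rw [map_zero, map_zero]⟩
  add_mem' := fun ha hb => ⟨add_mem ha.1 hb.1, fun f => by
    rw [map_add, map_add, ha.2, hb.2, add_zero]⟩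
  smul_mem' := fun c m hm => ⟨Submodule.smul_mem _ c hm.1, fun f => by
    rw [map_smul, map_smul, hm.2, smul_zero]⟩

/-- The rank of the pairing between `Hom(X, M)` and `Hom(M, X)` given by composition and `T`, for
`X = Ind_H^Γ (F_Θ)`. If `X` has a local endomorphism ring with residue field `F`, this is the
multiplicity of `X` as a direct summand of `M`. -/
def mult (H : Subgroup Γ) (Θ : Γ →* Fˣ) (T : (monoRep H Θ).V →ₗ[F] F) (M : FinRep F Γ) : ℤ :=
  Module.finrank F (eigenspace H Θ M) - Module.finrank F (eigenRad H Θ T M)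

variable (H : Subgroup Γ) (Θ : Γ →* Fˣ) (T : (monoRep H Θ).V →ₗ[F] F)

lemma mult_congr {M N : FinRep F Γ} (h : M.Iso N) : mult H Θ T M = mult H Θ T N := by
  obtain ⟨e⟩ := h
  have h1 : (eigenspace H Θ M).map (e.toLinearEquiv : M.V →ₗ[F] N.V) = eigenspace H Θ N := by
    ext n
    obtain ⟨m, rfl⟩ := e.toLinearEquiv.surjective n
    rw [Submodule.mem_map_equiv, LinearEquiv.symm_apply_apply]
    refine forall₂_congr fun h _ => ?_
    rw [← e.toLinearEquiv.injective.eq_iff, map_smul]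
    exact Eq.congr_left (map_act _ _ (f := e.toIntertwiningMap) h m)
  have h2 : (eigenRad H Θ T M).map (e.toLinearEquiv : M.V →ₗ[F] N.V) = eigenRad H Θ T N := by
    ext n
    obtain ⟨m, rfl⟩ := e.toLinearEquiv.surjective n
    rw [Submodule.mem_map_equiv, LinearEquiv.symm_apply_apply]
    refine and_congr ?_ ⟨fun hm f => hm (f.comp e.toIntertwiningMap), fun hn f => ?_⟩
    · rw [← h1, Submodule.mem_map_equiv, LinearEquiv.symm_apply_apply]
    · have := hn (f.comp e.symm.toIntertwiningMap)
      rw [Representation.IntertwiningMap.comp_toLinearMap, LinearMap.comp_apply] at this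
      rwa [show e.symm.toIntertwiningMap.toLinearMap (e.toLinearEquiv m) = m from
        equiv_symm_left e m] at this
  unfold mult
  rw [← h1, ← h2, LinearEquiv.finrank_map_eq, LinearEquiv.finrank_map_eq]

lemma finrank_submodule_prod {V W : Type*} [AddCommGroup V] [Module F V] [AddCommGroup W]
    [Module F W] [Module.Finite F V] [Module.Finite F W] (A : Submodule F V) (B : Submodule F W) :
    Module.finrank F (A.prod B) = Module.finrank F A + Module.finrank F B := by
  rw [← Module.finrank_prod]
  exact LinearEquiv.finrank_eq
    { toFun := fun x => (⟨x.1.1, x.2.1⟩, ⟨x.1.2, x.2.2⟩)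
      invFun := fun x => ⟨(x.1.1, x.2.1), x.1.2, x.2.2⟩
      map_add' := fun _ _ => rfl
      map_smul' := fun _ _ => rfl
      left_inv := fun _ => rfl
      right_inv := fun _ => rfl }

lemma mult_sum (M N : FinRep F Γ) : mult H Θ T (M.sum N) = mult H Θ T M + mult H Θ T N := by
  have h1 : eigenspace H Θ (M.sum N) = (eigenspace H Θ M).prod (eigenspace H Θ N) := by
    ext x
    exact ⟨fun h => ⟨fun k hk => congrArg Prod.fst (h k hk), fun k hk => congrArg Prod.snd (h k hk)⟩,
      fun h k hk => Prod.ext (h.1 k hk) (h.2 k hk)⟩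
  have h2 : eigenRad H Θ T (M.sum N) = (eigenRad H Θ T M).prod (eigenRad H Θ T N) := by
    ext x
    have hx : x ∈ eigenspace H Θ (M.sum N) ↔ x ∈ (eigenspace H Θ M).prod (eigenspace H Θ N) := by
      rw [h1]; rfl
    refine ⟨fun h => ⟨⟨(hx.1 h.1).1, fun f => h.2 (f.comp (sfst M N))⟩,
      ⟨(hx.1 h.1).2, fun f => h.2 (f.comp (ssnd M N))⟩⟩, fun h => ⟨hx.2 ⟨h.1.1, h.2.1⟩, fun f => ?_⟩⟩
    rw [← sum_decomp M N x, map_add, map_add]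
    have e1 := h.1.2 (f.comp (sinl M N))
    have e2 := h.2.2 (f.comp (sinr M N))
    rw [Representation.IntertwiningMap.comp_toLinearMap, LinearMap.comp_apply] at e1 e2
    exact (congrArg₂ (· + ·) e1 e2).trans (add_zero _)
  have e1 := (congrArg (fun A : Submodule F (M.sum N).V => Module.finrank F A) h1).trans
    (finrank_submodule_prod (eigenspace H Θ M) (eigenspace H Θ N))
  have e2 := (congrArg (fun A : Submodule F (M.sum N).V => Module.finrank F A) h2).trans
    (finrank_submodule_prod (eigenRad H Θ T M) (eigenRad H Θ T N))
  unfold mult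
  rw [e1, e2]
  push_cast
  ring

variable {H} in
lemma ev_mem_eigenspace : ev H Θ 1 ∈ eigenspace H Θ (monoRep H Θ) :=
  fun _ hk => act_ev_of_mem Θ hk

variable {p : ℕ} [hp : Fact p.Prime] [CharP F p] {H} {S Q : Subgroup Γ} (h : Isolates p S Q H)

include h

omit [Finite Γ] in
lemma Isolates.fixed_of_mem_eigenspace {M : FinRep F Γ} {m : M.V} (hm : m ∈ eigenspace H Θ M)
    (q : Γ) (hq : q ∈ Q) : M.ρ q m = m := by
  rw [hm q (h.le_H hq), char_eq_one p Θ h.pgroup_Q hq, Units.val_one, one_smul]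

/-- The functional `top` is multiplicative on endomorphisms. -/
lemma Isolates.top_apply (f : (monoRep H Θ).ρ.IntertwiningMap (monoRep H Θ).ρ)
    {m : (monoRep H Θ).V} (hm : m ∈ eigenspace H Θ (monoRep H Θ)) :
    h.top Θ (f.toLinearMap m) = h.top Θ (f.toLinearMap (ev H Θ 1)) * h.top Θ m := by
  have := h.functional_eq Θ (h.top Θ ∘ₗ f.toLinearMap) (fun s hs n => by
    rw [LinearMap.comp_apply, LinearMap.comp_apply, map_act, h.top_act Θ s hs])
    (h.fixed_of_mem_eigenspace Θ hm)
  exact this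

/-- The space `Hom(X, X)` modulo the kernel of the pairing is mapped isomorphically to `F` by `top`. -/
lemma Isolates.mult_self : mult H Θ (h.top Θ) (monoRep H Θ) = 1 := by
  let A := eigenspace H Θ (monoRep H Θ)
  let τ : A →ₗ[F] F := h.top Θ ∘ₗ A.subtype
  have hτ : LinearMap.range τ = ⊤ := LinearMap.range_eq_top.2 fun c =>
    ⟨c • ⟨ev H Θ 1, ev_mem_eigenspace Θ⟩, by
      rw [map_smul]
      exact (congrArg (c • ·) (h.top_ev Θ)).trans (mul_one c)⟩
  have hR : eigenRad H Θ (h.top Θ) (monoRep H Θ) = (LinearMap.ker τ).map A.subtype := by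
    ext m
    constructor
    · intro hm
      exact ⟨⟨m, hm.1⟩, hm.2 (.id _), rfl⟩
    · rintro ⟨m, hm, rfl⟩
      refine ⟨m.2, fun f => ?_⟩
      exact (h.top_apply Θ f m.2).trans (mul_eq_zero_of_right _ hm)
  have h1 := τ.finrank_range_add_finrank_ker
  rw [hτ, finrank_top, Module.finrank_self] at h1
  unfold mult
  rw [hR, Submodule.finrank_map_subtype_eq, show eigenspace H Θ (monoRep H Θ) = A from rfl, ← h1]
  push_cast
  ring

lemma Isolates.mult_eq_zero {Y : FinRep F Γ} (hY : Y.Indecomposable)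
    (hiso : ¬ Y.Iso (monoRep H Θ)) : mult H Θ (h.top Θ) Y = 0 := by
  have : eigenRad H Θ (h.top Θ) Y = eigenspace H Θ Y := by
    refine le_antisymm (fun m hm => hm.1) fun m hm => ⟨hm, fun f => ?_⟩
    by_contra hne
    apply hiso
    have hfix : ∀ q ∈ Q, (monoRep H Θ).ρ q (f.toLinearMap m) = f.toLinearMap m := fun q hq => by
      rw [← map_act, h.fixed_of_mem_eigenspace Θ hm q hq]
    let g := monoHom H Θ Y m hm
    have hg : g.toLinearMap (ev H Θ 1) = m := by
      exact (monoHom_ev H Θ Y m hm 1).trans (act_one _ _)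
    have hsurj : LinearMap.range (f.toLinearMap ∘ₗ g.toLinearMap) = ⊤ :=
      h.generates Θ hfix hne _ (by
        rintro x _ ⟨n, rfl⟩
        exact ⟨(monoRep H Θ).ρ x n, by
          rw [LinearMap.comp_apply, LinearMap.comp_apply, map_act, map_act]⟩)
        ⟨ev H Θ 1, by rw [LinearMap.comp_apply, hg]⟩
    have hsurj' := LinearMap.range_eq_top.1 hsurj
    exact (iso_of_comp_bijective hY g f ⟨LinearMap.injective_iff_surjective.2 hsurj',
      hsurj'⟩).symm
  unfold mult
  rw [this, sub_self]

end Multiplicity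

section LinearIndependence

variable {F : Type u} [Field F] {G : Type v} [Group G] [Finite G]

/-- The multiplicity as a homomorphism on the representation ring. -/
def multHom (H : Subgroup (G × G)) (Θ : G × G →* Fˣ) (T : (monoRep H Θ).V →ₗ[F] F) :
    BimodRing F G →+ ℤ :=
  let φ : FreeAbelianGroup (IsoClass F G) →+ ℤ :=
    FreeAbelianGroup.lift (Quotient.lift (mult H Θ T) fun _ _ h => mult_congr H Θ T h)
  AddCon.lift (splitIdeal F G).ringCon.toAddCon φ (by
    intro x y hxy
    change (splitIdeal F G).ringCon x y at hxy
    rw [TwoSidedIdeal.rel_iff, splitIdeal, TwoSidedIdeal.mem_mk'] at hxy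
    have key : ∀ z ∈ sumRel F G, φ z = 0 := fun z hz => by
      induction hz using AddSubgroup.closure_induction with
      | zero => exact map_zero _
      | add a b _ _ ha hb => rw [map_add, ha, hb, add_zero]
      | neg a _ ha => rw [map_neg, ha, neg_zero]
      | mem a ha =>
        obtain ⟨M, N, rfl⟩ := ha
        have hφ : ∀ K : FinRep F (G × G), φ (preCls K) = mult H Θ T K := fun K =>
          FreeAbelianGroup.lift_apply_of _ _
        rw [map_sub, map_sub, hφ, hφ, hφ, mult_sum]
        ring
    have := key _ hxy
    rw [map_sub, sub_eq_zero] at this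
    exact this)

lemma multHom_cls (H : Subgroup (G × G)) (Θ : G × G →* Fˣ) (T : (monoRep H Θ).V →ₗ[F] F)
    (M : FinRep F (G × G)) : multHom H Θ T (cls M) = mult H Θ T M :=
  FreeAbelianGroup.lift_apply_of _ _

/-- Multiplicities are additive functions that are dual to the classes of the modules in question, so
that these classes are linearly independent; the Krull–Schmidt theorem is not needed. -/
theorem linearIndependent_cls {p : ℕ} [hp : Fact p.Prime] [CharP F p] {ι : Type*}
    {S : Subgroup (G × G)} (Q H : ι → Subgroup (G × G)) (Θ : ι → G × G →* Fˣ)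
    (h : ∀ t, Isolates p S (Q t) (H t))
    (hne : ∀ s t, (monoRep (H s) (Θ s)).Iso (monoRep (H t) (Θ t)) → s = t) :
    LinearIndependent ℤ fun t => cls (monoRep (H t) (Θ t)) := by
  rw [linearIndependent_iff']
  intro s c hc t ht
  have := congrArg (multHom (H t) (Θ t) ((h t).top (Θ t))) hc
  rw [map_sum, map_zero, Finset.sum_eq_single t] at this
  · rwa [map_zsmul, multHom_cls, (h t).mult_self, smul_eq_mul, mul_one] at this
  · intro r _ hr
    rw [map_zsmul, multHom_cls, (h t).mult_eq_zero _ ((h r).indecomposable _)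
      (fun h' => hr (hne r t h')), smul_zero]
  · exact fun h' => absurd ht h'

end LinearIndependence

/-! ### Permutation bases and relative projectivity -/

section RelProjective

variable {F : Type u} [Field F] {Γ : Type v} [Group Γ] [Finite Γ]

/-- The basis `Θ(y)⁻¹ y ⊗ 1` of `Ind_H^Γ (F_Θ)`, which depends only on the cosets `y H`. -/
def monoBasis (H : Subgroup Γ) (Θ : Γ →* Fˣ) : Module.Basis (Γ ⧸ H) F (monoRep H Θ).V :=
  .ofEquivFun (.ofLinearMap
    (LinearMap.pi fun y => (Θ y.out : F) • (monoDelta H Θ ∘ₗ (monoRep H Θ).ρ (y.out)⁻¹))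
    (∑ y, (LinearMap.proj y).smulRight ((Θ y.out : F)⁻¹ • ev H Θ y.out))
    (by
      classical
      refine LinearMap.ext fun c => funext fun y => ?_
      simp only [LinearMap.comp_apply, LinearMap.sum_apply, map_sum, LinearMap.smulRight_apply,
        map_smul, LinearMap.proj_apply, LinearMap.id_apply, LinearMap.pi_apply,
        LinearMap.smul_apply]
      rw [Finset.sum_eq_single y]
      · rw [ev_act, inv_mul_cancel, monoDelta_of_mem Θ (one_mem H)]
        simp
      · intro z _ hz
        rw [ev_act, monoDelta_of_notMem]
        · simp
        · rw [← QuotientGroup.eq, QuotientGroup.out_eq', QuotientGroup.out_eq']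
          exact fun h' => hz h'.symm
      · simp)
    (by
      refine LinearMap.ext fun m => ?_
      conv_rhs => rw [LinearMap.id_apply, mono_expand H Θ m]
      rw [LinearMap.comp_apply, LinearMap.sum_apply]
      refine Finset.sum_congr rfl fun y _ => ?_
      simp only [LinearMap.smulRight_apply, LinearMap.proj_apply, LinearMap.pi_apply,
        LinearMap.smul_apply, LinearMap.comp_apply, smul_smul, smul_eq_mul]
      have h2 : (Θ y.out : F) ≠ 0 := (Θ y.out).ne_zero
      congr 1
      field_simp))

lemma monoBasis_apply (H : Subgroup Γ) (Θ : Γ →* Fˣ) (g : Γ) :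
    monoBasis H Θ (g : Γ ⧸ H) = (Θ g : F)⁻¹ • ev H Θ g := by
  classical
  have : ∀ y : Γ ⧸ H, monoBasis H Θ y = (Θ y.out : F)⁻¹ • ev H Θ y.out := fun y => by
    rw [monoBasis, Module.Basis.coe_ofEquivFun]
    change (∑ z : Γ ⧸ H, (LinearMap.proj z).smulRight ((Θ z.out : F)⁻¹ • ev H Θ z.out))
      (Pi.single y 1) = _
    rw [LinearMap.sum_apply, Finset.sum_eq_single y]
    · simp
    · intro z _ hz
      rw [LinearMap.smulRight_apply, LinearMap.proj_apply, Pi.single_eq_of_ne hz, zero_smul]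
    · simp
  obtain ⟨h, hh⟩ := QuotientGroup.mk_out_eq_mul H g
  have h2 : (Θ g : F) ≠ 0 := (Θ g).ne_zero
  have h3 : (Θ h : F) ≠ 0 := (Θ h).ne_zero
  rw [this, hh, ev_mul Θ g h.2, smul_smul, map_mul, Units.val_mul]
  congr 1
  field_simp

lemma monoRep_pPermutation (p : ℕ) [Fact p.Prime] [CharP F p] (H : Subgroup Γ) (Θ : Γ →* Fˣ) :
    (monoRep H Θ).PPermutation p := fun P hP => by
  let e := Finite.equivFin (Γ ⧸ H)
  refine ⟨Fin (Nat.card (Γ ⧸ H)), (monoBasis H Θ).reindex e, fun g hg i => ?_⟩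
  obtain ⟨y, hy⟩ := QuotientGroup.mk_surjective (e.symm i)
  refine ⟨e ((g * y : Γ) : Γ ⧸ H), ?_⟩
  rw [Module.Basis.reindex_apply, Module.Basis.reindex_apply, Equiv.symm_apply_apply, ← hy,
    monoBasis_apply, monoBasis_apply, map_smul, ev_act, map_mul, char_eq_one p Θ hP hg, one_mul]

/-- `Ind_Q^Γ (Res_Q M)` as a finitely generated module. -/
def indRes (M : FinRep F Γ) (Q : Subgroup Γ) : FinRep F Γ where
  V := Representation.IndV Q.subtype (M.ρ.comp Q.subtype)
  ρ := Representation.ind Q.subtype (M.ρ.comp Q.subtype)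

/-- The element `g⁻¹ ⊗ m` of `Ind_Q^Γ (Res_Q M) = FΓ ⊗_{FQ} M`. -/
def irMk (M : FinRep F Γ) (Q : Subgroup Γ) (g : Γ) : M.V →ₗ[F] (indRes M Q).V :=
  Representation.IndV.mk Q.subtype (M.ρ.comp Q.subtype) g

lemma irMk_act (M : FinRep F Γ) (Q : Subgroup Γ) (x g : Γ) (m : M.V) :
    (indRes M Q).ρ x (irMk M Q g m) = irMk M Q (g * x⁻¹) m :=
  Representation.ind_mk Q.subtype (M.ρ.comp Q.subtype) x g m

lemma irMk_mul (M : FinRep F Γ) {Q : Subgroup Γ} {q : Γ} (hq : q ∈ Q) (g : Γ) (m : M.V) :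
    irMk M Q (q * g) (M.ρ q m) = irMk M Q g m :=
  indV_mk_mul Q.subtype (M.ρ.comp Q.subtype) ⟨q, hq⟩ g m

lemma irMk_hom_ext {M : FinRep F Γ} {Q : Subgroup Γ} {W : Type*} [AddCommGroup W] [Module F W]
    {f f' : (indRes M Q).V →ₗ[F] W} (h : ∀ g m, f (irMk M Q g m) = f' (irMk M Q g m)) : f = f' :=
  Representation.IndV.hom_ext _ _ fun g => LinearMap.ext fun m => h g m

/-- The universal property of `Ind_Q^Γ (Res_Q M)`. -/
def irLift (M : FinRep F Γ) (Q : Subgroup Γ) {W : Type*} [AddCommGroup W] [Module F W]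
    (f : Γ → M.V →ₗ[F] W) (hf : ∀ q ∈ Q, ∀ g m, f (q * g) (M.ρ q m) = f g m) :
    (indRes M Q).V →ₗ[F] W :=
  indLift Q.subtype (M.ρ.comp Q.subtype) f fun q g => LinearMap.ext fun m => hf q q.2 g m

lemma irLift_mk (M : FinRep F Γ) (Q : Subgroup Γ) {W : Type*} [AddCommGroup W] [Module F W]
    (f : Γ → M.V →ₗ[F] W) (hf : ∀ q ∈ Q, ∀ g m, f (q * g) (M.ρ q m) = f g m) (g : Γ) (m : M.V) :
    irLift M Q f hf (irMk M Q g m) = f g m :=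
  indLift_mk Q.subtype (M.ρ.comp Q.subtype) f _ g m

/-- The canonical map from `Ind_Q^Γ (Res_Q M)` to `M`. -/
def irCounit (M : FinRep F Γ) (Q : Subgroup Γ) : (indRes M Q).ρ.IntertwiningMap M.ρ where
  toLinearMap := irLift M Q (fun g => M.ρ g⁻¹) fun q _ g m => by
    rw [act_act]; simp
  isIntertwining' x := irMk_hom_ext fun g m => by
    rw [LinearMap.comp_apply, LinearMap.comp_apply, irMk_act, irLift_mk, irLift_mk, act_act]
    simp

lemma irCounit_mk (M : FinRep F Γ) (Q : Subgroup Γ) (g : Γ) (m : M.V) :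
    (irCounit M Q).toLinearMap (irMk M Q g m) = M.ρ g⁻¹ m :=
  irLift_mk M Q (fun g => M.ρ g⁻¹) (fun q _ g m => by rw [act_act]; simp) g m

/-- A direct summand of `Ind_Q^Γ F` is relatively `Q`-projective. -/
lemma relProjective_of_summand {M : FinRep F Γ} {Q : Subgroup Γ}
    (i : M.ρ.IntertwiningMap (monoRep Q (1 : Γ →* Fˣ)).ρ)
    (r : (monoRep Q (1 : Γ →* Fˣ)).ρ.IntertwiningMap M.ρ)
    (h : ∀ m, r.toLinearMap (i.toLinearMap m) = m) : M.RelProjective Q := by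
  have hq : ∀ q ∈ Q, M.ρ q (r.toLinearMap (ev Q 1 1)) = r.toLinearMap (ev Q 1 1) := fun q hq => by
    rw [← map_act, act_ev_of_mem _ hq]; simp
  let f := monoHom Q 1 (indRes M Q) (irMk M Q 1 (r.toLinearMap (ev Q 1 1))) fun q hq' => by
    have := irMk_mul M (inv_mem hq') 1 (r.toLinearMap (ev Q 1 1))
    rw [hq _ (inv_mem hq'), mul_one] at this
    rw [irMk_act, one_mul, this]
    simp
  have hf : (irCounit M Q).toLinearMap ∘ₗ f.toLinearMap = r.toLinearMap := mono_hom_ext fun g => by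
    rw [LinearMap.comp_apply, monoHom_ev, irMk_act, irCounit_mk, one_mul, inv_inv, ← map_act,
      act_ev_one]
  refine ⟨f.comp i, irCounit M Q, Representation.IntertwiningMap.ext (LinearMap.ext fun m => ?_)⟩
  exact (LinearMap.congr_fun hf _).trans (h m)

/-- If `Q` permutes a basis of `M`, then `Ind_Q^Γ (Res_Q M)` is a direct sum of modules induced
from trivial modules of subgroups of `Q`. -/
lemma exists_biproduct_indRes (M : FinRep F Γ) (Q : Subgroup Γ) {ι : Type}
    (b : Module.Basis ι F M.V) (hb : ∀ g ∈ Q, ∀ i, ∃ j, M.ρ g (b i) = b j) :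
    ∃ (κ : Type) (_ : Fintype κ) (R : κ → Subgroup Γ), (∀ t, R t ≤ Q) ∧
      Nonempty (Biproduct (indRes M Q) fun t => monoRep (R t) (1 : Γ →* Fˣ)) := by
  classical
  have : Finite ι := Module.Finite.finite_basis b
  let s : Setoid ι :=
    { r := fun i j => ∃ q ∈ Q, M.ρ q (b i) = b j
      iseqv :=
        { refl := fun i => ⟨1, one_mem _, act_one _ _⟩
          symm := by
            rintro i j ⟨q, hq, h⟩
            exact ⟨q⁻¹, inv_mem hq, by rw [← h, act_act, inv_mul_cancel, act_one]⟩
          trans := by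
            rintro i j k ⟨q, hq, h⟩ ⟨q', hq', h'⟩
            exact ⟨q' * q, mul_mem hq' hq, by rw [← act_act, h, h']⟩ } }
  let R : Quotient s → Subgroup Γ := fun t =>
    { carrier := {q | q ∈ Q ∧ M.ρ q (b t.out) = b t.out}
      one_mem' := ⟨one_mem _, act_one _ _⟩
      mul_mem' := fun h h' => ⟨mul_mem h.1 h'.1, by rw [← act_act, h'.2, h.2]⟩
      inv_mem' := fun {x} h => ⟨inv_mem h.1, by
        conv_lhs => rw [← h.2]
        rw [act_act, inv_mul_cancel, act_one]⟩ }
  let B : Quotient s → (indRes M Q).V →ₗ[F] F := fun t => irLift M Q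
    (fun g => if g ∈ Q then b.coord t.out ∘ₗ M.ρ g⁻¹ else 0) fun q hq g m => by
      by_cases hg : g ∈ Q
      · rw [if_pos hg, if_pos (mul_mem hq hg), LinearMap.comp_apply, LinearMap.comp_apply, act_act]
        simp
      · rw [if_neg hg, if_neg fun h' => hg ((Q.mul_mem_cancel_left hq).1 h')]
        rfl
  refine ⟨Quotient s, Fintype.ofFinite _, R, fun t q hq => hq.1, ?_⟩
  let _ : Fintype (Quotient s) := Fintype.ofFinite _
  refine exists_biproduct_mono (indRes M Q) R (fun _ => 1) (fun t => irMk M Q 1 (b t.out)) B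
    (fun t q hq => ?_) (fun U hU => ?_) (fun t t' g => ?_) (fun t => ?_)
  · have := irMk_mul M (inv_mem hq.1) 1 (b t.out)
    rw [(R t).inv_mem hq |>.2, mul_one] at this
    rw [irMk_act, one_mul, this]
    simp
  · have key : ∀ g i, irMk M Q g (b i) ∈ U := fun g i => by
      obtain ⟨q, hq, h⟩ : s (Quotient.mk s i).out i := Quotient.mk_out i
      have h1 := irMk_mul M hq (q⁻¹ * g) (b (Quotient.mk s i).out)
      rw [h, mul_inv_cancel_left] at h1
      have h2 := hU (Quotient.mk s i) (q⁻¹ * g)⁻¹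
      rw [irMk_act, one_mul, inv_inv] at h2
      rwa [h1]
    have h0 : U.mkQ = 0 := irMk_hom_ext fun g m => by
      have : U.mkQ ∘ₗ irMk M Q g = 0 := b.ext fun i => by
        rw [LinearMap.comp_apply, LinearMap.zero_apply]
        exact (Submodule.Quotient.mk_eq_zero U).2 (key g i)
      exact LinearMap.congr_fun this m
    rw [← U.ker_mkQ, h0, LinearMap.ker_zero]
  · have h1 : B t' ((indRes M Q).ρ g (irMk M Q 1 (b t.out)))
        = (if g⁻¹ ∈ Q then b.coord t'.out ∘ₗ M.ρ g⁻¹⁻¹ else 0) (b t.out) := by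
      rw [irMk_act, one_mul]
      exact irLift_mk _ _ _ _ _ _
    by_cases hg : g ∈ Q
    · obtain ⟨j, hj⟩ := hb g hg t.out
      by_cases hjt : j = t'.out
      · right
        subst hjt
        have : t = t' := by
          have h2 : s t.out t'.out := ⟨g, hg, hj⟩
          have h3 := Quotient.sound h2
          rwa [Quotient.out_eq, Quotient.out_eq] at h3
        subst this
        exact ⟨rfl, hg, hj⟩
      · left
        rw [LinearMap.mem_ker, h1, if_pos (inv_mem hg), inv_inv, LinearMap.comp_apply, hj,
          Module.Basis.coord_apply, Module.Basis.repr_self, Finsupp.single_eq_of_ne (Ne.symm hjt)]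
    · left
      rw [LinearMap.mem_ker, h1, if_neg fun h' => hg ((Q.inv_mem_iff).1 h')]
      rfl
  · have h1 : B t (irMk M Q 1 (b t.out)) = (if (1 : Γ) ∈ Q then b.coord t.out ∘ₗ M.ρ 1⁻¹ else 0)
        (b t.out) := irLift_mk _ _ _ _ _ _
    rw [h1, if_pos (one_mem _), LinearMap.comp_apply, inv_one, act_one,
      Module.Basis.coord_apply, Module.Basis.repr_self, Finsupp.single_eq_same]
    exact one_ne_zero

end RelProjective

/-! ### Closure under direct summands -/

section SummandOf

variable {F : Type u} [Field F] {Γ : Type v} [Group Γ]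

/-- `M` is a direct summand of a finite direct sum of modules in the class `C`. -/
def FinRep.SummandOf (M : FinRep F Γ) (C : FinRep F Γ → Prop) : Prop :=
  ∃ (k : ℕ) (X : Fin k → FinRep F Γ) (i : ∀ t, M.ρ.IntertwiningMap (X t).ρ)
    (r : ∀ t, (X t).ρ.IntertwiningMap M.ρ), (∀ t, C (X t)) ∧
      ∀ m, ∑ t, (r t).toLinearMap ((i t).toLinearMap m) = m

lemma FinRep.SummandOf.of_fintype {M : FinRep F Γ} {C : FinRep F Γ → Prop} {ι : Type*} [Fintype ι]
    (X : ι → FinRep F Γ) (i : ∀ t, M.ρ.IntertwiningMap (X t).ρ)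
    (r : ∀ t, (X t).ρ.IntertwiningMap M.ρ) (hX : ∀ t, C (X t))
    (h : ∀ m, ∑ t, (r t).toLinearMap ((i t).toLinearMap m) = m) : M.SummandOf C := by
  let e := (Fintype.equivFin ι).symm
  refine ⟨_, fun t => X (e t), fun t => i (e t), fun t => r (e t), fun t => hX _, fun m => ?_⟩
  rw [e.sum_comp fun t => (r t).toLinearMap ((i t).toLinearMap m)]
  exact h m

lemma Biproduct.summandOf {M : FinRep F Γ} {C : FinRep F Γ → Prop} {ι : Type*} [Fintype ι]
    {X : ι → FinRep F Γ} (b : Biproduct M X) (hX : ∀ t, C (X t)) : M.SummandOf C :=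
  .of_fintype X b.proj b.inc hX b.sum_inc_proj

lemma FinRep.SummandOf.trans {M : FinRep F Γ} {C C' : FinRep F Γ → Prop} (h : M.SummandOf C)
    (h' : ∀ X, C X → X.SummandOf C') : M.SummandOf C' := by
  obtain ⟨k, X, i, r, hX, hm⟩ := h
  choose l Y i' r' hY hm' using fun t => h' (X t) (hX t)
  refine .of_fintype (ι := Σ t, Fin (l t)) (fun s => Y s.1 s.2) (fun s => (i' s.1 s.2).comp (i s.1))
    (fun s => (r s.1).comp (r' s.1 s.2)) (fun s => hY s.1 s.2) fun m => ?_
  rw [Fintype.sum_sigma]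
  conv_rhs => rw [← hm m]
  refine Finset.sum_congr rfl fun t _ => ?_
  conv_rhs => rw [← hm' t ((i t).toLinearMap m), map_sum]
  rfl

lemma FinRep.SummandOf.of_summand {M N : FinRep F Γ} {C : FinRep F Γ → Prop}
    (i : M.ρ.IntertwiningMap N.ρ) (r : N.ρ.IntertwiningMap M.ρ)
    (h : ∀ m, r.toLinearMap (i.toLinearMap m) = m) (hN : N.SummandOf C) : M.SummandOf C :=
  FinRep.SummandOf.trans (C := (· = N)) (.of_fintype (ι := Unit) (fun _ => N) (fun _ => i)
    (fun _ => r) (fun _ => rfl) fun m => by rw [Fintype.sum_unique]; exact h m)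
    fun _ hX => hX ▸ hN

lemma FinRep.Indecomposable.exists_iso_of_summandOf {M : FinRep F Γ} (hM : M.Indecomposable)
    {C : FinRep F Γ → Prop} (h : M.SummandOf C) (hC : ∀ X, C X → X.Indecomposable) :
    ∃ X, C X ∧ M.Iso X := by
  obtain ⟨k, X, i, r, hX, hm⟩ := h
  obtain ⟨t, ht⟩ := hM.exists_iso X (fun t => hC _ (hX t)) i r (LinearMap.ext fun m => by
    rw [LinearMap.sum_apply]
    exact hm m)
  exact ⟨X t, hX t, ht⟩

variable [Finite Γ]

/-- A relatively `Q`-projective `p`-permutation module is a summand of a direct sum of modules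
induced from trivial modules of subgroups of `Q`. -/
lemma FinRep.RelProjective.summandOf {M : FinRep F Γ} {Q : Subgroup Γ} (h : M.RelProjective Q)
    {p : ℕ} (hM : M.PPermutation p) (hQ : IsPGroup p Q) :
    M.SummandOf fun X => ∃ R ≤ Q, X = monoRep R 1 := by
  obtain ⟨i, r, hir⟩ := h
  obtain ⟨ι, b, hb⟩ := hM Q hQ
  obtain ⟨κ, _, R, hR, ⟨B⟩⟩ := exists_biproduct_indRes M Q b hb
  exact .of_summand (N := indRes M Q) i r
    (fun m => congrArg (fun f : M.ρ.IntertwiningMap M.ρ => f.toLinearMap m) hir)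
    (B.summandOf fun t => ⟨R t, hR t, rfl⟩)

omit [Finite Γ] in
lemma pPermutation_bot {M : FinRep F Γ} {Q : Subgroup Γ} (hQ : Q = ⊥) :
    ∃ (ι : Type) (b : Module.Basis ι F M.V), ∀ g ∈ Q, ∀ i, ∃ j, M.ρ g (b i) = b j := by
  refine ⟨_, Module.finBasis F M.V, fun g hg i => ⟨i, ?_⟩⟩
  rw [hQ, Subgroup.mem_bot] at hg
  rw [hg, act_one]

/-- A projective module is a summand of a free one. -/
lemma FinRep.Projective.summandOf {M : FinRep F Γ} (h : M.Projective) :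
    M.SummandOf fun X => X = monoRep ⊥ 1 := by
  have : Module.Projective (MonoidAlgebra F Γ) M.ρ.asModule := h
  let R := Representation.IntertwiningMap.equivLinearMapAsModule _ _ (irCounit M ⊥)
  have hR : Function.Surjective R := fun m =>
    ⟨irMk M ⊥ 1 m, (irCounit_mk M ⊥ 1 m).trans (by rw [inv_one]; exact act_one _ _)⟩
  obtain ⟨s, hs⟩ := Module.projective_lifting_property R LinearMap.id hR
  obtain ⟨ι, b, hb⟩ := pPermutation_bot (M := M) (Q := ⊥) rfl
  obtain ⟨κ, _, R', hR', ⟨B⟩⟩ := exists_biproduct_indRes M ⊥ b hb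
  exact .of_summand (N := indRes M ⊥)
    ((Representation.IntertwiningMap.equivLinearMapAsModule _ _).symm s) (irCounit M ⊥)
    (fun m => LinearMap.congr_fun hs m)
    (B.summandOf fun t => by rw [le_bot_iff.1 (hR' t)])

/-- A summand of `Ind_1^Γ F`, which is the regular module, is projective. -/
lemma projective_of_summand {M : FinRep F Γ}
    (i : M.ρ.IntertwiningMap (monoRep (⊥ : Subgroup Γ) (1 : Γ →* Fˣ)).ρ)
    (r : (monoRep (⊥ : Subgroup Γ) (1 : Γ →* Fˣ)).ρ.IntertwiningMap M.ρ)
    (h : ∀ m, r.toLinearMap (i.toLinearMap m) = m) : M.Projective := by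
  let reg := Representation.ofMulAction F Γ Γ
  have hreg : ∀ x g : Γ, reg x (MonoidAlgebra.single g 1) = MonoidAlgebra.single (x * g) 1 :=
    fun x g => by simp [reg]
  let a : (monoRep (⊥ : Subgroup Γ) (1 : Γ →* Fˣ)).ρ.IntertwiningMap reg :=
    { toLinearMap := monoLift ⊥ 1 (fun g => MonoidAlgebra.single g 1) fun g h hh => by
        rw [Subgroup.mem_bot.1 hh]; simp
      isIntertwining' := fun x => mono_hom_ext fun g => by
        rw [LinearMap.comp_apply, LinearMap.comp_apply, ev_act, monoLift_ev, monoLift_ev, hreg] }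
  have ha : ∀ g, a.toLinearMap (ev ⊥ 1 g) = MonoidAlgebra.single g 1 := fun g =>
    monoLift_ev ⊥ 1 _ _ g
  let c : reg.IntertwiningMap (monoRep (⊥ : Subgroup Γ) (1 : Γ →* Fˣ)).ρ :=
    (Representation.leftRegularMapEquiv _).symm (ev ⊥ 1 1)
  have hc : ∀ g, c.toLinearMap (MonoidAlgebra.single g 1) = ev ⊥ 1 g := fun g => by
    have : c (MonoidAlgebra.single g 1) = _ :=
      Representation.leftRegularMapEquiv_symm_single _ g (ev ⊥ 1 1)
    rw [act_ev_one] at this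
    exact this
  have hca : ∀ x, c.toLinearMap (a.toLinearMap x) = x := fun x => by
    have : c.toLinearMap ∘ₗ a.toLinearMap = LinearMap.id := mono_hom_ext fun g =>
      (congrArg c.toLinearMap (ha g)).trans (hc g)
    exact LinearMap.congr_fun this x
  let e := Representation.ofMulActionSelfAsModuleEquiv (k := F) (G := Γ)
  have : Module.Projective (MonoidAlgebra F Γ) reg.asModule := .of_equiv e.symm
  exact Module.Projective.of_split
    (Representation.IntertwiningMap.equivLinearMapAsModule _ _ (a.comp i))
    (Representation.IntertwiningMap.equivLinearMapAsModule _ _ (r.comp c))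
    (LinearMap.ext fun m => (congrArg r.toLinearMap (hca (i.toLinearMap m))).trans (h m))

end SummandOf

/-! ### Induction from the kernel of the linear characters -/

section Characters

variable {F : Type u} [Field F] {Γ : Type v} [Group Γ] [Finite Γ]

/-- Let `A` be a complement of `R` in `H`, and let the `Θ k` represent the linear characters of
`A`. Then `Ind_R^Γ F` is the direct sum of the `Ind_H^Γ (F_{Θ k})`. -/
theorem exists_biproduct_of_complement {A κ : Type*} [Group A] [Fintype A] [Fintype κ]
    {R H : Subgroup Γ} (σ : A →* Γ) (Θ : κ → Γ →* Fˣ) (Ψ : Γ →* Fˣ) (hRH : R ≤ H)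
    (hσH : ∀ a, σ a ∈ H) (hσR : ∀ a, σ a ∈ R → a = 1) (hdec : ∀ h ∈ H, ∃ a, (σ a)⁻¹ * h ∈ R)
    (hnorm : ∀ a, ∀ r ∈ R, (σ a)⁻¹ * r * σ a ∈ R) (hΘR : ∀ k, ∀ r ∈ R, Θ k r = Ψ r)
    (horth : ∀ k l, k ≠ l → ∑ a, (Θ k (σ a) : F) * (Θ l (σ a) : F)⁻¹ = 0)
    (horth' : ∀ a, a ≠ 1 → ∑ k, (Θ k (σ a) : F)⁻¹ = 0)
    (hA : (Fintype.card A : F) ≠ 0) (hκ : (Fintype.card κ : F) ≠ 0) :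
    Nonempty (Biproduct (monoRep R Ψ) fun k => monoRep H (Θ k)) := by
  classical
  let u : κ → (monoRep R Ψ).V := fun k => ∑ a, (Θ k (σ a) : F)⁻¹ • ev R Ψ (σ a)
  have hu : ∀ k, ∀ h ∈ H, (monoRep R Ψ).ρ h (u k) = (Θ k h : F) • u k := by
    intro k h hh
    obtain ⟨b, hb⟩ := hdec h hh
    have h1 : ∀ a, ev R Ψ (h * σ a) = (Ψ ((σ b)⁻¹ * h) : F) • ev R Ψ (σ (b * a)) := fun a => by
      have : h * σ a = σ (b * a) * ((σ a)⁻¹ * ((σ b)⁻¹ * h) * σ a) := by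
        rw [map_mul]; group
      rw [this, ev_mul Ψ _ (hnorm a _ hb), map_mul, map_mul, map_inv, mul_comm (Ψ (σ a))⁻¹,
        inv_mul_cancel_right]
    have h2 : Θ k h = Θ k (σ b) * Ψ ((σ b)⁻¹ * h) := by
      rw [← hΘR k _ hb, ← map_mul, mul_inv_cancel_left]
    simp only [u, map_sum, map_smul, ev_act, h1, Finset.smul_sum, smul_smul]
    refine Fintype.sum_equiv (Equiv.mulLeft b) _ _ fun a => ?_
    simp only [Equiv.coe_mulLeft, h2, Units.val_mul, map_mul, map_inv,
      Units.val_inv_eq_inv_val]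
    congr 1
    have h3 : (Θ k (σ b) : F) ≠ 0 := (Θ k (σ b)).ne_zero
    field_simp
  let B : κ → (monoRep R Ψ).V →ₗ[F] F := fun k =>
    ∑ a, (Θ k (σ a) : F) • (monoDelta R Ψ ∘ₗ (monoRep R Ψ).ρ (σ a)⁻¹)
  have hB : ∀ k g l, B k ((monoRep R Ψ).ρ g (u l)) = ∑ a, ∑ b, (Θ k (σ a) : F) *
      ((Θ l (σ b) : F)⁻¹ * monoDelta R Ψ (ev R Ψ ((σ a)⁻¹ * (g * σ b)))) := fun k g l => by
    simp only [B, u, map_sum, map_smul, LinearMap.sum_apply, LinearMap.smul_apply,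
      LinearMap.comp_apply, ev_act, smul_eq_mul, Finset.mul_sum]
    rw [Finset.sum_comm]
    refine Finset.sum_congr rfl fun a _ => Finset.sum_congr rfl fun b _ => ?_
    ring_nf
  have hB' : ∀ k l, B k (u l) = ∑ a, (Θ k (σ a) : F) * (Θ l (σ a) : F)⁻¹ := fun k l => by
    have := hB k 1 l
    rw [act_one] at this
    rw [this]
    refine Finset.sum_congr rfl fun a _ => ?_
    rw [Finset.sum_eq_single a]
    · rw [one_mul, inv_mul_cancel, monoDelta_of_mem Ψ (one_mem R), map_one, Units.val_one, mul_one]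
    · intro b _ hb
      rw [monoDelta_of_notMem, mul_zero, mul_zero]
      rw [one_mul, ← map_inv, ← map_mul]
      exact fun h => hb (inv_mul_eq_one.1 (hσR _ h)).symm
    · simp
  refine exists_biproduct_mono (monoRep R Ψ) (fun _ => H) Θ u B hu (fun U hU => ?_)
    (fun l k g => ?_) fun k => ?_
  · have hcard : (∑ k, u k) = (Fintype.card κ : F) • ev R Ψ 1 := by
      simp only [u]
      rw [Finset.sum_comm, Finset.sum_eq_single 1]
      · simp [Nat.cast_smul_eq_nsmul]
      · intro a _ ha
        rw [← Finset.sum_smul, horth' a ha, zero_smul]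
      · simp
    have hev : ∀ g, ev R Ψ g ∈ U := fun g => by
      have h1 : (monoRep R Ψ).ρ g (∑ k, u k) ∈ U := by
        rw [map_sum]
        exact sum_mem fun k _ => hU k g
      rw [hcard, map_smul, act_ev_one] at h1
      exact (Submodule.smul_mem_iff U hκ).1 h1
    have h0 : U.mkQ = 0 := mono_hom_ext fun g => (Submodule.Quotient.mk_eq_zero U).2 (hev g)
    rw [← U.ker_mkQ, h0, LinearMap.ker_zero]
  · by_cases hg : g ∈ H
    · by_cases hkl : l = k
      · exact .inr ⟨hkl, hg⟩
      · left
        rw [LinearMap.mem_ker, hu l g hg, map_smul, hB', horth k l (Ne.symm hkl), smul_zero]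
    · left
      rw [LinearMap.mem_ker, hB]
      refine Finset.sum_eq_zero fun a _ => Finset.sum_eq_zero fun b _ => ?_
      rw [monoDelta_of_notMem, mul_zero, mul_zero]
      intro h
      apply hg
      have := mul_mem (mul_mem (hσH a) (hRH h)) (inv_mem (hσH b))
      rwa [show σ a * ((σ a)⁻¹ * (g * σ b)) * (σ b)⁻¹ = g by group] at this
  · rw [hB']
    have : ∀ a, (Θ k (σ a) : F) * (Θ k (σ a) : F)⁻¹ = 1 := fun a =>
      mul_inv_cancel₀ (Θ k (σ a)).ne_zero
    simpa [this] using hA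

end Characters

/-! ### The Mackey formula for tensor products of induced bimodules -/

section Mackey

variable {F : Type u} [Field F] {G : Type v} [Group G] [Finite G]
variable (H H' : Subgroup (G × G)) (Θ Θ' : G × G →* Fˣ)

/-- The vector `(1 ⊗ 1) ⊗ (s ⊗ 1)` of the tensor product of two induced bimodules. -/
def tev (s : G) : (tensor (monoRep H Θ) (monoRep H' Θ')).V :=
  tmk (monoRep H Θ) (monoRep H' Θ') (ev H Θ 1) (ev H' Θ' (s, 1))

lemma tmk_ev_mid (x y : G × G) (h : G) :
    tmk (monoRep H Θ) (monoRep H' Θ') (ev H Θ ((1, h) * x)) (ev H' Θ' ((h, 1) * y))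
      = tmk (monoRep H Θ) (monoRep H' Θ') (ev H Θ x) (ev H' Θ' y) := by
  rw [← ev_act, ← ev_act, tmk_mid]

lemma tev_act (s a d : G) : (tensor (monoRep H Θ) (monoRep H' Θ')).ρ (a, d) (tev H H' Θ Θ' s)
    = tmk (monoRep H Θ) (monoRep H' Θ') (ev H Θ (a, 1)) (ev H' Θ' (s, d)) := by
  rw [tev, tmk_act, ev_act, ev_act]
  simp

lemma tmk_ev (a b c d : G) :
    tmk (monoRep H Θ) (monoRep H' Θ') (ev H Θ (a, b)) (ev H' Θ' (c, d))
      = (tensor (monoRep H Θ) (monoRep H' Θ')).ρ (a, d) (tev H H' Θ Θ' (b⁻¹ * c)) := by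
  have := tmk_ev_mid H H' Θ Θ' (a, 1) (b⁻¹ * c, d) b
  rw [tev_act, ← this]
  simp

variable {H H'}

/-- Up to a scalar and translation, `tev` depends only on the double coset of `s`. -/
lemma tev_mul {x y y' z : G} (h : (x, y) ∈ H) (h' : (y', z) ∈ H') (s : G) :
    tev H H' Θ Θ' (y * s * y') = ((Θ (x, y) : F)⁻¹ * (Θ' (y', z) : F)) •
      (tensor (monoRep H Θ) (monoRep H' Θ')).ρ (x, z⁻¹) (tev H H' Θ Θ' s) := by
  have e1 : ev H Θ (1, y⁻¹) = (Θ (x, y) : F)⁻¹ • ev H Θ (x, 1) := by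
    have := ev_mul Θ ((x, 1) : G × G) (inv_mem h)
    rw [map_inv, Units.val_inv_eq_inv_val] at this
    simpa using this
  have e2 : ev H' Θ' (s * y', 1) = (Θ' (y', z) : F) • ev H' Θ' (s, z⁻¹) := by
    have := ev_mul Θ' ((s, z⁻¹) : G × G) h'
    simpa using this
  have e3 := tmk_ev_mid H H' Θ Θ' (1, y⁻¹) (s * y', 1) y
  rw [e1, e2] at e3
  rw [tev_act, tev, ← smul_smul, ← map_smul (tmk _ _ _), ← LinearMap.smul_apply, ← map_smul, ← e3]
  simp [← mul_assoc, Prod.one_eq_mk]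

/-- The composite of `H` with the conjugate of `H'` by `s` acts on `tev s` through a linear character. -/
lemma tev_act_of_mem {x y z s : G} (h : (x, y) ∈ H) (h' : (s⁻¹ * y * s, z) ∈ H') :
    (tensor (monoRep H Θ) (monoRep H' Θ')).ρ (x, z) (tev H H' Θ Θ' s)
      = ((Θ (x, y) : F) * (Θ' (s⁻¹ * y * s, z) : F)) • tev H H' Θ Θ' s := by
  have e1 : ev H Θ (x, 1) = (Θ (x, y) : F) • ev H Θ (1, y⁻¹) := by
    have := ev_mul Θ ((1, y⁻¹) : G × G) h
    simpa using this
  have e2 : ev H' Θ' (s, z) = (Θ' (s⁻¹ * y * s, z) : F) • ev H' Θ' (y⁻¹ * s, 1) := by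
    have := ev_mul Θ' ((y⁻¹ * s, 1) : G × G) h'
    simpa [mul_assoc] using this
  have e3 := tmk_ev_mid H H' Θ Θ' 1 (s, 1) y⁻¹
  rw [tev_act, e1, e2, tev, ← smul_smul, map_smul, map_smul, LinearMap.smul_apply,
    smul_comm, ← e3]
  simp

/-- The functional on the tensor product of two induced bimodules that reads off the component of
the double coset of `t`. -/
def tDelta (H H' : Subgroup (G × G)) (Θ Θ' : G × G →* Fˣ) (t : G) :
    (tensor (monoRep H Θ) (monoRep H' Θ')).V →ₗ[F] F :=
  let _ : Fintype G := Fintype.ofFinite G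
  let f : (monoRep H Θ).V →ₗ[F] (monoRep H' Θ').V →ₗ[F] F :=
    ∑ g : G, (LinearMap.mul F F).compl₁₂ (monoDelta H Θ ∘ₗ (monoRep H Θ).ρ (1, g))
      (monoDelta H' Θ' ∘ₗ (monoRep H' Θ').ρ (t⁻¹ * g, 1))
  tlift _ _ f fun h m n => by
    simp only [f, LinearMap.sum_apply, LinearMap.compl₁₂_apply, LinearMap.comp_apply, act_act]
    refine Fintype.sum_equiv (Equiv.mulRight h) _ _ fun g => ?_
    simp [mul_assoc]

lemma tDelta_tev [Fintype G] (t s b c : G) :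
    tDelta H H' Θ Θ' t ((tensor (monoRep H Θ) (monoRep H' Θ')).ρ (b, c) (tev H H' Θ Θ' s))
      = ∑ g : G, monoDelta H Θ (ev H Θ (b, g)) * monoDelta H' Θ' (ev H' Θ' (t⁻¹ * g * s, c)) := by
  rw [tev_act, tDelta, tlift_tmk]
  simp only [LinearMap.sum_apply, LinearMap.compl₁₂_apply, LinearMap.comp_apply, ev_act,
    LinearMap.mul_apply_apply]
  refine Finset.sum_congr (by congr!) fun g _ => ?_
  simp

variable (H H')

/-- The tensor product of `Ind_H (F_Θ)` and `Ind_H' (F_Θ')` over `FG` is the direct sum, over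
representatives `t` of the double cosets of the second projection of `H` and the first projection
of `H'`, of modules induced from linear characters of the composites `H * ᵗH'`; a double coset
contributes nothing if `tev` vanishes on it. -/
theorem exists_biproduct_tensor {ι : Type*} [Fintype ι] (t : ι → G)
    (K : ι → Subgroup (G × G)) (Ψ : ι → G × G →* Fˣ)
    (hmem : ∀ i x z, (x, z) ∈ K i ↔ ∃ y, (x, y) ∈ H ∧ ((t i)⁻¹ * y * t i, z) ∈ H')
    (hchar : ∀ i x y z, (x, y) ∈ H → ((t i)⁻¹ * y * t i, z) ∈ H' →
      Ψ i (x, z) = Θ (x, y) * Θ' ((t i)⁻¹ * y * t i, z))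
    (hcov : ∀ s, tev H H' Θ Θ' s = 0 ∨
      ∃ i x y y' z, (x, y) ∈ H ∧ (y', z) ∈ H' ∧ s = y * t i * y')
    (hinj : ∀ i j x y y' z, (x, y) ∈ H → (y', z) ∈ H' → t i = y * t j * y' → i = j)
    (hcard : ∀ i, (Nat.card {y : G // (1, y) ∈ H ∧ ((t i)⁻¹ * y * t i, 1) ∈ H'} : F) ≠ 0) :
    Nonempty (Biproduct (tensor (monoRep H Θ) (monoRep H' Θ')) fun i => monoRep (K i) (Ψ i)) := by
  classical
  let _ : Fintype G := Fintype.ofFinite G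
  refine exists_biproduct_mono _ K Ψ (fun i => tev H H' Θ Θ' (t i)) (fun i => tDelta H H' Θ Θ' (t i))
    ?_ (fun U hU => ?_) ?_ ?_
  · rintro i ⟨x, z⟩ h
    obtain ⟨y, hy, hy'⟩ := (hmem i x z).1 h
    rw [tev_act_of_mem Θ Θ' hy hy', hchar i x y z hy hy', Units.val_mul]
  · have h1 : ∀ s g, (tensor (monoRep H Θ) (monoRep H' Θ')).ρ g (tev H H' Θ Θ' s) ∈ U := by
      intro s g
      rcases hcov s with h0 | ⟨i, x, y, y', z, hx, hz, rfl⟩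
      · rw [h0, map_zero]
        exact zero_mem _
      · rw [tev_mul Θ Θ' hx hz, map_smul, act_act]
        exact U.smul_mem _ (hU i _)
    have h0 : U.mkQ = 0 := tensor_hom_ext fun m n => by
      have h2 : (U.mkQ ∘ₗ (tmk (monoRep H Θ) (monoRep H' Θ')).flip n) = 0 :=
        mono_hom_ext fun x => by
          have h3 : U.mkQ ∘ₗ tmk (monoRep H Θ) (monoRep H' Θ') (ev H Θ x) = 0 :=
            mono_hom_ext fun y => by
              rw [LinearMap.comp_apply, show x = (x.1, x.2) from rfl, show y = (y.1, y.2) from rfl,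
                tmk_ev]
              exact (Submodule.Quotient.mk_eq_zero U).2 (h1 _ _)
          exact LinearMap.congr_fun h3 n
      exact LinearMap.congr_fun h2 m
    rw [← U.ker_mkQ, h0, LinearMap.ker_zero]
  · rintro i j ⟨b, c⟩
    by_cases hne : ∃ g : G, (b, g) ∈ H ∧ ((t j)⁻¹ * g * t i, c) ∈ H'
    · right
      obtain ⟨g, hg, hg'⟩ := hne
      have hij : i = j := hinj i j b⁻¹ g⁻¹ ((t j)⁻¹ * g * t i) c (inv_mem hg) hg' (by group)
      subst hij
      exact ⟨rfl, (hmem i b c).2 ⟨g, hg, hg'⟩⟩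
    · left
      rw [LinearMap.mem_ker, tDelta_tev]
      refine Finset.sum_eq_zero fun g _ => ?_
      by_cases hg : (b, g) ∈ H
      · rw [monoDelta_of_notMem (H := H') Θ' fun h => hne ⟨g, hg, h⟩, mul_zero]
      · rw [monoDelta_of_notMem Θ hg, zero_mul]
  · intro i
    have h1 := tDelta_tev (H := H) (H' := H') Θ Θ' (t i) (t i) 1 1
    rw [act_one'] at h1
    rw [h1]
    have h2 : ∀ g : G, monoDelta H Θ (ev H Θ (1, g)) *
        monoDelta H' Θ' (ev H' Θ' ((t i)⁻¹ * g * t i, 1))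
        = if (1, g) ∈ H ∧ ((t i)⁻¹ * g * t i, 1) ∈ H' then 1 else 0 := fun g => by
      split_ifs with h
      · rw [monoDelta_of_mem Θ h.1, monoDelta_of_mem Θ' h.2, ← Units.val_mul,
          ← hchar i 1 g 1 h.1 h.2, ← Prod.one_eq_mk, map_one, Units.val_one]
      · by_cases hg : (1, g) ∈ H
        · rw [monoDelta_of_notMem (H := H') Θ' fun h' => h ⟨hg, h'⟩, mul_zero]
        · rw [monoDelta_of_notMem Θ hg, zero_mul]
    simp only [h2]
    rw [Finset.sum_boole, ← Fintype.card_subtype, ← Nat.card_eq_fintype_card]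
    exact hcard i

end Mackey

/-! ### Automorphisms of order prime to `p` of a cyclic `p`-group -/

section CyclicPGroup

variable {D : Type v} [CommGroup D] [IsCyclic D] [Finite D]

/-- `D` is a nontrivial cyclic group of order `p ^ n`, and `E` is a group of automorphisms of `D`
of order prime to `p`. -/
structure CoprimeAction (p n : ℕ) (E : Subgroup (MulAut D)) : Prop where
  pos : 1 ≤ n
  card : Nat.card D = p ^ n
  coprime : (Nat.card E).Coprime p

variable {p n : ℕ} [hp : Fact p.Prime] {E : Subgroup (MulAut D)}

omit hp in
lemma int_pow_eq_one_mod {r : ℤ} (h : (p : ℤ) ∣ r - 1) (n : ℕ) : (p ^ n : ℤ) ∣ r ^ p ^ n - 1 := by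
  have := dvd_sub_pow_of_dvd_sub h n
  rw [one_pow] at this
  exact (pow_dvd_pow _ n.le_succ).trans this

lemma subgroup_eq_of_card_eq {A B : Subgroup D} (h : Nat.card A = Nat.card B) : A = B := by
  have hA := IsCyclic.card_powMonoidHom_ker (G := D) (Nat.card A)
  rw [Nat.gcd_eq_right (Subgroup.card_subgroup_dvd_card A)] at hA
  have key : ∀ C : Subgroup D, Nat.card C = Nat.card A → C = (powMonoidHom (Nat.card A)).ker := by
    intro C hC
    refine Subgroup.eq_of_le_of_card_ge (fun x hx => ?_) (hA.trans hC.symm).le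
    rw [MonoidHom.mem_ker, powMonoidHom_apply, ← hC]
    exact congrArg Subtype.val (pow_card_eq_one' (x := (⟨x, hx⟩ : C)))
  rw [key A rfl, key B h.symm]

namespace CoprimeAction

variable (h : CoprimeAction p n E)

include h

omit hp in
lemma card_level {i : ℕ} (hi : i ≤ n) : Nat.card (level D p i) = p ^ i := by
  have := IsCyclic.card_powMonoidHom_ker (G := D) (p ^ i)
  rw [h.card, Nat.gcd_eq_right (pow_dvd_pow p hi)] at this
  exact this

omit hp [IsCyclic D] [Finite D] in
lemma mem_level_top (x : D) : x ∈ level D p n := by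
  rw [mem_level, ← h.card]
  exact pow_card_eq_one'

lemma le_of_level_le {i j : ℕ} (hi : i ≤ n) (hj : j ≤ n) (hij : level D p i ≤ level D p j) :
    i ≤ j := by
  have := Subgroup.card_le_of_le hij
  rw [h.card_level hi, h.card_level hj] at this
  exact (Nat.pow_le_pow_iff_right hp.out.one_lt).1 this

lemma eq_level (A : Subgroup D) : ∃ i ≤ n, A = level D p i := by
  have hA := Subgroup.card_subgroup_dvd_card A
  rw [h.card, Nat.dvd_prime_pow hp.out] at hA
  obtain ⟨i, hi, hA⟩ := hA
  exact ⟨i, hi, subgroup_eq_of_card_eq (hA.trans (h.card_level hi).symm)⟩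

omit hp [IsCyclic D] [Finite D] in
lemma eq_one_of_pow {ρ : MulAut D} (hρ : ρ ∈ E) {k : ℕ} (hk : ρ ^ p ^ k = 1) : ρ = 1 := by
  have h1 : (⟨ρ, hρ⟩ : E) ^ p ^ k = 1 := Subtype.ext hk
  have h2 : orderOf (⟨ρ, hρ⟩ : E) = 1 := Nat.eq_one_of_dvd_coprimes (h.coprime.pow_right k)
    (orderOf_dvd_natCard _) (orderOf_dvd_of_pow_eq_one h1)
  exact congrArg Subtype.val (orderOf_eq_one_iff.1 h2)

omit [Finite D] in
/-- A nontrivial element of `E` is a power map whose exponent is not `1` modulo `p`. -/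
lemma exists_zpow {ρ : MulAut D} (hρ : ρ ∈ E) (hne : ρ ≠ 1) :
    ∃ r : ℤ, (∀ x, ρ x = x ^ r) ∧ ¬ (p : ℤ) ∣ r - 1 := by
  obtain ⟨r, hr⟩ := MonoidHom.map_cyclic ρ.toMonoidHom
  have hr' : ∀ x, ρ x = x ^ r := hr
  refine ⟨r, hr', fun hdvd => hne (h.eq_one_of_pow hρ (k := n) (MulEquiv.ext fun x => ?_))⟩
  have hpow : ∀ k : ℕ, (ρ ^ k) x = x ^ (r ^ k) := fun k => by
    induction k with
    | zero => simp
    | succ k ih => rw [pow_succ', MulAut.mul_apply, ih, map_zpow, hr', ← zpow_mul, pow_succ']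
  obtain ⟨c, hc⟩ := int_pow_eq_one_mod hdvd n
  rw [hpow, MulAut.one_apply, eq_add_of_sub_eq hc, zpow_add, zpow_one, zpow_mul]
  have : x ^ (p ^ n : ℤ) = 1 := by
    rw [← Nat.cast_pow, zpow_natCast, ← h.card]
    exact pow_card_eq_one'
  rw [this, one_zpow, one_mul]

omit [Finite D] in
/-- `E` acts freely on the nontrivial elements of `D / D_l`. -/
lemma eq_one_of_fix {ρ : MulAut D} (hρ : ρ ∈ E) {l : ℕ} {x : D} (hx : x ∉ level D p l)
    (hfix : x⁻¹ * ρ x ∈ level D p l) : ρ = 1 := by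
  by_contra hne
  obtain ⟨r, hr, hdvd⟩ := h.exists_zpow hρ hne
  apply hx
  rw [hr, mem_level, ← zpow_neg_one, ← zpow_add, add_comm, ← sub_eq_add_neg, ← zpow_natCast,
    ← zpow_mul] at hfix
  have h1 : IsCoprime (r - 1) ((p : ℤ) ^ n) :=
    ((Nat.prime_iff_prime_int.1 hp.out).irreducible.coprime_iff_not_dvd.2 hdvd).symm.pow_right
  obtain ⟨a, b, hab⟩ := h1
  have h2 : x ^ ((p : ℤ) ^ n) = 1 := by
    rw [← Nat.cast_pow, zpow_natCast, ← h.card]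
    exact pow_card_eq_one'
  rw [mem_level, ← zpow_natCast, ← mul_one ((p ^ l : ℕ) : ℤ), ← hab, mul_add, zpow_add,
    show ((p ^ l : ℕ) : ℤ) * (a * (r - 1)) = ((r - 1) * (p ^ l : ℕ)) * a by ring, zpow_mul, hfix,
    show ((p ^ l : ℕ) : ℤ) * (b * (p : ℤ) ^ n) = (p : ℤ) ^ n * ((p ^ l : ℕ) * b) by ring, zpow_mul,
    h2, one_zpow, one_zpow, one_mul]

/-- `E` acts faithfully on `D_i` for `i ≥ 1`. -/
lemma eq_one_of_resTop {ρ : MulAut D} (hρ : ρ ∈ E) {i : ℕ} (hi : 1 ≤ i)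
    (hres : resTop p i ρ = 1) : ρ = 1 := by
  have hdvd : p ∣ Nat.card D := by
    rw [h.card]
    exact dvd_pow_self p (Nat.one_le_iff_ne_zero.1 h.pos)
  obtain ⟨x, hx⟩ := exists_prime_orderOf_dvd_card' p hdvd
  have hxi : x ∈ level D p i := by
    rw [mem_level, ← orderOf_dvd_iff_pow_eq_one, hx]
    exact dvd_pow_self p (Nat.one_le_iff_ne_zero.1 hi)
  refine h.eq_one_of_fix hρ (l := 0) (x := x) ?_ ?_
  · rw [mem_level, pow_zero, pow_one]
    rintro rfl
    rw [orderOf_one] at hx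
    exact hp.out.one_lt.ne hx
  · have : ρ x = x := congrArg (fun a : MulAut (level D p i) => (a ⟨x, hxi⟩ : D)) hres
    rw [this, inv_mul_cancel]
    exact one_mem _

/-- The `E`-orbits of nontrivial cosets of `D_l` in `D`. -/
@[reducible] def orbitSetoid (_ : CoprimeAction p n E) (l : ℕ) : Setoid {x : D // x ∉ level D p l} where
  r x y := ∃ ρ ∈ E, (ρ (x : D))⁻¹ * y ∈ level D p l
  iseqv :=
    { refl := fun x => ⟨1, one_mem _, by simp [one_mem]⟩
      symm := by
        rintro x y ⟨ρ, hρ, hxy⟩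
        refine ⟨ρ⁻¹, inv_mem hρ, ?_⟩
        have := aut_mem (resTop p l ρ⁻¹) (inv_mem hxy) (inv_mem hxy)
        have h2 : (resTop p l ρ⁻¹ ⟨_, inv_mem hxy⟩ : D) = ρ⁻¹ ((ρ (x : D))⁻¹ * y)⁻¹ := rfl
        rw [h2] at this
        simpa using this
      trans := by
        rintro x y z ⟨ρ, hρ, hxy⟩ ⟨σ, hσ, hyz⟩
        refine ⟨σ * ρ, mul_mem hσ hρ, ?_⟩
        have := aut_mem (resTop p l σ) hxy hxy
        have h2 : (resTop p l σ ⟨_, hxy⟩ : D) = σ ((ρ (x : D))⁻¹ * y) := rfl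
        rw [h2] at this
        have h3 := mul_mem this hyz
        simpa [mul_assoc] using h3 }

/-- The set of `E`-orbits of nontrivial cosets of `D_l` in `D`. -/
def Orbits (h : CoprimeAction p n E) (l : ℕ) : Type v := Quotient (h.orbitSetoid l)

omit hp [IsCyclic D] in
instance (l : ℕ) : Finite (h.Orbits l) :=
  Quotient.finite (h.orbitSetoid l)

instance (l : ℕ) : Fintype (h.Orbits l) := Fintype.ofFinite _

/-- A representative of an orbit. -/
def rep {l : ℕ} (o : h.Orbits l) : D := (Quotient.out (s := h.orbitSetoid l) o).1

omit hp [IsCyclic D] [Finite D] in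
lemma rep_notMem {l : ℕ} (o : h.Orbits l) : h.rep o ∉ level D p l :=
  (Quotient.out (s := h.orbitSetoid l) o).2

omit hp [IsCyclic D] [Finite D] in
lemma exists_rep {l : ℕ} {d : D} (hd : d ∉ level D p l) :
    ∃ (o : h.Orbits l) (ρ : E), ∃ e ∈ level D p l, d = (ρ : MulAut D) (h.rep o) * e := by
  obtain ⟨ρ, hρ, he⟩ := Quotient.mk_out (s := h.orbitSetoid l) ⟨d, hd⟩
  exact ⟨Quotient.mk (h.orbitSetoid l) ⟨d, hd⟩, ⟨ρ, hρ⟩, _, he, (mul_inv_cancel_left _ _).symm⟩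

omit hp [IsCyclic D] [Finite D] in
lemma rep_inj {l : ℕ} {o o' : h.Orbits l} {ρ : E} {e : D} (he : e ∈ level D p l)
    (heq : h.rep o = (ρ : MulAut D) (h.rep o') * e) : o = o' := by
  have : (h.orbitSetoid l).r (Quotient.out (s := h.orbitSetoid l) o')
      (Quotient.out (s := h.orbitSetoid l) o) :=
    ⟨ρ, ρ.2, by
      change ((ρ : MulAut D) (h.rep o'))⁻¹ * h.rep o ∈ _
      rwa [heq, inv_mul_cancel_left]⟩
  have := Quotient.sound (s := h.orbitSetoid l) this
  exact ((Quotient.out_eq (s := h.orbitSetoid l) o').symm.trans (this.trans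
    (Quotient.out_eq (s := h.orbitSetoid l) o))).symm

omit [Finite D] in
lemma bijective_orbits (l : ℕ) : Function.Bijective
    (fun x : h.Orbits l × E × level D p l => (⟨(x.2.1 : MulAut D) (h.rep x.1) * x.2.2, fun hx => by
      have h1 := (Subgroup.mul_mem_cancel_right _ x.2.2.2).1 hx
      have h2 : (resTop p l (x.2.1⁻¹ : E) ⟨_, h1⟩ : D) = h.rep x.1 :=
        (x.2.1 : MulAut D).symm_apply_apply _
      exact h.rep_notMem x.1 (h2 ▸ Subtype.prop _)⟩ : {x : D // x ∉ level D p l})) := by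
  constructor
  · rintro ⟨o, ρ, e⟩ ⟨o', ρ', e'⟩ heq
    have h0 : (ρ : MulAut D) (h.rep o) * e = (ρ' : MulAut D) (h.rep o') * e' :=
      congrArg Subtype.val heq
    have h1 := congrArg (ρ⁻¹ : E).1 h0
    rw [map_mul, map_mul] at h1
    have h2 : (ρ⁻¹ : E).1 ((ρ : MulAut D) (h.rep o)) = h.rep o :=
      (ρ : MulAut D).symm_apply_apply _
    have h3 : ∀ x : level D p l, (ρ⁻¹ : E).1 (x : D) ∈ level D p l := fun x =>
      (resTop p l (ρ⁻¹ : E).1 x).2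
    rw [h2, ← eq_mul_inv_iff_mul_eq, mul_assoc] at h1
    obtain rfl := h.rep_inj (ρ := ρ⁻¹ * ρ') (mul_mem (h3 e') (inv_mem (h3 e))) h1
    have h4 := h.eq_one_of_fix (ρ⁻¹ * ρ').2 (h.rep_notMem o) (by
      rw [← inv_mem_iff, mul_inv_rev, inv_inv]
      have : (((ρ⁻¹ * ρ' : E) : MulAut D) (h.rep o))⁻¹ * h.rep o
          = (ρ⁻¹ : E).1 e' * ((ρ⁻¹ : E).1 e)⁻¹ := by
        nth_rewrite 2 [h1]
        exact inv_mul_cancel_left _ _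
      rw [this]
      exact mul_mem (h3 e') (inv_mem (h3 e)))
    obtain rfl : ρ = ρ' := inv_mul_eq_one.1 (Subtype.ext h4)
    rw [Subtype.ext (mul_left_cancel h0) (a1 := e)]
  · rintro ⟨d, hd⟩
    obtain ⟨o, ρ, e, he, rfl⟩ := h.exists_rep hd
    exact ⟨(o, ρ, ⟨e, he⟩), rfl⟩

omit hp in
/-- The free action of `E` on the nontrivial elements of `D / D_l` has `(p^(n-l) - 1) / |E|`
orbits. -/
lemma card_orbits_mul [Fact p.Prime] {l : ℕ} (hl : l ≤ n) :
    Nat.card (h.Orbits l) * Nat.card E = p ^ (n - l) - 1 := by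
  classical
  have h1 := Nat.card_congr (Equiv.ofBijective _ (h.bijective_orbits l))
  have h2 : Nat.card {x : D // x ∉ level D p l} + Nat.card (level D p l) = p ^ n := by
    rw [← h.card, add_comm, ← Nat.card_sum]
    exact Nat.card_congr (Equiv.sumCompl (· ∈ level D p l))
  rw [← h1, Nat.card_prod, Nat.card_prod, h.card_level hl] at h2
  have h3 : p ^ n = p ^ (n - l) * p ^ l := by rw [← pow_add, Nat.sub_add_cancel hl]
  rw [h3, ← mul_assoc, ← Nat.succ_mul] at h2
  have := Nat.eq_of_mul_eq_mul_right (pow_pos (Fact.out : p.Prime).pos l) h2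
  rw [← this, Nat.succ_sub_one]

lemma card_orbits {l : ℕ} (hl : l ≤ n) :
    Fintype.card (h.Orbits l) = (p ^ (n - l) - 1) / Nat.card E := by
  rw [← h.card_orbits_mul hl, Nat.mul_div_cancel _ Nat.card_pos, Nat.card_eq_fintype_card]

lemma dvd (i : ℕ) : Nat.card E ∣ p ^ (n - i) - 1 := by
  rcases le_total i n with hi | hi
  · exact Dvd.intro_left _ (h.card_orbits_mul hi)
  · rw [Nat.sub_eq_zero_of_le hi, pow_zero]
    exact dvd_zero _

end CoprimeAction

/-! #### Linear characters of `E` -/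

namespace CoprimeAction

variable {F : Type u} [Field F] [CharP F p] (h : CoprimeAction p n E)

include h

/-- The faithful character of `E` given by the action of `E` on `D / D^p`. -/
lemma exists_injective_char : ∃ ω : E →* Fˣ, Function.Injective ω := by
  have hdvd : p ∣ Nat.card D := by
    rw [h.card]
    exact dvd_pow_self p (Nat.one_le_iff_ne_zero.1 h.pos)
  refine ⟨(Units.map (ZMod.castHom hdvd F).toMonoidHom).comp
    ((IsCyclic.mulAutMulEquiv D).toMonoidHom.comp E.subtype),
    (injective_iff_map_eq_one _).2 fun ρ hρ => ?_⟩
  have h1 : ZMod.castHom hdvd F (IsCyclic.mulAutMulEquiv D ρ : (ZMod (Nat.card D))ˣ) = 1 :=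
    congrArg Units.val hρ
  obtain ⟨r, hr⟩ := ZMod.intCast_surjective
    ((IsCyclic.mulAutMulEquiv D ρ : (ZMod (Nat.card D))ˣ) : ZMod (Nat.card D))
  rw [← hr, map_intCast] at h1
  have h2 : (p : ℤ) ∣ r - 1 := by
    rw [← CharP.intCast_eq_zero_iff F p, Int.cast_sub, h1, Int.cast_one, sub_self]
  have h3 : ((r ^ p ^ n - 1 : ℤ) : ZMod (Nat.card D)) = 0 := by
    rw [ZMod.intCast_zmod_eq_zero_iff_dvd, h.card, Nat.cast_pow]
    exact int_pow_eq_one_mod h2 n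
  have h4 : (IsCyclic.mulAutMulEquiv D ρ) ^ p ^ n = 1 := Units.ext (by
    rw [Units.val_pow_eq_pow_val, ← hr, Units.val_one, ← sub_eq_zero]
    exact_mod_cast h3)
  rw [← map_pow] at h4
  exact Subtype.ext (h.eq_one_of_pow ρ.2 ((map_eq_one_iff _ (MulEquiv.injective _)).1 h4))

omit [CharP F p] in
lemma mul_comm_E (ρ σ : E) : ρ * σ = σ * ρ := Subtype.ext (mulAut_comm _ _)

lemma card_char : Nat.card (E →* Fˣ) = Nat.card E := by
  obtain ⟨ω, hω⟩ := h.exists_injective_char (F := F)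
  have : IsCyclic E := isCyclic_of_injective_ringHom ((Units.coeHom F).comp ω)
    (Units.val_injective.comp hω)
  let _ : CommGroup E := { mul_comm := fun ρ σ => h.mul_comm_E ρ σ }
  obtain ⟨e⟩ := IsCyclic.monoidHom_mulEquiv_rootsOfUnity E Fˣ
  obtain ⟨g, hg⟩ := isCyclic_iff_exists_orderOf_eq_natCard.1 this
  have h1 : IsPrimitiveRoot (ω g) (Nat.card E) := by
    rw [← hg, ← orderOf_injective ω hω g]
    exact IsPrimitiveRoot.orderOf _
  have : NeZero (Nat.card E) := ⟨Nat.card_pos.ne'⟩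
  rw [Nat.card_congr e.toEquiv, Nat.card_congr (rootsOfUnityUnitsMulEquiv F _).toEquiv]
  exact h1.card_rootsOfUnity'

lemma card_E_ne_zero [Fintype E] : (Fintype.card E : F) ≠ 0 := by
  rw [Ne, CharP.cast_eq_zero_iff F p, ← Nat.card_eq_fintype_card]
  exact fun hd => hp.out.one_lt.ne' (Nat.eq_one_of_dvd_coprimes h.coprime hd dvd_rfl)

lemma card_char_ne_zero : (Fintype.card (E →* Fˣ) : F) ≠ 0 := by
  rw [← Nat.card_eq_fintype_card, h.card_char, Ne, CharP.cast_eq_zero_iff F p]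
  exact fun hd => hp.out.one_lt.ne' (Nat.eq_one_of_dvd_coprimes h.coprime hd dvd_rfl)

omit h hp [CharP F p] [IsCyclic D] in
lemma sum_char_eq_zero [Fintype E] {lam mu : E →* Fˣ} (hne : lam ≠ mu) :
    ∑ ρ, (lam ρ : F) * (mu ρ : F)⁻¹ = 0 := by
  have := sum_hom_units_eq_zero ((Units.coeHom F).comp (lam * mu⁻¹)) fun h => hne (by
    refine mul_inv_eq_one.1 (MonoidHom.ext fun ρ => Units.ext ?_)
    exact DFunLike.congr_fun h ρ)
  rw [← this]
  refine Finset.sum_congr rfl fun ρ _ => ?_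
  simp

lemma sum_char_apply_eq_zero {ρ : E} (hρ : ρ ≠ 1) : ∑ lam : E →* Fˣ, (lam ρ : F)⁻¹ = 0 := by
  obtain ⟨ω, hω⟩ := h.exists_injective_char (F := F)
  have h1 : (ω ρ : F) ≠ 1 := fun h1 => hρ ((map_eq_one_iff ω hω).1 (Units.ext h1))
  have h2 : ∑ lam : E →* Fˣ, (lam ρ : F)⁻¹ = ω ρ * ∑ lam : E →* Fˣ, (lam ρ : F)⁻¹ := by
    rw [Finset.mul_sum]
    refine Fintype.sum_equiv (Equiv.mulLeft ω) _ _ fun lam => ?_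
    rw [Equiv.coe_mulLeft, MonoidHom.mul_apply, Units.val_mul, mul_inv,
      mul_inv_cancel_left₀ (ω ρ).ne_zero]
  by_contra h3
  exact h1 (mul_right_cancel₀ h3 (h2.symm.trans (one_mul _).symm))

end CoprimeAction

end CyclicPGroup

/-! ### Twisted diagonal subgroups of `G × G` -/

section Conjugation

variable {F : Type u} [Field F] {Γ : Type v} [Group Γ] [Finite Γ]

lemma mono_eq_top {H : Subgroup Γ} {Θ : Γ →* Fˣ} {U : Submodule F (monoRep H Θ).V}
    (hU : ∀ g, ev H Θ g ∈ U) : U = ⊤ := by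
  have h0 : U.mkQ = 0 := mono_hom_ext fun g => (Submodule.Quotient.mk_eq_zero U).2 (hU g)
  rw [← U.ker_mkQ, h0, LinearMap.ker_zero]

/-- Modules induced from conjugate subgroups are isomorphic. -/
lemma mono_conj (H H' : Subgroup Γ) (Θ : Γ →* Fˣ) (g : Γ) (h : ∀ x, x ∈ H ↔ g⁻¹ * x * g ∈ H') :
    (monoRep H Θ).Iso (monoRep H' Θ) := by
  refine (iso_mono (monoRep H' Θ) H Θ (ev H' Θ g) (monoDelta H' Θ ∘ₗ (monoRep H' Θ).ρ g⁻¹)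
    (fun x hx => ?_) (fun U hU => mono_eq_top fun x => ?_) (fun x hx => ?_) ?_).symm
  · rw [ev_act, show x * g = g * (g⁻¹ * x * g) by group, ev_mul Θ g ((h x).1 hx), map_mul, map_mul,
      map_inv, mul_comm (Θ g)⁻¹, inv_mul_cancel_right]
  · have := hU (x * g⁻¹)
    rwa [ev_act, inv_mul_cancel_right] at this
  · rw [LinearMap.comp_apply, ev_act, ev_act, ← mul_assoc,
      monoDelta_of_notMem Θ fun h' => hx ((h x).2 h')]
  · rw [LinearMap.comp_apply, ev_act, inv_mul_cancel, monoDelta_of_mem Θ (one_mem _), map_one]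
    exact one_ne_zero

lemma mono_congr_char {H : Subgroup Γ} {Θ Θ' : Γ →* Fˣ} (h : ∀ x ∈ H, Θ x = Θ' x) :
    (monoRep H Θ).Iso (monoRep H Θ') :=
  iso_mono _ _ _ (ev _ _ 1) (monoDelta _ _)
    (fun x hx => by rw [act_ev_of_mem _ hx, h x hx])
    (fun U hU => mono_eq_top fun x => by
      have := hU x
      rwa [act_ev_one] at this)
    (fun x hx => by rw [act_ev_one, monoDelta_of_notMem _ hx])
    (by
      rw [monoDelta_of_mem _ (one_mem _), map_one]
      exact one_ne_zero)

end Conjugation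

section Twisted

variable {D : Type v} [CommGroup D] [IsCyclic D] {E : Subgroup (MulAut D)}

/-- The projection of `G × G` onto `E × E`. -/
def rightPr (E : Subgroup (MulAut D)) : SD E × SD E →* E × E :=
  SemidirectProduct.rightHom.prodMap SemidirectProduct.rightHom

omit [IsCyclic D] in
lemma rightPr_apply (g : SD E × SD E) : rightPr E g = (g.1.right, g.2.right) := rfl

/-- The embedding of `E × E` into `G × G`. -/
def inrPair (E : Subgroup (MulAut D)) : E × E →* SD E × SD E :=
  SemidirectProduct.inr.prodMap SemidirectProduct.inr

omit [IsCyclic D] in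
lemma inrPair_apply (l : E × E) : inrPair E l = (⟨1, l.1⟩, ⟨1, l.2⟩) := rfl

omit [IsCyclic D] in
lemma rightPr_inrPair (l : E × E) : rightPr E (inrPair E l) = l := rfl

/-- The pairs of elements of `E` that agree on `D_i`: all pairs if `i = 0`, and the diagonal
if `i ≥ 1` and `E` has order prime to `p`. -/
def stab (E : Subgroup (MulAut D)) (p i : ℕ) : Subgroup (E × E) :=
  ((resTop p i).comp (E.subtype.comp (MonoidHom.fst E E))).eqLocus
    ((resTop p i).comp (E.subtype.comp (MonoidHom.snd E E)))

variable {p i : ℕ}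

omit [IsCyclic D] in
lemma mem_stab {l : E × E} : l ∈ stab E p i ↔ resTop p i l.1.1 = resTop p i l.2.1 := Iff.rfl

/-- The subgroup of all `(α(x)ρ, xσ)` with `x ∈ D_i` and `ρ, σ ∈ E` such that `ρ` and `σ` agree
on `D_i`. -/
def full (E : Subgroup (MulAut D)) (α : MulAut (level D p i)) : Subgroup (SD E × SD E) where
  carrier := {g | (∃ x : level D p i, g.1.left = α x ∧ g.2.left = x) ∧ rightPr E g ∈ stab E p i}
  one_mem' := ⟨⟨1, by simp⟩, one_mem _⟩
  mul_mem' := by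
    rintro g k ⟨⟨x, hx1, hx2⟩, hg⟩ ⟨⟨y, hy1, hy2⟩, hk⟩
    refine ⟨⟨x * resTop p i g.2.right.1 y, ?_, ?_⟩, ?_⟩
    · have := aut_comm α g.1.right.1 y
      rw [map_mul, Subgroup.coe_mul, ← show resTop p i g.1.right.1 = resTop p i g.2.right.1 from hg,
        this, Prod.fst_mul, SemidirectProduct.mul_left, hx1, hy1]
      rfl
    · rw [Prod.snd_mul, SemidirectProduct.mul_left, hx2, hy2]
      rfl
    · rw [map_mul]
      exact mul_mem hg hk
  inv_mem' := by
    rintro g ⟨⟨x, hx1, hx2⟩, hg⟩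
    have hg' := inv_mem hg
    rw [← map_inv] at hg'
    refine ⟨⟨resTop p i g⁻¹.2.right.1 x⁻¹, ?_, ?_⟩, hg'⟩
    · have := aut_comm α g⁻¹.1.right.1 x⁻¹
      rw [← show resTop p i g⁻¹.1.right.1 = resTop p i g⁻¹.2.right.1 from hg', this, Prod.fst_inv,
        SemidirectProduct.inv_left, hx1, map_inv α x]
      rfl
    · rw [Prod.snd_inv, SemidirectProduct.inv_left, hx2]
      rfl

/-- The subgroup of all `(α(x)ρ, xσ)` with `x ∈ D_i` and `(ρ, σ) ∈ L`, for a group `L` of pairs of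
elements of `E` that agree on `D_i`. -/
def tw (α : MulAut (level D p i)) (L : Subgroup (E × E)) : Subgroup (SD E × SD E) :=
  full E α ⊓ L.comap (rightPr E)

lemma mem_tw {α : MulAut (level D p i)} {L : Subgroup (E × E)} (hL : L ≤ stab E p i)
    {g : SD E × SD E} : g ∈ tw α L ↔
      (∃ x : level D p i, g.1.left = α x ∧ g.2.left = x) ∧ (g.1.right, g.2.right) ∈ L :=
  ⟨fun h => ⟨h.1.1, h.2⟩, fun h => ⟨⟨h.1, hL h.2⟩, h.2⟩⟩

lemma inrPair_mem_tw {α : MulAut (level D p i)} {L : Subgroup (E × E)} (hL : L ≤ stab E p i)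
    {l : E × E} (hl : l ∈ L) : inrPair E l ∈ tw α L :=
  (mem_tw hL).2 ⟨⟨1, by rw [map_one]; rfl, rfl⟩, hl⟩

lemma mem_tw_bot {α : MulAut (level D p i)} {g : SD E × SD E} : g ∈ tw α ⊥ ↔
    ∃ x : level D p i, g = (SemidirectProduct.inl (α x : D), SemidirectProduct.inl (x : D)) := by
  rw [mem_tw bot_le, Subgroup.mem_bot]
  constructor
  · rintro ⟨⟨x, h1, h2⟩, h3⟩
    exact ⟨x, Prod.ext (SemidirectProduct.ext h1 (congrArg Prod.fst h3))
      (SemidirectProduct.ext h2 (congrArg Prod.snd h3))⟩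
  · rintro ⟨x, rfl⟩
    exact ⟨⟨x, rfl, rfl⟩, rfl⟩

lemma tw_bot (α : MulAut (level D p i)) : tw α ⊥ = diag E α :=
  Subgroup.ext fun _ => mem_tw_bot

omit [IsCyclic D] in
lemma conj_inl (g : SD E) (c : D) : g⁻¹ * SemidirectProduct.inl c * g
    = SemidirectProduct.inl ((g.right⁻¹ : E).1 c) := by
  refine SemidirectProduct.ext ?_ ?_
  · simp only [SemidirectProduct.mul_left, SemidirectProduct.inv_left, SemidirectProduct.mul_right,
      SemidirectProduct.left_inl, SemidirectProduct.right_inl, SemidirectProduct.inv_right, mul_one,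
      map_inv, Subgroup.subtype_apply, InvMemClass.coe_inv]
    rw [mul_comm, mul_inv_cancel_left]
  · simp

lemma card_tw_bot (α : MulAut (level D p i)) : Nat.card (tw (E := E) α ⊥) = Nat.card (level D p i) := by
  refine (Nat.card_congr (Equiv.ofBijective (fun x : level D p i =>
    (⟨(SemidirectProduct.inl (α x : D), SemidirectProduct.inl (x : D)), mem_tw_bot.2 ⟨x, rfl⟩⟩ :
      tw (E := E) α ⊥)) ⟨fun x y hxy => ?_, ?_⟩)).symm
  · exact Subtype.ext (SemidirectProduct.inl_injective
      (congrArg (fun z => z.1.2) hxy))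
  · rintro ⟨g, hg⟩
    obtain ⟨x, rfl⟩ := mem_tw_bot.1 hg
    exact ⟨x, rfl⟩

variable [Finite D]

/-- The module induced from the linear character `(α(x)ρ, xσ) ↦ θ(ρ, σ)` of `tw α L`. -/
def twRep {F : Type u} [Field F] (α : MulAut (level D p i)) (L : Subgroup (E × E))
    (θ : E × E →* Fˣ) : FinRep F (SD E × SD E) :=
  monoRep (tw α L) (θ.comp (rightPr E))

/-- The modules `M_{i,α,λ}` (if `i ≥ 1`) and `P_{λ,μ}` (if `i = 0`), in a uniform way: induced from
linear characters of `full E α`. -/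
def src {F : Type u} [Field F] (α : MulAut (level D p i)) (θ : E × E →* Fˣ) :
    FinRep F (SD E × SD E) :=
  twRep α (stab E p i) θ

namespace CoprimeAction

variable {n : ℕ} [hp : Fact p.Prime] (h : CoprimeAction p n E)

include h

lemma isPGroup_ker : IsPGroup p (rightPr E).ker := by
  rintro ⟨g, hg⟩
  have h1 : g = (SemidirectProduct.inl g.1.left, SemidirectProduct.inl g.2.left) :=
    Prod.ext (SemidirectProduct.ext rfl (congrArg Prod.fst hg))
      (SemidirectProduct.ext rfl (congrArg Prod.snd hg))
  have h2 : ∀ x : D, x ^ p ^ n = 1 := h.mem_level_top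
  refine ⟨n, Subtype.ext ?_⟩
  change g ^ p ^ n = 1
  rw [h1]
  exact Prod.ext (by rw [Prod.pow_fst, ← map_pow, h2, map_one]; rfl)
    (by rw [Prod.pow_snd, ← map_pow, h2, map_one]; rfl)

lemma right_eq_one {P : Subgroup (SD E)} (hP : IsPGroup p P) {g : SD E} (hg : g ∈ P) :
    g.right = 1 := by
  obtain ⟨k, hk⟩ := hP ⟨g, hg⟩
  have h1 : g ^ p ^ k = 1 := congrArg Subtype.val hk
  have h2 := congrArg (SemidirectProduct.rightHom (φ := E.subtype)) h1
  rw [map_pow, map_one] at h2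
  exact Subtype.ext (h.eq_one_of_pow (k := k) g.right.2 (congrArg Subtype.val h2))

/-- The twisted diagonal subgroup `{(α(x), x) | x ∈ D_i}` and the subgroup `full E α` satisfy the
condition that makes endomorphism rings of induced modules local, with respect to `D × D`. The
reason is that conjugation by `(dρ, eσ)` changes the twist `α` by the restriction of `ρσ⁻¹`. -/
lemma isolates (α : MulAut (level D p i)) :
    Isolates p (rightPr E).ker (tw α ⊥) (tw α (stab E p i)) where
  normal := inferInstance
  pgroup := h.isPGroup_ker
  le_S := fun g hg => hg.2
  le_H := inf_le_inf le_rfl (Subgroup.comap_mono bot_le)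
  star := fun x hx => by
    have hst : rightPr E x ∈ stab E p i := by
      rw [← inv_mem_iff]
      refine MulEquiv.ext fun y => ?_
      obtain ⟨y, rfl⟩ := α.surjective y
      obtain ⟨⟨z, hz1, hz2⟩, -⟩ := (mem_tw le_rfl).1 (hx _ (mem_tw_bot.2 ⟨y, rfl⟩))
      rw [Prod.snd_mul, Prod.snd_mul, Prod.snd_inv, conj_inl, SemidirectProduct.left_inl] at hz2
      rw [Prod.fst_mul, Prod.fst_mul, Prod.fst_inv, conj_inl, SemidirectProduct.left_inl] at hz1
      obtain rfl : z = resTop p i (x.2.right⁻¹ : E).1 y := Subtype.ext hz2.symm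
      rw [aut_comm] at hz1
      exact Subtype.ext hz1
    refine ⟨x * (inrPair E (rightPr E x))⁻¹, ?_, _, inrPair_mem_tw le_rfl hst,
      (inv_mul_cancel_right _ _).symm⟩
    rw [MonoidHom.mem_ker, map_mul, map_inv, rightPr_inrPair, mul_inv_cancel]

variable {F : Type u} [Field F] [CharP F p]

lemma src_indecomposable (α : MulAut (level D p i)) (θ : E × E →* Fˣ) :
    (src α θ).Indecomposable :=
  (h.isolates α).indecomposable _

omit h hp [CharP F p] in
/-- Twisting `α` by an element of `E` does not change the induced module. -/
lemma src_iso_of_mul (β : MulAut (level D p i)) (ρ : E) (θ : E × E →* Fˣ) :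
    (src (β * resTop p i ρ) θ).Iso (src β θ) := by
  have key : ∀ (α : MulAut (level D p i)) (σ : E) (x : SD E × SD E), x ∈ tw α (stab E p i) →
      (inrPair E (σ, 1))⁻¹ * x * inrPair E (σ, 1)
        ∈ tw (α * (resTop p i σ)⁻¹) (stab E p i) := by
    intro α σ x hx
    obtain ⟨⟨z, hz1, hz2⟩, hz⟩ := (mem_tw le_rfl).1 hx
    refine (mem_tw le_rfl).2 ⟨⟨z, ?_, ?_⟩, ?_⟩
    · have h1 := aut_comm α (σ⁻¹ : E).1 z
      rw [MulAut.mul_apply, ← map_inv]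
      refine Eq.trans ?_ h1.symm
      rw [← hz1]
      simp [inrPair_apply]
    · simp [inrPair_apply, hz2]
    · have h2 : (((inrPair E (σ, 1))⁻¹ * x * inrPair E (σ, 1)).1.right,
          ((inrPair E (σ, 1))⁻¹ * x * inrPair E (σ, 1)).2.right) = (x.1.right, x.2.right) := by
        refine Prod.ext ?_ ?_
        · change σ⁻¹ * x.1.right * σ = x.1.right
          rw [mul_assoc, inv_mul_eq_iff_eq_mul]
          exact Subtype.ext (mulAut_comm _ _)
        · simp [inrPair_apply]
      rw [h2]
      exact hz
  refine mono_conj _ _ _ (inrPair E (ρ, 1)) fun x => ⟨fun hx => ?_, fun hx => ?_⟩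
  · have := key _ ρ x hx
    rwa [mul_inv_cancel_right] at this
  · have := key _ ρ⁻¹ _ hx
    have h3 : inrPair E (ρ⁻¹, 1) = (inrPair E (ρ, 1))⁻¹ := by
      rw [← map_inv]; simp
    rw [h3, inv_inv] at this
    have h4 : (resTop p i (ρ⁻¹ : E).1)⁻¹ = resTop p i ρ := by
      rw [← map_inv]; simp
    rw [h4] at this
    simpa [mul_assoc] using this

/-- An isomorphism between induced modules conjugates one twisted diagonal subgroup into the other. -/
lemma src_iso_conj {j : ℕ} {α : MulAut (level D p i)} {β : MulAut (level D p j)}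
    {θ θ' : E × E →* Fˣ} (hiso : (src (F := F) α θ).Iso (src β θ')) :
    ∃ ρ σ : E, ∀ y : level D p i, ∃ z : level D p j,
      (ρ : MulAut D) (α y) = β z ∧ (σ : MulAut D) y = z := by
  obtain ⟨x, hx⟩ := (h.isolates α).exists_conj hiso
  refine ⟨x.1.right⁻¹, x.2.right⁻¹, fun y => ?_⟩
  obtain ⟨⟨z, hz1, hz2⟩, -⟩ := (mem_tw le_rfl).1 (hx _ (mem_tw_bot.2 ⟨y, rfl⟩))
  rw [Prod.snd_mul, Prod.snd_mul, Prod.snd_inv, conj_inl, SemidirectProduct.left_inl] at hz2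
  rw [Prod.fst_mul, Prod.fst_mul, Prod.fst_inv, conj_inl, SemidirectProduct.left_inl] at hz1
  exact ⟨z, hz1, hz2⟩

lemma src_iso_le {j : ℕ} (hi : i ≤ n) (hj : j ≤ n) {α : MulAut (level D p i)}
    {β : MulAut (level D p j)} {θ θ' : E × E →* Fˣ}
    (hiso : (src (F := F) α θ).Iso (src β θ')) : i ≤ j := by
  obtain ⟨ρ, σ, hz⟩ := h.src_iso_conj hiso
  refine h.le_of_level_le hi hj fun x hx => ?_
  obtain ⟨z, -, hz2⟩ := hz ⟨x, hx⟩
  have hz' := z.2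
  rw [← hz2, mem_level, ← map_pow] at hz'
  rw [mem_level]
  exact (map_eq_one_iff _ (MulEquiv.injective _)).1 hz'

lemma src_iso_index {j : ℕ} (hi : i ≤ n) (hj : j ≤ n) {α : MulAut (level D p i)}
    {β : MulAut (level D p j)} {θ θ' : E × E →* Fˣ}
    (hiso : (src (F := F) α θ).Iso (src β θ')) : i = j :=
  le_antisymm (h.src_iso_le hi hj hiso) (h.src_iso_le hj hi hiso.symm)

/-- The twist `α` is determined up to `E`, and `θ` up to its values on pairs that agree on `D_i`. -/
theorem src_iso_iff {α β : MulAut (level D p i)} {θ θ' : E × E →* Fˣ} :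
    (src (F := F) α θ).Iso (src β θ') ↔
      (∃ ρ ∈ E, α = β * resTop p i ρ) ∧ ∀ l ∈ stab E p i, θ l = θ' l := by
  constructor
  · intro hiso
    obtain ⟨ρ, σ, hz⟩ := h.src_iso_conj hiso
    have hα : α = β * resTop p i (σ * ρ⁻¹ : E).1 := by
      have h1 : resTop p i ρ.1 * α = β * resTop p i σ.1 := MulEquiv.ext fun y => by
        obtain ⟨z, hz1, hz2⟩ := hz y
        have h2 : resTop p i σ.1 y = z := Subtype.ext hz2
        rw [MulAut.mul_apply, MulAut.mul_apply, h2]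
        exact Subtype.ext hz1
      rw [mulAut_comm, ← eq_mul_inv_iff_mul_eq] at h1
      rw [h1, mul_assoc, ← map_inv, ← map_mul]
      rfl
    refine ⟨⟨_, (σ * ρ⁻¹ : E).2, hα⟩, fun l hl => ?_⟩
    rw [hα] at hiso
    have h3 := (h.isolates β).char_eq ((src_iso_of_mul β _ θ).symm.trans hiso)
      _ (inrPair_mem_tw le_rfl hl)
    rwa [MonoidHom.comp_apply, MonoidHom.comp_apply, rightPr_inrPair] at h3
  · rintro ⟨⟨ρ, hρ, rfl⟩, hθ⟩
    exact (src_iso_of_mul β ⟨ρ, hρ⟩ θ).trans (mono_congr_char fun x hx => hθ _ hx.2)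

end CoprimeAction

end Twisted

/-! ### Modules induced from twisted diagonal subgroups -/

section IsSummand

variable {F : Type u} [Field F] {Γ : Type v} [Group Γ]

/-- `M` is isomorphic to a direct summand of `N`. -/
def FinRep.IsSummand (M N : FinRep F Γ) : Prop :=
  ∃ (i : M.ρ.IntertwiningMap N.ρ) (r : N.ρ.IntertwiningMap M.ρ),
    ∀ m, r.toLinearMap (i.toLinearMap m) = m

lemma FinRep.IsSummand.trans {M N K : FinRep F Γ} (h : M.IsSummand N) (h' : N.IsSummand K) :
    M.IsSummand K := by
  obtain ⟨i, r, hm⟩ := h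
  obtain ⟨i', r', hm'⟩ := h'
  refine ⟨i'.comp i, r.comp r', fun m => ?_⟩
  conv_rhs => rw [← hm m, ← hm' (i.toLinearMap m)]
  rfl

lemma FinRep.Iso.isSummand {M N : FinRep F Γ} (h : M.Iso N) : M.IsSummand N := by
  obtain ⟨e⟩ := h
  exact ⟨e.toIntertwiningMap, e.symm.toIntertwiningMap, equiv_symm_left e⟩

lemma Biproduct.isSummand {M : FinRep F Γ} {ι : Type*} [Fintype ι] {X : ι → FinRep F Γ}
    (b : Biproduct M X) (t : ι) : (X t).IsSummand M :=
  ⟨b.inc t, b.proj t, b.proj_inc_same t⟩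

lemma FinRep.IsSummand.summandOf {M N : FinRep F Γ} {C : FinRep F Γ → Prop} (h : M.IsSummand N)
    (hN : N.SummandOf C) : M.SummandOf C := by
  obtain ⟨i, r, hm⟩ := h
  exact .of_summand i r hm hN

end IsSummand

section Twisted

variable {D : Type v} [CommGroup D] [IsCyclic D] {E : Subgroup (MulAut D)} {p i : ℕ}

omit [IsCyclic D] in
lemma level_zero : level D p 0 = ⊥ := by
  ext x
  rw [mem_level, pow_zero, pow_one, Subgroup.mem_bot]

instance : Subsingleton (level D p 0) := by
  rw [level_zero]
  infer_instance

instance : Subsingleton (MulAut (level D p 0)) :=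
  ⟨fun _ _ => MulEquiv.ext fun _ => Subsingleton.elim _ _⟩

omit [IsCyclic D] in
lemma stab_zero : stab E p 0 = ⊤ :=
  top_unique fun _ _ => Subsingleton.elim _ _

/-- If `L₀` has a complement in `L₁` that is isomorphic to `E`, then inducing a linear character
from `tw α L₀` gives the sum of the modules induced from its extensions to `tw α L₁`. -/
theorem CoprimeAction.exists_biproduct_tw [Finite D] {n : ℕ} [hp : Fact p.Prime]
    (h : CoprimeAction p n E) {F : Type u} [Field F] [CharP F p] (α : MulAut (level D p i))
    {L₀ L₁ : Subgroup (E × E)} (hL : L₁ ≤ stab E p i) (τ : E →* E × E) (pr : E × E →* E)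
    (hτ : ∀ e, pr (τ e) = e) (hτL : ∀ e, τ e ∈ L₁) (hL₀ : ∀ l ∈ L₀, l ∈ L₁ ∧ pr l = 1)
    (hL₁ : ∀ l ∈ L₁, (τ (pr l))⁻¹ * l ∈ L₀) (θ : E × E →* Fˣ) :
    Nonempty (Biproduct (twRep α L₀ θ) fun ν : E →* Fˣ =>
      twRep α L₁ (ν.comp pr * ((θ.comp τ).comp pr)⁻¹ * θ)) := by
  have hLL : L₀ ≤ L₁ := fun l hl => (hL₀ l hl).1
  let _ : Fintype E := Fintype.ofFinite E
  have hval : ∀ (ν : E →* Fˣ) (e : E),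
      ((ν.comp pr * ((θ.comp τ).comp pr)⁻¹ * θ).comp (rightPr E)) ((inrPair E).comp τ e) = ν e := by
    intro ν e
    rw [MonoidHom.comp_apply, MonoidHom.comp_apply, rightPr_inrPair]
    simp [hτ]
  have hmem : ∀ g : SD E × SD E, g ∈ tw α L₁ → rightPr E g ∈ L₀ → g ∈ tw α L₀ :=
    fun g hg hg' => ⟨hg.1, hg'⟩
  refine exists_biproduct_of_complement (A := E) ((inrPair E).comp τ) _ _
    (inf_le_inf le_rfl (Subgroup.comap_mono hLL)) (fun e => inrPair_mem_tw hL (hτL e))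
    (fun e he => ?_) (fun g hg => ⟨pr (rightPr E g), hmem _
      (mul_mem (inv_mem (inrPair_mem_tw hL (hτL _))) hg) ?_⟩) (fun e g hg => hmem _
      (mul_mem (mul_mem (inv_mem (inrPair_mem_tw hL (hτL e))) ⟨hg.1, hLL hg.2⟩)
        (inrPair_mem_tw hL (hτL e))) ?_) (fun ν g hg => ?_) (fun ν ν' hne => ?_) (fun e he => ?_)
    h.card_E_ne_zero h.card_char_ne_zero
  · have := (hL₀ _ he.2).2
    rwa [MonoidHom.comp_apply, rightPr_inrPair, hτ] at this
  · rw [map_mul, map_inv, MonoidHom.comp_apply, rightPr_inrPair]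
    exact hL₁ _ hg.2
  · rw [map_mul, map_mul, map_inv, MonoidHom.comp_apply, rightPr_inrPair,
      show (τ e)⁻¹ * rightPr E g = rightPr E g * (τ e)⁻¹ from
        Prod.ext (h.mul_comm_E _ _) (h.mul_comm_E _ _), inv_mul_cancel_right]
    exact hg.2
  · have := (hL₀ _ hg.2).2
    simp [this]
  · simp only [hval]
    exact sum_char_eq_zero hne
  · simp only [hval]
    exact h.sum_char_apply_eq_zero he

variable [Finite D] {n : ℕ} [hp : Fact p.Prime]

omit hp [IsCyclic D] [Finite D] in
lemma char_mul_inv_mul {F : Type u} [Field F] (χ θ : E × E →* Fˣ) : χ * χ⁻¹ * θ = θ :=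
  MonoidHom.ext fun _ => by simp

omit hp [Finite D] in
lemma tw_one_bot : tw (1 : MulAut (level D p 0)) (⊥ : Subgroup (E × E)) = ⊥ := by
  ext x
  rw [mem_tw_bot, Subgroup.mem_bot]
  constructor
  · rintro ⟨y, rfl⟩
    rw [Subsingleton.elim y 1]
    simp
  · rintro rfl
    exact ⟨1, by simp; rfl⟩

namespace CoprimeAction

variable (h : CoprimeAction p n E)

include h

lemma mem_stab_iff (hi : 1 ≤ i) {l : E × E} : l ∈ stab E p i ↔ l.1 = l.2 := by
  constructor
  · intro hl
    have h1 : resTop p i (l.1 * l.2⁻¹ : E).1 = 1 := by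
      rw [Subgroup.coe_mul, map_mul, mem_stab.1 hl, ← map_mul]
      simp
    exact mul_inv_eq_one.1 (Subtype.ext (h.eq_one_of_resTop (l.1 * l.2⁻¹ : E).2 hi h1))
  · intro hl
    rw [mem_stab, hl]

variable {F : Type u} [Field F] [CharP F p]

/-- Every `src α θ` is a summand of the module induced from the trivial module of the twisted
diagonal subgroup, and every summand of the latter is of this form. -/
lemma src_isSummand_and (α : MulAut (level D p i)) :
    (∀ θ : E × E →* Fˣ, (src α θ).IsSummand (monoRep (tw α ⊥) 1)) ∧
    (monoRep (tw α ⊥) (1 : SD E × SD E →* Fˣ)).SummandOf fun X => ∃ θ, X = src α θ := by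
  have key : ∀ θ : E × E →* Fˣ, (twRep α ⊥ θ).Iso (monoRep (tw α ⊥) 1) := fun θ =>
    mono_congr_char fun x hx => by
      rw [MonoidHom.comp_apply, Subgroup.mem_bot.1 hx.2, map_one]
      rfl
  rcases Nat.eq_zero_or_pos i with rfl | hi
  · have hb1 := fun θ : E × E →* Fˣ => h.exists_biproduct_tw α (L₀ := (⊤ : Subgroup E).prod ⊥)
      (L₁ := stab E p 0) le_rfl (MonoidHom.inr E E) (MonoidHom.snd E E) (fun _ => rfl)
      (fun _ => by rw [stab_zero]; trivial) (fun l hl => ⟨by rw [stab_zero]; trivial, hl.2⟩)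
      (fun l _ => ⟨trivial, by simp⟩) θ
    have hb2 := fun θ : E × E →* Fˣ => h.exists_biproduct_tw α (L₀ := ⊥)
      (L₁ := (⊤ : Subgroup E).prod ⊥) (by rw [stab_zero]; exact le_top)
      (MonoidHom.inl E E) (MonoidHom.fst E E) (fun _ => rfl)
      (fun _ => ⟨trivial, rfl⟩) (fun l hl => by rw [Subgroup.mem_bot.1 hl]; exact ⟨one_mem _, rfl⟩)
      (fun l hl => Prod.ext (by simp) (by simpa using hl.2)) θ
    refine ⟨fun θ => ?_, ?_⟩
    · have h1 := ((hb1 θ).some.isSummand (θ.comp (MonoidHom.inr E E))).trans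
        ((Eq.mp (congrArg (fun χ => (twRep α ((⊤ : Subgroup E).prod ⊥) χ).IsSummand _)
          (char_mul_inv_mul ((θ.comp (MonoidHom.inl E E)).comp (MonoidHom.fst E E)) θ))
          ((hb2 θ).some.isSummand (θ.comp (MonoidHom.inl E E)))).trans (key θ).isSummand)
      exact Eq.mp (congrArg (fun χ => (src α χ).IsSummand _) (char_mul_inv_mul _ θ)) h1
    · refine (key 1).symm.isSummand.summandOf (((hb2 1).some.summandOf
        (C := fun X => ∃ θ, X = twRep α ((⊤ : Subgroup E).prod ⊥) θ) fun _ => ⟨_, rfl⟩).trans ?_)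
      rintro _ ⟨θ, rfl⟩
      exact (hb1 θ).some.summandOf fun _ => ⟨_, rfl⟩
  · have hb := fun θ : E × E →* Fˣ => h.exists_biproduct_tw α (L₀ := ⊥)
      (L₁ := stab E p i) le_rfl ((MonoidHom.id E).prod (MonoidHom.id E)) (MonoidHom.fst E E)
      (fun _ => rfl) (fun _ => (h.mem_stab_iff hi).2 rfl)
      (fun l hl => by rw [Subgroup.mem_bot.1 hl]; exact ⟨one_mem _, rfl⟩)
      (fun l hl => Prod.ext (by simp) (by
        have := (h.mem_stab_iff hi).1 hl
        simp [this])) θ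
    refine ⟨fun θ => ?_, ?_⟩
    · have h1 := ((hb θ).some.isSummand (θ.comp ((MonoidHom.id E).prod (MonoidHom.id E)))).trans
        (key θ).isSummand
      exact Eq.mp (congrArg (fun χ => (src α χ).IsSummand _) (char_mul_inv_mul _ θ)) h1
    · exact (key 1).symm.isSummand.summandOf ((hb 1).some.summandOf fun _ => ⟨_, rfl⟩)

omit [CharP F p] in
/-- The subgroups of `D × D` that meet both factors trivially are the twisted diagonal subgroups
of the `D_k × D_k`. -/
lemma exists_eq_tw (X : Subgroup (SD E × SD E)) (hX : X ≤ (rightPr E).ker)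
    (h1 : ∀ x ∈ X, x.1 = 1 → x = 1) (h2 : ∀ x ∈ X, x.2 = 1 → x = 1) :
    ∃ k ≤ n, ∃ α : MulAut (level D p k), X = tw α ⊥ := by
  have hr1 : ∀ x ∈ X, x.1 = SemidirectProduct.inl x.1.left := fun x hx =>
    SemidirectProduct.ext rfl (congrArg Prod.fst (hX hx))
  have hr2 : ∀ x ∈ X, x.2 = SemidirectProduct.inl x.2.left := fun x hx =>
    SemidirectProduct.ext rfl (congrArg Prod.snd (hX hx))
  let f : X →* D := MonoidHom.mk' (fun x => x.1.1.left) fun x y => by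
    have := congrArg Prod.fst (hX x.2)
    change (x.1.1 * y.1.1).left = _
    rw [SemidirectProduct.mul_left, show x.1.1.right = 1 from this]
    rfl
  let g : X →* D := MonoidHom.mk' (fun x => x.1.2.left) fun x y => by
    have := congrArg Prod.snd (hX x.2)
    change (x.1.2 * y.1.2).left = _
    rw [SemidirectProduct.mul_left, show x.1.2.right = 1 from this]
    rfl
  have hf : Function.Injective f := (injective_iff_map_eq_one f).2 fun x hx => Subtype.ext
    (h1 _ x.2 (by rw [hr1 _ x.2, show x.1.1.left = 1 from hx, map_one]))
  have hg : Function.Injective g := (injective_iff_map_eq_one g).2 fun x hx => Subtype.ext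
    (h2 _ x.2 (by rw [hr2 _ x.2, show x.1.2.left = 1 from hx, map_one]))
  obtain ⟨k, hk, hgk⟩ := h.eq_level g.range
  have hfk : f.range = level D p k := by
    rw [← hgk]
    exact subgroup_eq_of_card_eq ((Nat.card_congr (MonoidHom.ofInjective hf).toEquiv).symm.trans
      (Nat.card_congr (MonoidHom.ofInjective hg).toEquiv))
  let ef : X ≃* level D p k := (MonoidHom.ofInjective hf).trans (MulEquiv.subgroupCongr hfk)
  let eg : X ≃* level D p k := (MonoidHom.ofInjective hg).trans (MulEquiv.subgroupCongr hgk)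
  have hef : ∀ x, (ef x : D) = x.1.1.left := fun x => rfl
  have heg : ∀ x, (eg x : D) = x.1.2.left := fun x => rfl
  refine ⟨k, hk, eg.symm.trans ef, Subgroup.ext fun x => ?_⟩
  rw [mem_tw_bot]
  constructor
  · intro hx
    refine ⟨eg ⟨x, hx⟩, Prod.ext ?_ ?_⟩
    · rw [MulEquiv.trans_apply, MulEquiv.symm_apply_apply, hef]
      exact hr1 x hx
    · rw [heg]
      exact hr2 x hx
  · rintro ⟨y, rfl⟩
    obtain ⟨x, rfl⟩ := eg.surjective y
    rw [MulEquiv.trans_apply, MulEquiv.symm_apply_apply, hef, heg, ← hr1 _ x.2, ← hr2 _ x.2]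
    exact x.2

omit [CharP F p] in
lemma le_ker_of_isTwistedDiagonal {X : Subgroup (SD E × SD E)} (hX : IsTwistedDiagonal p X) :
    X ≤ (rightPr E).ker ∧ (∀ x ∈ X, x.1 = 1 → x = 1) ∧ (∀ x ∈ X, x.2 = 1 → x = 1) := by
  obtain ⟨P, Q, φ, hP, hQ, hX⟩ := hX
  refine ⟨fun x hx => ?_, fun x hx hx1 => ?_, fun x hx hx2 => ?_⟩
  · obtain ⟨y, rfl⟩ := (hX x).1 hx
    exact Prod.ext (h.right_eq_one hP (φ y).2) (h.right_eq_one hQ y.2)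
  · obtain ⟨y, rfl⟩ := (hX x).1 hx
    have h3 : φ y = 1 := Subtype.ext hx1
    rw [(map_eq_one_iff φ φ.injective).1 h3, map_one]
    rfl
  · obtain ⟨y, rfl⟩ := (hX x).1 hx
    have h3 : y = 1 := Subtype.ext hx2
    rw [h3, map_one]
    rfl

omit [CharP F p] in
lemma isTwistedDiagonal_tw (α : MulAut (level D p i)) :
    IsTwistedDiagonal p (tw (E := E) α ⊥) := by
  let A : Subgroup (SD E) := (level D p i).map SemidirectProduct.inl
  have hA : IsPGroup p A := by
    refine IsPGroup.map (fun x => ⟨n, Subtype.ext ?_⟩) _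
    exact h.mem_level_top x.1
  let e : level D p i ≃* A :=
    (level D p i).equivMapOfInjective _ SemidirectProduct.inl_injective
  refine ⟨A, A, (e.symm.trans α).trans e, hA, hA, fun x => ?_⟩
  rw [mem_tw_bot]
  constructor
  · rintro ⟨y, rfl⟩
    refine ⟨e y, ?_⟩
    rw [MulEquiv.trans_apply, MulEquiv.trans_apply, MulEquiv.symm_apply_apply]
    rfl
  · rintro ⟨y, rfl⟩
    obtain ⟨y, rfl⟩ := e.surjective y
    refine ⟨y, ?_⟩
    rw [MulEquiv.trans_apply, MulEquiv.trans_apply, MulEquiv.symm_apply_apply]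
    rfl

/-- An indecomposable `p`-permutation module that is relatively projective to a twisted diagonal
subgroup `X` is some `src α θ`. -/
theorem exists_iso_src {M : FinRep F (SD E × SD E)} (hM : M.Indecomposable)
    (hperm : M.PPermutation p) {X : Subgroup (SD E × SD E)} (hX : IsTwistedDiagonal p X)
    (hrel : M.RelProjective X) : ∃ k ≤ n, ∃ (α : MulAut (level D p k)) (θ : E × E →* Fˣ),
      tw α ⊥ ≤ X ∧ M.Iso (src α θ) := by
  obtain ⟨hX0, hX1, hX2⟩ := h.le_ker_of_isTwistedDiagonal hX
  have h1 := (hrel.summandOf hperm (h.isPGroup_ker.to_le hX0)).trans (C' := fun Y =>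
      ∃ k ≤ n, ∃ (α : MulAut (level D p k)) (θ : E × E →* Fˣ), tw α ⊥ ≤ X ∧ Y = src α θ) (by
    rintro _ ⟨R, hR, rfl⟩
    obtain ⟨k, hk, α, rfl⟩ := h.exists_eq_tw R (hR.trans hX0) (fun x hx => hX1 x (hR hx))
      (fun x hx => hX2 x (hR hx))
    obtain ⟨l, Y, a, b, hY, hab⟩ := (h.src_isSummand_and (F := F) α).2
    refine ⟨l, Y, a, b, fun t => ?_, hab⟩
    obtain ⟨θ, hθ⟩ := hY t
    exact ⟨k, hk, α, θ, hR, hθ⟩)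
  obtain ⟨_, ⟨k, hk, α, θ, hα, rfl⟩, hiso⟩ := hM.exists_iso_of_summandOf h1 (by
    rintro _ ⟨k, hk, α, θ, -, rfl⟩
    exact h.src_indecomposable α θ)
  exact ⟨k, hk, α, θ, hα, hiso⟩

omit h [IsCyclic D] in
lemma _root_.TrivialSource.FinRep.PPermutation.congr {M N : FinRep F (SD E × SD E)}
    (hM : M.PPermutation p) (hiso : M.Iso N) : N.PPermutation p := fun P hP => by
  obtain ⟨ι, b, hb⟩ := hM P hP
  obtain ⟨e⟩ := hiso
  refine ⟨ι, b.map e.toLinearEquiv, fun g hg i => ?_⟩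
  obtain ⟨j, hj⟩ := hb g hg i
  refine ⟨j, ?_⟩
  rw [Module.Basis.map_apply, Module.Basis.map_apply, ← hj]
  exact (equiv_act e g (b i)).symm

lemma src_pPermutation (α : MulAut (level D p i)) (θ : E × E →* Fˣ) :
    (src α θ).PPermutation p := monoRep_pPermutation p _ _

lemma relProjective_of_iso_src {M : FinRep F (SD E × SD E)} {α : MulAut (level D p i)}
    {θ : E × E →* Fˣ} (hiso : M.Iso (src α θ)) : M.RelProjective (tw α ⊥) := by
  obtain ⟨a, r, hm⟩ := hiso.isSummand.trans ((h.src_isSummand_and α).1 θ)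
  exact relProjective_of_summand a r hm

/-- If `src α θ` is projective relative to a subgroup `R` of its twisted diagonal subgroup, then it is
isomorphic to a module `src β θ'` attached to a subgroup of `R`; since `i` is determined by the
module, `R` is the whole twisted diagonal subgroup. -/
theorem isVertex_of_iso_src (hi : i ≤ n) {M : FinRep F (SD E × SD E)} {α : MulAut (level D p i)}
    {θ : E × E →* Fˣ} (hiso : M.Iso (src α θ)) : M.IsVertex (tw α ⊥) := by
  refine ⟨h.relProjective_of_iso_src hiso, fun R hR hrel => ?_⟩
  obtain ⟨hX0, hX1, hX2⟩ := h.le_ker_of_isTwistedDiagonal (h.isTwistedDiagonal_tw α)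
  obtain ⟨j, -, γ, rfl⟩ := h.exists_eq_tw R (hR.trans hX0) (fun x hx => hX1 x (hR hx))
      (fun x hx => hX2 x (hR hx))
  obtain ⟨k, hk, β, θ', hβ, hiso'⟩ := h.exists_iso_src
    ((h.src_indecomposable α θ).congr hiso.symm)
    ((h.src_pPermutation α θ).congr hiso.symm) (h.isTwistedDiagonal_tw γ) hrel
  obtain rfl := h.src_iso_index hi hk (hiso.symm.trans hiso')
  refine Subgroup.eq_of_le_of_card_ge hR ?_
  rw [card_tw_bot α, ← card_tw_bot (E := E) β]
  exact Subgroup.card_le_of_le hβ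

theorem exists_iso_src_of_isVertex {M : FinRep F (SD E × SD E)} (hM : M.Indecomposable)
    (hperm : M.PPermutation p) {X : Subgroup (SD E × SD E)} (hX : IsTwistedDiagonal p X)
    (hv : M.IsVertex X) : ∃ k ≤ n, ∃ (α : MulAut (level D p k)) (θ : E × E →* Fˣ),
      X = tw α ⊥ ∧ M.Iso (src α θ) := by
  obtain ⟨k, hk, α, θ, hα, hiso⟩ := h.exists_iso_src hM hperm hX hv.1
  exact ⟨k, hk, α, θ, (hv.2 _ hα (h.relProjective_of_iso_src hiso)).symm, hiso⟩

lemma src_projective (α : MulAut (level D p 0)) (θ : E × E →* Fˣ) : (src α θ).Projective := by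
  obtain rfl : α = 1 := Subsingleton.elim _ _
  have h1 := (h.src_isSummand_and (1 : MulAut (level D p 0))).1 θ
  rw [tw_one_bot] at h1
  obtain ⟨a, r, hm⟩ := h1
  exact projective_of_summand a r hm

theorem exists_iso_src_of_projective {M : FinRep F (SD E × SD E)} (hM : M.Indecomposable)
    (hproj : M.Projective) :
    ∃ θ : E × E →* Fˣ, M.Iso (src (1 : MulAut (level D p 0)) θ) := by
  have h1 := (h.src_isSummand_and (F := F) (1 : MulAut (level D p 0))).2
  rw [tw_one_bot] at h1
  obtain ⟨_, ⟨θ, rfl⟩, hiso⟩ := hM.exists_iso_of_summandOf (hproj.summandOf.trans (by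
    rintro _ rfl
    exact h1)) (by
    rintro _ ⟨θ, rfl⟩
    exact h.src_indecomposable _ θ)
  exact ⟨θ, hiso⟩

end CoprimeAction

end Twisted

/-! ### Tensor products of modules induced from twisted diagonal subgroups -/

section Tensor

variable {D : Type v} [CommGroup D] [IsCyclic D] {E : Subgroup (MulAut D)} {p i j k l : ℕ}

omit [IsCyclic D] in
lemma stab_mono (h : k ≤ i) : stab E p i ≤ stab E p k := fun x hx => by
  rw [mem_stab] at hx ⊢
  exact MulEquiv.ext fun y => Subtype.ext (congrArg
    (fun a : MulAut (level D p i) => (a ⟨y, level_mono h y.2⟩ : D)) hx)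

lemma mem_tw_inl_conj {α : MulAut (level D p i)} {L : Subgroup (E × E)} (hL : L ≤ stab E p i)
    {y z : SD E} {t : D} :
    ((SemidirectProduct.inl t)⁻¹ * y * SemidirectProduct.inl t, z) ∈ tw α L ↔
      (∃ x : level D p i, t⁻¹ * y.left * (y.right : MulAut D) t = α x ∧ z.left = x) ∧
        (y.right, z.right) ∈ L := by
  rw [mem_tw hL]
  simp [← map_inv]

variable {α : MulAut (level D p i)} {β : MulAut (level D p j)} {L L' : Subgroup (E × E)}
  (hki : k ≤ i) (hkj : k ≤ j) (hk : k = i ∨ k = j) (hil : i ≤ l) (hjl : j ≤ l)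
  (hL : L ≤ stab E p i) (hL' : L' ≤ stab E p j)

include hil hjl hL hL' in
lemma fix_of_mem_tw {t : D} (hfix : ∀ σ : E, t⁻¹ * (σ : MulAut D) t ∈ level D p l →
      (σ : MulAut D) t = t) {x y z : SD E} (h : (x, y) ∈ tw α L)
    (h' : ((SemidirectProduct.inl t)⁻¹ * y * SemidirectProduct.inl t, z) ∈ tw β L') :
    (y.right : MulAut D) t = t := by
  obtain ⟨⟨a, -, ha⟩, -⟩ := (mem_tw hL).1 h
  obtain ⟨⟨b, hb, -⟩, -⟩ := (mem_tw_inl_conj hL').1 h'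
  apply hfix
  have : t⁻¹ * (y.right : MulAut D) t = (a : D)⁻¹ * β b := by
    rw [← hb, ← show y.left = a from ha, mul_comm t⁻¹ y.left, mul_assoc, inv_mul_cancel_left]
  rw [this]
  exact mul_mem (inv_mem (level_mono hil a.2)) (level_mono hjl (β b).2)

include hk hil hjl hL hL' in
/-- The composite of `tw α L` with the conjugate of `tw β L'` by `t`. -/
lemma mem_tw_comp {t : D} (hfix : ∀ σ : E, t⁻¹ * (σ : MulAut D) t ∈ level D p l →
      (σ : MulAut D) t = t) {Lc : Subgroup (E × E)}
    (hLc : ∀ ρ τ, (ρ, τ) ∈ Lc ↔ ∃ σ, (ρ, σ) ∈ L ∧ (σ, τ) ∈ L' ∧ (σ : MulAut D) t = t)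
    (x z : SD E) : (x, z) ∈ tw (res hki α * res hkj β) Lc ↔ ∃ y, (x, y) ∈ tw α L ∧
      ((SemidirectProduct.inl t)⁻¹ * y * SemidirectProduct.inl t, z) ∈ tw β L' := by
  have hLcs : Lc ≤ stab E p k := fun r hr => by
    obtain ⟨σ, h1, h2, -⟩ := (hLc r.1 r.2).1 hr
    exact (mem_stab.1 (stab_mono hki (hL h1))).trans (mem_stab.1 (stab_mono hkj (hL' h2)))
  constructor
  · intro h
    obtain ⟨⟨b, hb1, hb2⟩, hr⟩ := (mem_tw hLcs).1 h
    obtain ⟨σ, h1, h2, h3⟩ := (hLc _ _).1 hr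
    refine ⟨⟨β ⟨b, level_mono hkj b.2⟩, σ⟩, (mem_tw hL).2
      ⟨⟨⟨β ⟨b, level_mono hkj b.2⟩, level_mono hki (aut_mem β _ b.2)⟩, hb1, rfl⟩, h1⟩,
      (mem_tw_inl_conj hL').2 ⟨⟨⟨b, level_mono hkj b.2⟩, ?_, hb2⟩, h2⟩⟩
    change t⁻¹ * _ * (σ : MulAut D) t = _
    rw [h3, mul_comm, mul_inv_cancel_left]
  · rintro ⟨y, hy, hy'⟩
    have hσ := fix_of_mem_tw hil hjl hL hL' hfix hy hy'
    obtain ⟨⟨a, ha1, ha2⟩, h1⟩ := (mem_tw hL).1 hy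
    obtain ⟨⟨b, hb1, hb2⟩, h2⟩ := (mem_tw_inl_conj hL').1 hy'
    rw [hσ, mul_comm, mul_inv_cancel_left, show y.left = a from ha2] at hb1
    have hbk : (b : D) ∈ level D p k := by
      rcases hk with rfl | rfl
      · have hm : (β b : D) ∈ level D p k := hb1 ▸ a.2
        have := aut_mem β⁻¹ (β b).2 hm
        rwa [show β⁻¹ ⟨β b, (β b).2⟩ = b from β.symm_apply_apply b] at this
      · exact b.2
    refine (mem_tw hLcs).2 ⟨⟨⟨b, hbk⟩, ?_, hb2⟩, (hLc _ _).2 ⟨_, h1, h2, hσ⟩⟩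
    rw [show (x, z).1.left = α a from ha1]
    exact congrArg (fun c : level D p i => (α c : D)) (Subtype.ext hb1)

namespace CoprimeAction

variable [Finite D] {n : ℕ} [hp : Fact p.Prime] (h : CoprimeAction p n E)

/-- The representatives of the double cosets: `1` (if the proposition `ok` holds) and the
representatives of the `E`-orbits of nontrivial cosets of `D_l`. -/
def dcRep {l : ℕ} (ok : Prop) : PLift ok ⊕ h.Orbits l → D
  | .inl _ => 1
  | .inr o => h.rep o

include h

/-- The projection to `E` is injective on such a group `A`, whose order is therefore prime to `p`. This
keeps the generators of the tensor product from being annihilated by the separating functionals. -/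
lemma card_ne_zero {F : Type u} [Field F] [CharP F p] (hL : L ≤ stab E p i)
    (A : Subgroup (SD E)) (hA : ∀ y ∈ A, (1, y) ∈ tw α L) : (Nat.card A : F) ≠ 0 := by
  have hinj : Function.Injective
      ((SemidirectProduct.rightHom (φ := E.subtype)).comp A.subtype) := by
    refine (injective_iff_map_eq_one _).2 fun y hy => Subtype.ext (SemidirectProduct.ext ?_ hy)
    obtain ⟨⟨a, ha1, ha2⟩, -⟩ := (mem_tw hL).1 (hA y y.2)
    have h1 : a = 1 := (map_eq_one_iff α α.injective).1 (Subtype.ext ha1.symm)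
    rw [h1] at ha2
    exact ha2
  have hdvd := Subgroup.card_dvd_of_injective _ hinj
  rw [Ne, CharP.cast_eq_zero_iff F p]
  exact fun hd => hp.out.one_lt.ne' (Nat.eq_one_of_dvd_coprimes h.coprime (hd.trans hdvd) dvd_rfl)

include hk hL hL' in
/-- The product of two modules induced from linear characters of twisted diagonal subgroups. The
trivial double coset contributes the module for the composite of the two subgroups, provided that
the characters are compatible; the double coset of any other representative contributes the module
for the elements with trivial middle component in `E`. -/
theorem cls_twRep_mul {F : Type u} [Field F] [CharP F p] (hl : l = i ∨ l = j) (hil : i ≤ l)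
    (hjl : j ≤ l) {L₁ L₀ : Subgroup (E × E)}
    (hpr : ∀ σ, ∃ ρ, (ρ, σ) ∈ L) (hpr' : ∀ σ, ∃ τ, (σ, τ) ∈ L')
    (hL₁ : ∀ ρ τ, (ρ, τ) ∈ L₁ ↔ ∃ σ, (ρ, σ) ∈ L ∧ (σ, τ) ∈ L')
    (hL₀ : ∀ ρ τ, (ρ, τ) ∈ L₀ ↔ (ρ, 1) ∈ L ∧ (1, τ) ∈ L')
    {θ θ' θ₁ θ₀ : E × E →* Fˣ} (ok : Prop) [Decidable ok]
    (hok : ok → ∀ ρ σ τ, (ρ, σ) ∈ L → (σ, τ) ∈ L' → θ₁ (ρ, τ) = θ (ρ, σ) * θ' (σ, τ))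
    (hnok : ¬ ok → ∃ σ, (1, σ) ∈ L ∧ (σ, 1) ∈ L' ∧ θ (1, σ) * θ' (σ, 1) ≠ 1)
    (hθ₀ : ∀ ρ τ, (ρ, 1) ∈ L → (1, τ) ∈ L' → θ₀ (ρ, τ) = θ (ρ, 1) * θ' (1, τ)) :
    cls (twRep α L θ) * cls (twRep β L' θ')
      = (if ok then cls (twRep (res hki α * res hkj β) L₁ θ₁) else 0)
        + Fintype.card (h.Orbits l) • cls (twRep (res hki α * res hkj β) L₀ θ₀) := by
  have hfix1 : ∀ σ : E, (1 : D)⁻¹ * (σ : MulAut D) 1 ∈ level D p l → (σ : MulAut D) 1 = 1 :=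
    fun σ _ => map_one _
  have hfix2 : ∀ (o : h.Orbits l) (σ : E), (h.rep o)⁻¹ * (σ : MulAut D) (h.rep o) ∈ level D p l →
      (σ : MulAut D) (h.rep o) = h.rep o := fun o σ hσ => by
    rw [h.eq_one_of_fix σ.2 (h.rep_notMem o) hσ]; rfl
  have hone : ∀ (o : h.Orbits l) (σ : E), (σ : MulAut D) (h.rep o) = h.rep o → σ = 1 :=
    fun o σ hσ => Subtype.ext (h.eq_one_of_fix σ.2 (h.rep_notMem o) (by
      rw [hσ, inv_mul_cancel]; exact one_mem _))
  -- every element of `D` is in the double coset of `1` or of a representative of an orbit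
  have hdec : ∀ d : D, ∃ t : D, (t = 1 ∨ ∃ o : h.Orbits l, t = h.rep o) ∧
      ∃ e₁ ∈ level D p i, ∃ e₂ ∈ level D p j, ∃ ρ : E, d = e₁ * (ρ : MulAut D) t * e₂ := by
    intro d
    obtain ⟨t, ht, ρ, e, he, hd⟩ : ∃ t : D, (t = 1 ∨ ∃ o : h.Orbits l, t = h.rep o) ∧
        ∃ ρ : E, ∃ e ∈ level D p l, d = (ρ : MulAut D) t * e := by
      by_cases hd : d ∈ level D p l
      · exact ⟨1, .inl rfl, 1, d, hd, by rw [map_one, one_mul]⟩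
      · obtain ⟨o, ρ, e, he, hd⟩ := h.exists_rep hd
        exact ⟨_, .inr ⟨o, rfl⟩, ρ, e, he, hd⟩
    refine ⟨t, ht, ?_⟩
    rcases hl with rfl | rfl
    · exact ⟨e, he, 1, one_mem _, ρ, by rw [hd, mul_one, mul_comm]⟩
    · exact ⟨1, one_mem _, e, he, ρ, by rw [hd, one_mul]⟩
  have hcos : ∀ s : SD E, ∃ t : D, (t = 1 ∨ ∃ o : h.Orbits l, t = h.rep o) ∧
      ∃ x y y' z, (x, y) ∈ tw α L ∧ (y', z) ∈ tw β L' ∧ s = y * SemidirectProduct.inl t * y' := by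
    intro s
    obtain ⟨t, ht, e₁, he₁, e₂, he₂, ρ, hd⟩ := hdec s.left
    obtain ⟨ρ', hρ'⟩ := hpr ρ
    obtain ⟨τ, hτ⟩ := hpr' (ρ⁻¹ * s.right)
    let e₃ := resTop p j (ρ⁻¹ : E).1 ⟨e₂, he₂⟩
    refine ⟨t, ht, ⟨α ⟨e₁, he₁⟩, ρ'⟩, ⟨e₁, ρ⟩, ⟨(e₃ : D), ρ⁻¹ * s.right⟩, ⟨(β⁻¹ e₃ : level D p j), τ⟩,
      (mem_tw hL).2 ⟨⟨⟨e₁, he₁⟩, rfl, rfl⟩, hρ'⟩,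
      (mem_tw hL').2 ⟨⟨β⁻¹ e₃, ?_, rfl⟩, hτ⟩, SemidirectProduct.ext ?_ ?_⟩
    · exact congrArg Subtype.val (β.apply_symm_apply e₃).symm
    · have h1 : (ρ : MulAut D) (e₃ : D) = e₂ := (ρ : MulAut D).apply_symm_apply e₂
      simp only [SemidirectProduct.mul_left, SemidirectProduct.mul_right,
        SemidirectProduct.left_inl, SemidirectProduct.right_inl, mul_one, Subgroup.subtype_apply]
      rw [h1, hd]
    · simp
  have htev : ¬ ok → tev (tw α L) (tw β L') (θ.comp (rightPr E)) (θ'.comp (rightPr E)) 1 = 0 := by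
    intro hn
    obtain ⟨σ, h1, h2, h3⟩ := hnok hn
    have h4 := tev_act_of_mem (H := tw α L) (H' := tw β L') (θ.comp (rightPr E))
      (θ'.comp (rightPr E)) (s := 1) (x := 1) (z := 1)
      (y := SemidirectProduct.inr σ) (inrPair_mem_tw hL h1) (by
        rw [inv_one, one_mul, mul_one]
        exact inrPair_mem_tw hL' h2)
    rw [act_one', inv_one, one_mul, mul_one, ← Units.val_mul] at h4
    by_contra h0
    have h5 := smul_left_injective F h0 (h4.symm.trans (one_smul F _).symm)
    exact h3 (Units.ext h5)
  rw [cls_mul]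
  suffices hB : Nonempty (Biproduct (tensor (twRep α L θ) (twRep β L' θ')) fun s => monoRep
      (Sum.elim (fun _ => tw (res hki α * res hkj β) L₁)
        (fun _ : h.Orbits l => tw (res hki α * res hkj β) L₀) s)
      (Sum.elim (fun _ : PLift ok => θ₁.comp (rightPr E)) (fun _ => θ₀.comp (rightPr E)) s)) by
    obtain ⟨b⟩ := hB
    have hb : cls (tensor (twRep α L θ) (twRep β L' θ')) = _ := b.cls_eq
    rw [hb, Fintype.sum_sum_type]
    congr 1
    · split_ifs with hk'
      · have : Unique (PLift ok) := ⟨⟨⟨hk'⟩⟩, fun _ => Subsingleton.elim _ _⟩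
        rw [Fintype.sum_unique]
        rfl
      · have : IsEmpty (PLift ok) := ⟨fun a => hk' a.down⟩
        rw [Fintype.sum_empty]
    · rw [← Finset.card_univ, ← Finset.sum_const]
      rfl
  refine exists_biproduct_tensor (tw α L) (tw β L') (θ.comp (rightPr E))
    (θ'.comp (rightPr E)) (fun s => SemidirectProduct.inl (h.dcRep (l := l) ok s))
    (Sum.elim (fun _ => tw (res hki α * res hkj β) L₁) fun _ => tw (res hki α * res hkj β) L₀)
    (Sum.elim (fun _ => θ₁.comp (rightPr E)) fun _ => θ₀.comp (rightPr E)) ?_ ?_ ?_ ?_ ?_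
  · rintro (_ | o) x z
    · exact mem_tw_comp hki hkj hk hil hjl hL hL' hfix1 (fun ρ τ => by
        rw [hL₁]
        exact exists_congr fun σ => ⟨fun h => ⟨h.1, h.2, map_one _⟩, fun h => ⟨h.1, h.2.1⟩⟩) x z
    · refine mem_tw_comp hki hkj hk hil hjl hL hL' (hfix2 o) (fun ρ τ => ?_) x z
      rw [hL₀]
      constructor
      · rintro ⟨h1, h2⟩
        exact ⟨1, h1, h2, rfl⟩
      · rintro ⟨σ, h1, h2, h3⟩
        obtain rfl := hone o σ h3
        exact ⟨h1, h2⟩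
  · rintro (a | o) x y z hy hy'
    · have hyr := ((mem_tw_inl_conj hL').1 hy').2
      have := hok a.down _ _ _ ((mem_tw hL).1 hy).2 hyr
      simpa [rightPr_apply] using this
    · have hyr := ((mem_tw_inl_conj hL').1 hy').2
      have hyl := ((mem_tw hL).1 hy).2
      have hσ := hone o _ (fix_of_mem_tw hil hjl hL hL' (hfix2 o) hy hy')
      change (x.right, y.right) ∈ L at hyl
      rw [hσ] at hyl hyr
      have := hθ₀ _ _ hyl hyr
      simpa [rightPr_apply, hσ] using this
  · intro s
    obtain ⟨t, ht, x, y, y', z, hy, hy', rfl⟩ := hcos s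
    rcases ht with rfl | ⟨o, rfl⟩
    · by_cases hk' : ok
      · exact .inr ⟨.inl ⟨hk'⟩, x, y, y', z, hy, hy', rfl⟩
      · left
        rw [map_one, tev_mul _ _ hy hy', htev hk', map_zero, smul_zero]
    · exact .inr ⟨.inr o, x, y, y', z, hy, hy', rfl⟩
  · intro s s' x y y' z hy hy' heq
    obtain ⟨⟨a, -, ha⟩, -⟩ := (mem_tw hL).1 hy
    obtain ⟨⟨b, hb, -⟩, -⟩ := (mem_tw hL').1 hy'
    have ha' : y.left ∈ level D p l := ha ▸ level_mono hil a.2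
    have hb' : y'.left ∈ level D p l := hb ▸ level_mono hjl (β b).2
    have hb'' : (y.right : MulAut D) y'.left ∈ level D p l :=
      (resTop p l (y.right : E).1 ⟨y'.left, hb'⟩).2
    have h1 : h.dcRep ok s = (y.right : MulAut D) (h.dcRep ok s')
        * (y.left * (y.right : MulAut D) y'.left) := by
      have := congrArg SemidirectProduct.left heq
      simp only [SemidirectProduct.mul_left, SemidirectProduct.mul_right,
        SemidirectProduct.left_inl, SemidirectProduct.right_inl, mul_one,
        Subgroup.subtype_apply] at this
      rw [this, mul_comm y.left, mul_assoc]
    have h2 := mul_mem ha' hb''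
    rcases s with s | o <;> rcases s' with s' | o'
    · exact congrArg Sum.inl (Subsingleton.elim _ _)
    · exfalso
      have h3 : (y.right : MulAut D) (h.rep o') ∈ level D p l := by
        have h3 : 1 = (y.right : MulAut D) (h.rep o') * _ := h1
        rw [eq_inv_of_mul_eq_one_left h3.symm]
        exact inv_mem h2
      have h4 := (resTop p l (y.right⁻¹ : E).1 ⟨_, h3⟩).2
      have h5 : (resTop p l (y.right⁻¹ : E).1 ⟨_, h3⟩ : D) = h.rep o' :=
        (y.right : MulAut D).symm_apply_apply _
      exact h.rep_notMem o' (h5 ▸ h4)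
    · exfalso
      have h3 : h.rep o = (y.right : MulAut D) 1 * _ := h1
      rw [map_one, one_mul] at h3
      exact h.rep_notMem o (h3 ▸ h2)
    · exact congrArg Sum.inr (h.rep_inj (ρ := y.right) h2 h1)
  · intro s
    let A : Subgroup (SD E) := (tw α L).comap (MonoidHom.inr _ _) ⊓ ((tw β L').comap
      (MonoidHom.inl _ _)).comap
        (MulAut.conj (SemidirectProduct.inl (h.dcRep ok s))⁻¹).toMonoidHom
    have hA := h.card_ne_zero (F := F) hL A fun y hy => hy.1
    rwa [Nat.card_congr (Equiv.subtypeEquivRight fun y => ?_)] at hA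
    have h1 : (SemidirectProduct.inl (h.dcRep ok s))⁻¹ * y * (SemidirectProduct.inl (h.dcRep ok s))
        = MulAut.conj (SemidirectProduct.inl (h.dcRep ok s) : SD E)⁻¹ y := by
      rw [MulAut.conj_apply, inv_inv]
    rw [h1]
    rfl

end CoprimeAction

end Tensor

/-! ### The modules `P_{λ,μ}` and `M_{i,α,λ}` and their products -/

section Identification

variable {F : Type u} [Field F]

lemma indChar_iso_mono {Γ H : Type v} [Group Γ] [Finite Γ] [Group H] {φ : H →* Γ}
    (Θ : Γ →* Fˣ) : (indChar φ (Θ.comp φ)).Iso (monoRep φ.range Θ) := by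
  classical
  let σ := charRep (Θ.comp φ)
  have hact : ∀ (x g : Γ) (a : F), (indChar φ (Θ.comp φ)).ρ x (Representation.IndV.mk φ σ g a)
      = Representation.IndV.mk φ σ (g * x⁻¹) a := fun x g a => Representation.ind_mk φ σ x g a
  let B : (indChar φ (Θ.comp φ)).V →ₗ[F] F := indLift φ σ
    (fun g => if g ∈ φ.range then (Θ g : F)⁻¹ • LinearMap.id else 0) fun h g => by
      refine LinearMap.ext fun a => ?_
      have hiff : φ h * g ∈ φ.range ↔ g ∈ φ.range :=
        Subgroup.mul_mem_cancel_left _ (MonoidHom.mem_range.2 ⟨h, rfl⟩)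
      have h2 : (Θ (φ h) : F) ≠ 0 := (Θ (φ h)).ne_zero
      have h3 : (Θ g : F) ≠ 0 := (Θ g).ne_zero
      by_cases hg : g ∈ φ.range
      · rw [if_pos hg, if_pos (hiff.2 hg)]
        simp only [LinearMap.comp_apply, LinearMap.smul_apply, LinearMap.id_apply, σ,
          charRep_apply, MonoidHom.comp_apply, map_mul, Units.val_mul, smul_eq_mul]
        field_simp
      · rw [if_neg hg, if_neg (hiff.not.2 hg)]
        rfl
  have hB : ∀ g, B (Representation.IndV.mk φ σ g 1)
      = if g ∈ φ.range then (Θ g : F)⁻¹ else 0 := fun g => by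
    refine (indLift_mk φ σ _ _ g 1).trans ?_
    split_ifs <;> simp
  refine iso_mono _ _ Θ (Representation.IndV.mk φ σ 1 1) B ?_ (fun U hU => ?_) (fun g hg => ?_) ?_
  · rintro _ ⟨x, rfl⟩
    have h1 := indV_mk_mul φ σ x⁻¹ 1 (Θ (φ x) : F)
    rw [hact, one_mul, ← map_inv]
    have hσ : σ x⁻¹ (Θ (φ x) : F) = 1 := by
      rw [charRep_apply, MonoidHom.comp_apply, map_inv, map_inv, Units.inv_mul]
    rw [mul_one, hσ] at h1
    have h2 := (Representation.IndV.mk φ σ 1).map_smul (Θ (φ x) : F) 1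
    rw [smul_eq_mul, mul_one] at h2
    exact h1.trans h2
  · have h0 : U.mkQ = 0 := Representation.IndV.hom_ext φ σ fun g => LinearMap.ext_ring (by
      have := hU g⁻¹
      rw [hact, one_mul, inv_inv] at this
      exact (Submodule.Quotient.mk_eq_zero U).2 this)
    rw [← U.ker_mkQ, h0, LinearMap.ker_zero]
  · rw [hact, one_mul, hB, if_neg (by rwa [inv_mem_iff])]
  · rw [hB, if_pos (one_mem _), map_one]
    simp

lemma outerTensor_congr {Γ H : Type v} [Group Γ] [Group H] {M M' : FinRep F Γ} {N N' : FinRep F H}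
    (h : M.Iso M') (h' : N.Iso N') : (outerTensor M N).Iso (outerTensor M' N') := by
  obtain ⟨e⟩ := h
  obtain ⟨e'⟩ := h'
  refine ⟨.mk (TensorProduct.congr e.toLinearEquiv e'.toLinearEquiv) fun x => ?_⟩
  refine TensorProduct.ext' fun m n => ?_
  change (e.toLinearMap (M.ρ x.1 m)) ⊗ₜ[F] (e'.toLinearMap (N.ρ x.2 n)) = _
  rw [map_act, map_act]
  rfl

/-- The outer tensor product of two induced modules is induced from the product subgroup. -/
lemma outerTensor_mono {Γ H : Type v} [Group Γ] [Group H] [Finite Γ] [Finite H]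
    (A : Subgroup Γ) (B : Subgroup H) (Θ : Γ →* Fˣ) (Θ' : H →* Fˣ) :
    (outerTensor (monoRep A Θ) (monoRep B Θ')).Iso (monoRep (A.prod B)
      (Θ.comp (MonoidHom.fst Γ H) * Θ'.comp (MonoidHom.snd Γ H))) := by
  have hact : ∀ (x : Γ × H) (m : (monoRep A Θ).V) (n : (monoRep B Θ').V),
      (outerTensor (monoRep A Θ) (monoRep B Θ')).ρ x (m ⊗ₜ[F] n)
        = ((monoRep A Θ).ρ x.1 m) ⊗ₜ[F] ((monoRep B Θ').ρ x.2 n) := fun _ _ _ => rfl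
  let δ : (outerTensor (monoRep A Θ) (monoRep B Θ')).V →ₗ[F] F :=
    LinearMap.mul' F F ∘ₗ TensorProduct.map (monoDelta A Θ) (monoDelta B Θ')
  have hδ : ∀ (m : (monoRep A Θ).V) (n : (monoRep B Θ').V),
      δ (m ⊗ₜ[F] n) = monoDelta A Θ m * monoDelta B Θ' n := fun _ _ => rfl
  refine iso_mono _ _ _ (ev A Θ 1 ⊗ₜ[F] ev B Θ' 1) δ ?_ (fun U hU => ?_) ?_ ?_
  · rintro ⟨x, y⟩ ⟨hx, hy⟩
    rw [hact, act_ev_of_mem Θ hx, act_ev_of_mem Θ' hy, TensorProduct.smul_tmul_smul]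
    rfl
  · have h0 : U.mkQ = 0 := TensorProduct.ext (mono_hom_ext fun x => mono_hom_ext fun y => by
      have := hU (x, y)
      rw [hact, act_ev_one, act_ev_one] at this
      exact (Submodule.Quotient.mk_eq_zero U).2 this)
    rw [← U.ker_mkQ, h0, LinearMap.ker_zero]
  · rintro ⟨x, y⟩ hxy
    rw [hact, hδ, act_ev_one, act_ev_one]
    by_cases hx : x ∈ A
    · rw [monoDelta_of_notMem (H := B) Θ' fun hy => hxy ⟨hx, hy⟩, mul_zero]
    · rw [monoDelta_of_notMem Θ hx, zero_mul]
  · rw [hδ, monoDelta_of_mem Θ (one_mem A), monoDelta_of_mem Θ' (one_mem B), map_one, map_one]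
    simp

variable {D : Type v} [CommGroup D] [IsCyclic D] [Finite D] {E : Subgroup (MulAut D)} {p i : ℕ}

/-- The linear character `(ρ, σ) ↦ λ(ρ) μ(σ)⁻¹` of `E × E`. -/
def biChar (lam mu : E →* Fˣ) : E × E →* Fˣ :=
  lam.comp (MonoidHom.fst E E) * (mu⁻¹).comp (MonoidHom.snd E E)

omit [IsCyclic D] [Finite D] in
lemma biChar_apply (lam mu : E →* Fˣ) (l : E × E) : biChar lam mu l = lam l.1 * (mu l.2)⁻¹ := rfl

omit [IsCyclic D] [Finite D] in
lemma biChar_inj {lam mu lam' mu' : E →* Fˣ} (h : ∀ l, biChar lam mu l = biChar lam' mu' l) :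
    lam = lam' ∧ mu = mu' := by
  constructor
  · ext ρ
    have := h (ρ, 1)
    simp only [biChar_apply, map_one, inv_one, mul_one] at this
    rw [this]
  · ext ρ
    have := h (1, ρ)
    simp only [biChar_apply, map_one, one_mul, inv_inj] at this
    rw [this]

omit [IsCyclic D] [Finite D] in
lemma exists_eq_biChar (θ : E × E →* Fˣ) : ∃ lam mu : E →* Fˣ, θ = biChar lam mu := by
  refine ⟨θ.comp (MonoidHom.inl E E), (θ.comp (MonoidHom.inr E E))⁻¹, MonoidHom.ext fun l => ?_⟩
  rw [biChar_apply, MonoidHom.inv_apply, inv_inv, MonoidHom.comp_apply, MonoidHom.comp_apply,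
    ← map_mul]
  simp

lemma projOne_iso (lam : E →* Fˣ) : (projOne lam).Iso (monoRep
    (SemidirectProduct.inr : E →* SD E).range (lam.comp SemidirectProduct.rightHom)) :=
  indChar_iso_mono (φ := (SemidirectProduct.inr : E →* SD E))
    (lam.comp SemidirectProduct.rightHom)

/-- The module `P_{λ,μ}` is the case `i = 0`, with the trivial twist. -/
lemma projBi_iso (p : ℕ) (lam mu : E →* Fˣ) :
    (projBi lam mu).Iso (src (1 : MulAut (level D p 0)) (biChar lam mu)) := by
  refine (outerTensor_congr (projOne_iso lam) (projOne_iso mu⁻¹)).trans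
    ((outerTensor_mono _ _ _ _).trans ?_)
  have hH : (SemidirectProduct.inr : E →* SD E).range.prod (SemidirectProduct.inr : E →* SD E).range
      = tw (1 : MulAut (level D p 0)) (stab E p 0) := by
    ext ⟨x, y⟩
    rw [mem_tw le_rfl, Subgroup.mem_prod]
    constructor
    · rintro ⟨⟨ρ, rfl⟩, ⟨σ, rfl⟩⟩
      exact ⟨⟨1, rfl, rfl⟩, by rw [stab_zero]; trivial⟩
    · rintro ⟨⟨a, ha1, ha2⟩, -⟩
      rw [Subsingleton.elim a 1, map_one] at ha1
      rw [Subsingleton.elim a 1] at ha2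
      exact ⟨⟨x.right, SemidirectProduct.ext ha1.symm rfl⟩,
        ⟨y.right, SemidirectProduct.ext ha2.symm rfl⟩⟩
  rw [hH]
  exact .refl _

namespace CoprimeAction

variable {n : ℕ} [hp : Fact p.Prime] (h : CoprimeAction p n E)

include h

lemma tw_stab (hi : 1 ≤ i) (α : MulAut (level D p i)) : tw α (stab E p i) = diagE E α := by
  ext ⟨x, y⟩
  rw [mem_tw le_rfl]
  constructor
  · rintro ⟨⟨a, ha1, ha2⟩, hst⟩
    exact ⟨a, x.right, Prod.ext (SemidirectProduct.ext ha1 rfl)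
      (SemidirectProduct.ext ha2 ((h.mem_stab_iff hi).1 hst).symm)⟩
  · rintro ⟨a, ρ, heq⟩
    rw [Prod.ext_iff] at heq
    obtain ⟨rfl, rfl⟩ := heq
    exact ⟨⟨a, rfl, rfl⟩, (h.mem_stab_iff hi).2 rfl⟩

/-- The module `M_{i,α,λ}` is the case `i ≥ 1`, where the relevant pairs in `E × E` are diagonal. -/
lemma trivSrc_eq (hi : 1 ≤ i) (α : MulAut (level D p i)) (lam : E →* Fˣ) :
    trivSrc α lam = src α (lam.comp (MonoidHom.fst E E)) := by
  rw [src, twRep, h.tw_stab hi, monoRep_eq]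
  rfl

lemma src_iso_trivSrc [CharP F p] (hi : 1 ≤ i) (α : MulAut (level D p i)) (θ : E × E →* Fˣ) :
    (src α θ).Iso (trivSrc α (θ.comp ((MonoidHom.id E).prod (MonoidHom.id E)))) := by
  rw [h.trivSrc_eq hi]
  refine mono_congr_char fun x hx => ?_
  have h1 := (h.mem_stab_iff hi).1 hx.2
  rw [MonoidHom.comp_apply, MonoidHom.comp_apply]
  refine congrArg θ (Prod.ext rfl h1.symm)

omit hp in
lemma regular_iso [Fact p.Prime] :
    (regular F (SD E)).Iso (src (1 : MulAut (level D p n)) (1 : E × E →* Fˣ)) := by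
  classical
  have hmem : ∀ g : SD E × SD E, g ∈ tw (1 : MulAut (level D p n)) (stab E p n) ↔ g.1 = g.2 := by
    intro g
    rw [mem_tw le_rfl, h.mem_stab_iff h.pos]
    constructor
    · rintro ⟨⟨a, h1, h2⟩, h3⟩
      exact SemidirectProduct.ext (h1.trans h2.symm) h3
    · intro hg
      exact ⟨⟨⟨g.2.left, h.mem_level_top _⟩, by rw [hg]; rfl, rfl⟩, by rw [hg]⟩
  have hB := fun y => rlift_rsingle (F := F) (fun y : SD E => if y = 1 then (1 : F) else 0) y
  refine iso_mono _ _ _ (rsingle F 1) (rlift fun y => if y = 1 then 1 else 0) (fun g hg => ?_)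
    (fun U hU => ?_) (fun g hg => ?_) ?_
  · rw [regular_act, mul_one, (hmem g).1 hg, mul_inv_cancel, MonoidHom.one_comp]
    simp
  · have h0 : U.mkQ = 0 := regular_hom_ext fun y => by
      have := hU (y, 1)
      rw [regular_act, mul_one, inv_one, mul_one] at this
      exact (Submodule.Quotient.mk_eq_zero U).2 this
    rw [← U.ker_mkQ, h0, LinearMap.ker_zero]
  · rw [regular_act, hB, mul_one, if_neg fun h1 => hg ((hmem g).2 (mul_inv_eq_one.1 h1))]
  · rw [hB, if_pos rfl]
    exact one_ne_zero

end CoprimeAction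

end Identification

section Products

variable {F : Type u} [Field F] {p n i j : ℕ} [hp : Fact p.Prime] [CharP F p]
variable {D : Type v} [CommGroup D] [IsCyclic D] [Finite D] {E : Subgroup (MulAut D)}

lemma mem_stab_zero (l : E × E) : l ∈ stab E p 0 := by
  rw [stab_zero]
  trivial

lemma cls_projBi (lam mu : E →* Fˣ) : (cls (projBi lam mu) : BimodRing F (SD E))
    = cls (src (1 : MulAut (level D p 0)) (biChar lam mu)) :=
  cls_congr (projBi_iso p lam mu)

namespace CoprimeAction

variable (h : CoprimeAction p n E)

include h

/-- The module induced from the first factor `E` of `E × E`. -/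
lemma cls_twRep_left (γ : MulAut (level D p 0)) (lam : E →* Fˣ) :
    (cls (twRep γ ((⊤ : Subgroup E).prod ⊥) (lam.comp (MonoidHom.fst E E))) : BimodRing F (SD E))
      = ∑ ν : E →* Fˣ, cls (projBi lam ν) := by
  obtain rfl : γ = 1 := Subsingleton.elim _ _
  obtain ⟨b⟩ := h.exists_biproduct_tw (1 : MulAut (level D p 0)) (L₀ := (⊤ : Subgroup E).prod ⊥)
    (L₁ := stab E p 0) le_rfl (MonoidHom.inr E E) (MonoidHom.snd E E) (fun _ => rfl)
    (fun _ => mem_stab_zero _) (fun l hl => ⟨mem_stab_zero _, hl.2⟩)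
    (fun l _ => ⟨trivial, by simp⟩) (lam.comp (MonoidHom.fst E E))
  rw [b.cls_eq]
  refine Fintype.sum_equiv (Equiv.inv _) _ _ fun ν => ?_
  rw [cls_projBi (p := p)]
  refine cls_congr (mono_congr_char fun x _ => ?_)
  simp [biChar_apply, mul_comm]

/-- The module induced from the second factor `E` of `E × E`. -/
lemma cls_twRep_right (γ : MulAut (level D p 0)) (mu : E →* Fˣ) :
    (cls (twRep γ ((⊥ : Subgroup E).prod ⊤) ((mu⁻¹).comp (MonoidHom.snd E E))) :
      BimodRing F (SD E)) = ∑ ν : E →* Fˣ, cls (projBi ν mu) := by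
  obtain rfl : γ = 1 := Subsingleton.elim _ _
  obtain ⟨b⟩ := h.exists_biproduct_tw (1 : MulAut (level D p 0)) (L₀ := (⊥ : Subgroup E).prod ⊤)
    (L₁ := stab E p 0) le_rfl (MonoidHom.inl E E) (MonoidHom.fst E E) (fun _ => rfl)
    (fun _ => mem_stab_zero _) (fun l hl => ⟨mem_stab_zero _, hl.1⟩)
    (fun l _ => ⟨by simp, trivial⟩) ((mu⁻¹).comp (MonoidHom.snd E E))
  rw [b.cls_eq]
  refine Finset.sum_congr rfl fun ν _ => ?_
  rw [cls_projBi (p := p)]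
  refine cls_congr (mono_congr_char fun x _ => ?_)
  simp [biChar_apply]

/-- The module induced from the trivial module of the twisted diagonal subgroup itself. -/
lemma cls_twRep_bot (hi : 1 ≤ i) (α : MulAut (level D p i)) :
    (cls (twRep α ⊥ 1) : BimodRing F (SD E)) = ∑ ν : E →* Fˣ, cls (trivSrc α ν) := by
  obtain ⟨b⟩ := h.exists_biproduct_tw α (L₀ := ⊥)
    (L₁ := stab E p i) le_rfl ((MonoidHom.id E).prod (MonoidHom.id E)) (MonoidHom.fst E E)
    (fun _ => rfl) (fun _ => (h.mem_stab_iff hi).2 rfl)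
    (fun l hl => by rw [Subgroup.mem_bot.1 hl]; exact ⟨one_mem _, rfl⟩)
    (fun l hl => Prod.ext (by simp) (by
      have := (h.mem_stab_iff hi).1 hl
      simp [this])) (1 : E × E →* Fˣ)
  rw [b.cls_eq]
  refine Finset.sum_congr rfl fun ν _ => ?_
  rw [h.trivSrc_eq hi]
  refine cls_congr (mono_congr_char fun x _ => ?_)
  simp

/-- The trivial double coset contributes only for `μ = λ'`, as otherwise an element of `E` acts on the
corresponding generator of the tensor product by a nontrivial scalar. -/
theorem projBi_mul_projBi (lam mu lam' mu' : E →* Fˣ) :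
    (cls (projBi lam mu) : BimodRing F (SD E)) * cls (projBi lam' mu')
      = (if mu = lam' then cls (projBi lam mu') else 0)
        + Fintype.card (h.Orbits 0) • cls (projBi lam mu') := by
  have := h.cls_twRep_mul (F := F) (α := (1 : MulAut (level D p 0)))
    (β := (1 : MulAut (level D p 0))) (L := stab E p 0) (L' := stab E p 0) le_rfl le_rfl (.inl rfl)
    le_rfl le_rfl (.inl rfl) le_rfl le_rfl (L₁ := stab E p 0) (L₀ := stab E p 0)
    (fun _ => ⟨1, mem_stab_zero _⟩) (fun _ => ⟨1, mem_stab_zero _⟩)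
    (fun _ _ => ⟨fun _ => ⟨1, mem_stab_zero _, mem_stab_zero _⟩, fun _ => mem_stab_zero _⟩)
    (fun _ _ => ⟨fun _ => ⟨mem_stab_zero _, mem_stab_zero _⟩, fun _ => mem_stab_zero _⟩)
    (θ := biChar lam mu) (θ' := biChar lam' mu') (θ₁ := biChar lam mu') (θ₀ := biChar lam mu')
    (mu = lam') (by
      rintro rfl ρ σ τ - -
      simp [biChar_apply]) (fun hne => by
      by_contra! hall
      apply hne
      ext σ
      have := hall σ (mem_stab_zero _) (mem_stab_zero _)
      simp only [biChar_apply, map_one, one_mul, inv_one, mul_one] at this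
      rw [inv_mul_eq_one.1 this]) (fun ρ τ _ _ => by simp [biChar_apply])
  rw [Subsingleton.elim (res le_rfl (1 : MulAut (level D p 0)) * res le_rfl 1) 1] at this
  rw [cls_projBi (p := p), cls_projBi (p := p), cls_projBi (p := p)]
  exact this

theorem projBi_mul_trivSrc (lam mu mu' : E →* Fˣ) (hj : 1 ≤ j) (β : MulAut (level D p j)) :
    (cls (projBi lam mu) : BimodRing F (SD E)) * cls (trivSrc β mu')
      = cls (projBi lam (mu * mu'⁻¹))
        + ∑ ν : E →* Fˣ, Fintype.card (h.Orbits j) • cls (projBi lam ν) := by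
  have := h.cls_twRep_mul (F := F) (α := (1 : MulAut (level D p 0))) (β := β)
    (L := stab E p 0) (L' := stab E p j) le_rfl j.zero_le (.inl rfl)
    le_rfl le_rfl (.inr rfl) j.zero_le le_rfl (L₁ := stab E p 0) (L₀ := (⊤ : Subgroup E).prod ⊥)
    (fun _ => ⟨1, mem_stab_zero _⟩) (fun σ => ⟨σ, (h.mem_stab_iff hj).2 rfl⟩)
    (fun _ τ => ⟨fun _ => ⟨τ, mem_stab_zero _, (h.mem_stab_iff hj).2 rfl⟩,
      fun _ => mem_stab_zero _⟩)
    (fun _ τ => ⟨fun hτ => ⟨mem_stab_zero _, (h.mem_stab_iff hj).2 (Eq.symm hτ.2)⟩,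
      fun hτ => ⟨trivial, ((h.mem_stab_iff hj).1 hτ.2).symm⟩⟩)
    (θ := biChar lam mu) (θ' := mu'.comp (MonoidHom.fst E E))
    (θ₁ := biChar lam (mu * mu'⁻¹)) (θ₀ := lam.comp (MonoidHom.fst E E))
    True (fun _ ρ σ τ _ hστ => by
      obtain rfl : σ = τ := (h.mem_stab_iff hj).1 hστ
      simp [biChar_apply, mul_comm, mul_left_comm]) (fun hne => absurd trivial hne)
    (fun ρ τ _ _ => by simp [biChar_apply])
  rw [if_pos trivial, h.cls_twRep_left, Finset.smul_sum,
    Subsingleton.elim (res le_rfl (1 : MulAut (level D p 0)) * res j.zero_le β) 1] at this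
  rw [cls_projBi (p := p), cls_projBi (p := p), h.trivSrc_eq hj]
  exact this

theorem trivSrc_mul_projBi (lam lam' mu' : E →* Fˣ) (hi : 1 ≤ i) (α : MulAut (level D p i)) :
    (cls (trivSrc α lam) : BimodRing F (SD E)) * cls (projBi lam' mu')
      = cls (projBi (lam * lam') mu')
        + ∑ ν : E →* Fˣ, Fintype.card (h.Orbits i) • cls (projBi ν mu') := by
  have := h.cls_twRep_mul (F := F) (α := α) (β := (1 : MulAut (level D p 0)))
    (L := stab E p i) (L' := stab E p 0) i.zero_le le_rfl (.inr rfl)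
    le_rfl le_rfl (.inl rfl) le_rfl i.zero_le (L₁ := stab E p 0) (L₀ := (⊥ : Subgroup E).prod ⊤)
    (fun σ => ⟨σ, (h.mem_stab_iff hi).2 rfl⟩) (fun _ => ⟨1, mem_stab_zero _⟩)
    (fun ρ _ => ⟨fun _ => ⟨ρ, (h.mem_stab_iff hi).2 rfl, mem_stab_zero _⟩,
      fun _ => mem_stab_zero _⟩)
    (fun ρ _ => ⟨fun hρ => ⟨(h.mem_stab_iff hi).2 hρ.1, mem_stab_zero _⟩,
      fun hρ => ⟨(h.mem_stab_iff hi).1 hρ.1, trivial⟩⟩)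
    (θ := lam.comp (MonoidHom.fst E E)) (θ' := biChar lam' mu')
    (θ₁ := biChar (lam * lam') mu') (θ₀ := (mu'⁻¹).comp (MonoidHom.snd E E))
    True (fun _ ρ σ τ hρσ _ => by
      obtain rfl : ρ = σ := (h.mem_stab_iff hi).1 hρσ
      simp [biChar_apply, mul_assoc]) (fun hne => absurd trivial hne)
    (fun ρ τ hρ _ => by
      obtain rfl : ρ = 1 := (h.mem_stab_iff hi).1 hρ
      simp [biChar_apply])
  rw [if_pos trivial, h.cls_twRep_right, Finset.smul_sum,
    Subsingleton.elim (res i.zero_le α * res le_rfl (1 : MulAut (level D p 0))) 1] at this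
  rw [cls_projBi (p := p), cls_projBi (p := p), h.trivSrc_eq hi]
  exact this

/-- Here `k` and `l` are the minimum and the maximum of `i` and `j`. -/
theorem trivSrc_mul_trivSrc {k l : ℕ} (hki : k ≤ i) (hkj : k ≤ j) (hk : k = i ∨ k = j)
    (hil : i ≤ l) (hjl : j ≤ l) (hl : l = i ∨ l = j) (lam mu : E →* Fˣ) (hk1 : 1 ≤ k)
    (α : MulAut (level D p i)) (β : MulAut (level D p j)) :
    (cls (trivSrc α lam) : BimodRing F (SD E)) * cls (trivSrc β mu)
      = cls (trivSrc (res hki α * res hkj β) (lam * mu))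
        + ∑ ν : E →* Fˣ, Fintype.card (h.Orbits l) •
            cls (trivSrc (res hki α * res hkj β) ν) := by
  have hi : 1 ≤ i := hk1.trans hki
  have hj : 1 ≤ j := hk1.trans hkj
  have := h.cls_twRep_mul (F := F) (α := α) (β := β) (L := stab E p i) (L' := stab E p j)
    hki hkj hk le_rfl le_rfl hl hil hjl (L₁ := stab E p k) (L₀ := ⊥)
    (fun σ => ⟨σ, (h.mem_stab_iff hi).2 rfl⟩) (fun σ => ⟨σ, (h.mem_stab_iff hj).2 rfl⟩)
    (fun ρ τ => by
      rw [h.mem_stab_iff hk1]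
      constructor
      · rintro (rfl : ρ = τ)
        exact ⟨ρ, (h.mem_stab_iff hi).2 rfl, (h.mem_stab_iff hj).2 rfl⟩
      · rintro ⟨σ, h1, h2⟩
        exact ((h.mem_stab_iff hi).1 h1).trans ((h.mem_stab_iff hj).1 h2))
    (fun ρ τ => by
      rw [h.mem_stab_iff hi, h.mem_stab_iff hj, Subgroup.mem_bot, Prod.ext_iff]
      exact and_congr_right fun _ => eq_comm)
    (θ := lam.comp (MonoidHom.fst E E)) (θ' := mu.comp (MonoidHom.fst E E))
    (θ₁ := (lam * mu).comp (MonoidHom.fst E E)) (θ₀ := 1)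
    True (fun _ ρ σ τ hρσ _ => by
      obtain rfl : ρ = σ := (h.mem_stab_iff hi).1 hρσ
      simp) (fun hne => absurd trivial hne)
    (fun ρ τ hρ _ => by
      obtain rfl : ρ = 1 := (h.mem_stab_iff hi).1 hρ
      simp)
  rw [if_pos trivial, h.cls_twRep_bot hk1, Finset.smul_sum] at this
  rw [h.trivSrc_eq hi, h.trivSrc_eq hj, h.trivSrc_eq hk1]
  exact this

lemma cls_trivSrc_one : (cls (trivSrc (1 : MulAut (level D p n)) (1 : E →* Fˣ)) :
    BimodRing F (SD E)) = 1 := by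
  rw [h.trivSrc_eq h.pos, MonoidHom.one_comp, ← cls_congr h.regular_iso, cls_regular]

end CoprimeAction

end Products

/-! ### Rings spanned by a linearly independent family -/

section Abstract

/-- A biadditive map sends two subgroups into a third one as soon as it does so on generators. -/
lemma map₂_mem_of_closure {R T : Type*} [AddCommGroup R] [AddCommGroup T] (f : R →+ R →+ T)
    {s t : Set R} {A : AddSubgroup T} (h : ∀ a ∈ s, ∀ b ∈ t, f a b ∈ A) {x y : R}
    (hx : x ∈ AddSubgroup.closure s) (hy : y ∈ AddSubgroup.closure t) : f x y ∈ A := by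
  have h1 : ∀ a ∈ s, f a y ∈ A := fun a ha =>
    (AddSubgroup.closure_le (A.comap (f a))).2 (fun b hb => h a ha b hb) hy
  exact (AddSubgroup.closure_le (A.comap (f.flip y))).2 h1 hx

lemma mul_mem_of_closure {R : Type*} [Ring R] {s t : Set R} {A : AddSubgroup R}
    (h : ∀ a ∈ s, ∀ b ∈ t, a * b ∈ A) {x y : R} (hx : x ∈ AddSubgroup.closure s)
    (hy : y ∈ AddSubgroup.closure t) : x * y ∈ A :=
  map₂_mem_of_closure AddMonoidHom.mul h hx hy

/-- If a linearly independent family `f` in a ring multiplies like a `ℤ`-basis of `R`, then its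
span is a ring isomorphic to `R`. -/
theorem exists_ringEquiv_of_basis {T R κ : Type*} [Ring T] [NonUnitalRing R]
    (b : Module.Basis κ ℤ R) {f : κ → T} (hf : LinearIndependent ℤ f)
    (hmul : ∀ x y, b.constr ℤ f (b x * b y) = f x * f y) {A : AddSubgroup T}
    (hA : A = AddSubgroup.closure (Set.range f)) :
    ∃ S : NonUnitalSubring T, S.toAddSubgroup = A ∧
      ∃ e : S ≃+* R, ∀ x, ∃ h : f x ∈ S, e ⟨f x, h⟩ = b x := by
  subst hA
  let L := b.constr ℤ f
  have hL : ∀ x, L (b x) = f x := b.constr_basis ℤ f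
  have hLmul : (LinearMap.mul ℤ R).compr₂ L = (LinearMap.mul ℤ T).compl₁₂ L L :=
    b.ext fun x => b.ext fun y => by
      change L (b x * b y) = L (b x) * L (b y)
      rw [hL, hL]
      exact hmul x y
  let φ : R →ₙ+* T :=
    { L.toAddMonoidHom with map_mul' := fun x y => LinearMap.congr_fun₂ hLmul x y }
  have hinj : Function.Injective φ := fun x y hxy => b.repr.injective (hf (by
    have h1 : ∀ z, φ z = Finsupp.linearCombination ℤ f (b.repr z) := fun z => b.constr_apply ℤ f z
    rw [← h1, ← h1, hxy]))
  have hmem : ∀ x, x ∈ AddSubgroup.closure (Set.range f) ↔ ∃ r, φ r = x := fun x => by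
    have h1 : LinearMap.range L = Submodule.span ℤ (Set.range f) := b.constr_range (S := ℤ)
    rw [← Submodule.span_int_eq_addSubgroupClosure, Submodule.mem_toAddSubgroup, ← h1]
    rfl
  let S : NonUnitalSubring T :=
    { AddSubgroup.closure (Set.range f) with
      mul_mem' := fun {x y} hx hy => by
        obtain ⟨r, rfl⟩ := (hmem x).1 hx
        obtain ⟨s, rfl⟩ := (hmem y).1 hy
        exact (hmem _).2 ⟨r * s, map_mul φ r s⟩ }
  have hS : ∀ r, φ r ∈ S := fun r => (hmem _).2 ⟨r, rfl⟩
  let e : R ≃+* S := RingEquiv.ofBijective (NonUnitalRingHom.codRestrict φ S hS)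
    ⟨fun x y hxy => hinj (congrArg Subtype.val hxy), fun x => by
      obtain ⟨r, hr⟩ := (hmem x).1 x.2
      exact ⟨r, Subtype.ext hr⟩⟩
  refine ⟨S, rfl, e.symm, fun x => ?_⟩
  have hx : φ (b x) = f x := hL x
  refine ⟨hx ▸ hS _, e.symm_apply_eq.2 (Subtype.ext hx.symm)⟩

lemma exists_basis_of_closure {T κ : Type*} [AddCommGroup T] {f : κ → T}
    (hf : LinearIndependent ℤ f) {A : AddSubgroup T}
    (hA : A = AddSubgroup.closure (Set.range f)) :
    ∃ b : Module.Basis κ ℤ A, ∀ x, (b x : T) = f x := by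
  subst hA
  have hmem : ∀ x, x ∈ Submodule.span ℤ (Set.range f) ↔ x ∈ AddSubgroup.closure (Set.range f) :=
    fun x => by rw [← Submodule.span_int_eq_addSubgroupClosure, Submodule.mem_toAddSubgroup]
  let e : Submodule.span ℤ (Set.range f) ≃+ AddSubgroup.closure (Set.range f) :=
    { Equiv.subtypeEquivRight hmem with map_add' := fun _ _ => rfl }
  exact ⟨(Module.Basis.span hf).map e.toIntLinearEquiv, fun x =>
    congrArg Subtype.val (Module.Basis.span_apply hf x)⟩

section TwistedBasis

/-- A `ℤ`-basis of `R`, viewed as a basis of `R_c`. -/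
def twistedBasis {R κ : Type*} [Ring R] (c : R) (b : Module.Basis κ ℤ R) :
    Module.Basis κ ℤ (Twisted c) :=
  b.map (Twisted.of c).toIntLinearEquiv

lemma twistedBasis_apply {R κ : Type*} [Ring R] (c : R) (b : Module.Basis κ ℤ R) (x : κ) :
    twistedBasis c b x = Twisted.of c (b x) := b.map_apply _ _

lemma twistedBasis_constr {R T κ : Type*} [Ring R] [Ring T] (c : R) (b : Module.Basis κ ℤ R)
    (f : κ → T) (r : R) :
    (twistedBasis c b).constr ℤ f (Twisted.of c r) = b.constr ℤ f r := by
  rw [Module.Basis.constr_apply, Module.Basis.constr_apply]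
  rfl

variable {X : Type*} [Fintype X] [DecidableEq X]

lemma single_mul_starCartan_mul_single (m : ℤ) (a b c d : X) :
    Matrix.single a b (1 : ℤ) * starCartan X m * Matrix.single c d 1
      = (if b = c then Matrix.single a d 1 else 0) + m • Matrix.single a d 1 := by
  rw [Matrix.single_mul_mul_single]
  rw [one_mul, mul_one, starCartan, Matrix.add_apply, Matrix.one_apply, Matrix.smul_apply,
    Matrix.of_apply, smul_eq_mul, mul_one, Matrix.single_add, Matrix.smul_single, smul_eq_mul,
    mul_one]
  split_ifs <;> simp

lemma single_mul_twistElt_mul_single {Γ Y : Type*} [Group Γ] [CommGroup Y] [Fintype Y] (m : ℤ)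
    (x y : Γ × Y) :
    MonoidAlgebra.single x (1 : ℤ) * twistElt Γ Y m * MonoidAlgebra.single y 1
      = MonoidAlgebra.single (x * y) 1
        + m • ∑ ν : Y, MonoidAlgebra.single ((x * y).1, ν) 1 := by
  rw [twistElt, mul_add, mul_one, add_mul, MonoidAlgebra.single_mul_single, mul_one,
    mul_smul_comm, smul_mul_assoc, Finset.mul_sum, Finset.sum_mul]
  congr 2
  refine Fintype.sum_equiv ((Equiv.mulLeft x.2).trans (Equiv.mulRight y.2)) _ _ fun ν => ?_
  rw [MonoidAlgebra.single_mul_single, MonoidAlgebra.single_mul_single, mul_one, mul_one]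
  congr 1
  exact Prod.ext (by simp) rfl

end TwistedBasis

/-- A linearly independent family multiplying like the matrix units of `Mat_X(ℤ)_C`, where `C` has
entries `m + 1` on and `m` off the diagonal. -/
theorem exists_ringEquiv_matrix {T X : Type*} [Ring T] [Fintype X] [DecidableEq X] {f : X × X → T}
    (hf : LinearIndependent ℤ f) (m : ℕ)
    (hmul : ∀ a b c d, f (a, b) * f (c, d) = (if b = c then f (a, d) else 0) + m • f (a, d))
    {A : AddSubgroup T} (hA : A = AddSubgroup.closure (Set.range f)) :
    ∃ S : NonUnitalSubring T, S.toAddSubgroup = A ∧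
      ∃ e : S ≃+* Twisted (starCartan X m), ∀ x, ∃ h : f x ∈ S,
        e ⟨f x, h⟩ = Twisted.of _ (Matrix.single x.1 x.2 1) := by
  let b := Matrix.stdBasis ℤ X X
  have hb : ∀ i j, Matrix.single i j 1 = b (i, j) := fun i j =>
    (Matrix.stdBasis_eq_single ℤ i j).symm
  obtain ⟨S, hS, e, he⟩ := exists_ringEquiv_of_basis (twistedBasis (starCartan X m) b) hf
    (fun x y => by
      rw [twistedBasis_apply, twistedBasis_apply, Twisted.of_mul, twistedBasis_constr, ← hb, ← hb,
        single_mul_starCartan_mul_single, map_add, map_zsmul, hb, b.constr_basis, natCast_zsmul,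
        apply_ite (b.constr ℤ f), b.constr_basis, map_zero, ← hmul]) hA
  refine ⟨S, hS, e, fun x => ?_⟩
  obtain ⟨h, hx⟩ := he x
  exact ⟨h, hx.trans (by rw [twistedBasis_apply, hb])⟩

/-- A linearly independent family multiplying like the group elements in `ℤ[Γ × Y]_c`, where
`c = (1, 1) + m ∑_y (1, y)`. -/
theorem exists_ringEquiv_twistElt {T Γ Y : Type*} [Ring T] [Group Γ] [CommGroup Y] [Fintype Y]
    {f : Γ × Y → T} (hf : LinearIndependent ℤ f) (m : ℕ)
    (hmul : ∀ x y, f x * f y = f (x * y) + ∑ ν : Y, m • f ((x * y).1, ν))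
    {A : AddSubgroup T} (hA : A = AddSubgroup.closure (Set.range f)) :
    ∃ S : NonUnitalSubring T, S.toAddSubgroup = A ∧
      ∃ e : S ≃+* Twisted (twistElt Γ Y m), ∀ x, ∃ h : f x ∈ S,
        e ⟨f x, h⟩ = Twisted.of _ (MonoidAlgebra.single x 1) := by
  let b := MonoidAlgebra.basis (Γ × Y) ℤ
  have hb : ∀ x, MonoidAlgebra.single x 1 = b x := fun x => rfl
  obtain ⟨S, hS, e, he⟩ := exists_ringEquiv_of_basis (twistedBasis (twistElt Γ Y m) b) hf
    (fun x y => by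
      rw [twistedBasis_apply, twistedBasis_apply, Twisted.of_mul, twistedBasis_constr, ← hb, ← hb,
        single_mul_twistElt_mul_single, map_add, map_zsmul, map_sum, natCast_zsmul,
        Finset.smul_sum, hmul]
      simp only [hb, b.constr_basis]) hA
  refine ⟨S, hS, e, fun x => ?_⟩
  obtain ⟨h, hx⟩ := he x
  exact ⟨h, hx.trans (twistedBasis_apply _ b x)⟩

/-- A linearly independent family multiplying like the elements of a group `Γ`. -/
theorem exists_ringEquiv_monoidAlgebra {T Γ : Type*} [Ring T] [Group Γ]
    {f : Γ → T} (hf : LinearIndependent ℤ f) (hmul : ∀ x y, f x * f y = f (x * y))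
    {A : AddSubgroup T} (hA : A = AddSubgroup.closure (Set.range f)) :
    ∃ S : NonUnitalSubring T, S.toAddSubgroup = A ∧
      ∃ e : S ≃+* MonoidAlgebra ℤ Γ, ∀ x, ∃ h : f x ∈ S,
        e ⟨f x, h⟩ = MonoidAlgebra.single x 1 := by
  let b := MonoidAlgebra.basis Γ ℤ
  have hb : ∀ x, b x = MonoidAlgebra.single x 1 := fun x => rfl
  exact exists_ringEquiv_of_basis b hf (fun x y => by
    rw [hb, hb, MonoidAlgebra.single_mul_single, mul_one, ← hb, b.constr_basis, hmul]) hA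

end Abstract

/-! ### The trivial source ring of `F[D ⋊ E]` -/

section TrivialSourceRing

variable {F : Type u} [Field F] {p n i j : ℕ} [hp : Fact p.Prime] [CharP F p]
variable {D : Type v} [CommGroup D] [IsCyclic D] [Finite D] {E : Subgroup (MulAut D)}

lemma FinRep.Projective.congr {Γ : Type v} [Group Γ] {M N : FinRep F Γ} (hM : M.Projective)
    (hiso : M.Iso N) : N.Projective := by
  obtain ⟨e⟩ := hiso
  have : Module.Projective (MonoidAlgebra F Γ) M.ρ.asModule := hM
  exact Module.Projective.of_split
    (Representation.IntertwiningMap.equivLinearMapAsModule _ _ e.symm.toIntertwiningMap)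
    (Representation.IntertwiningMap.equivLinearMapAsModule _ _ e.toIntertwiningMap)
    (LinearMap.ext fun m => e.toLinearEquiv.apply_symm_apply m)

namespace CoprimeAction

variable (h : CoprimeAction p n E)

include h

section Classification

lemma projBi_indecomposable (lam mu : E →* Fˣ) :
    (projBi lam mu : FinRep F (SD E × SD E)).Indecomposable :=
  (h.src_indecomposable (F := F) _ _).congr (projBi_iso p lam mu).symm

lemma projBi_projective (lam mu : E →* Fˣ) :
    (projBi lam mu : FinRep F (SD E × SD E)).Projective :=
  (h.src_projective (F := F) _ _).congr (projBi_iso p lam mu).symm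

lemma exists_iso_projBi {M : FinRep F (SD E × SD E)} (hM : M.Indecomposable)
    (hproj : M.Projective) : ∃ lam mu : E →* Fˣ, M.Iso (projBi lam mu) := by
  obtain ⟨θ, hθ⟩ := h.exists_iso_src_of_projective hM hproj
  obtain ⟨lam, mu, rfl⟩ := exists_eq_biChar θ
  exact ⟨lam, mu, hθ.trans (projBi_iso p lam mu).symm⟩

lemma src_biChar_iso_iff (lam mu lam' mu' : E →* Fˣ) :
    (src (F := F) (1 : MulAut (level D p 0)) (biChar lam mu)).Iso
      (src (1 : MulAut (level D p 0)) (biChar lam' mu')) ↔ lam = lam' ∧ mu = mu' := by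
  rw [h.src_iso_iff]
  constructor
  · rintro ⟨-, hl⟩
    exact biChar_inj fun l => hl l (mem_stab_zero l)
  · rintro ⟨rfl, rfl⟩
    exact ⟨⟨1, one_mem E, Subsingleton.elim _ _⟩, fun _ _ => rfl⟩

lemma projBi_iso_iff (lam mu lam' mu' : E →* Fˣ) :
    (projBi lam mu : FinRep F (SD E × SD E)).Iso (projBi lam' mu') ↔ lam = lam' ∧ mu = mu' := by
  rw [← h.src_biChar_iso_iff]
  exact ⟨fun hiso => ((projBi_iso p lam mu).symm.trans hiso).trans (projBi_iso p lam' mu'),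
    fun hiso => ((projBi_iso p lam mu).trans hiso).trans (projBi_iso p lam' mu').symm⟩

lemma trivSrc_indecomposable (hi : 1 ≤ i) (α : MulAut (level D p i)) (lam : E →* Fˣ) :
    (trivSrc α lam : FinRep F (SD E × SD E)).Indecomposable := by
  rw [h.trivSrc_eq hi]
  exact h.src_indecomposable _ _

lemma trivSrc_pPermutation (hi : 1 ≤ i) (α : MulAut (level D p i)) (lam : E →* Fˣ) :
    (trivSrc α lam : FinRep F (SD E × SD E)).PPermutation p := by
  rw [h.trivSrc_eq hi]
  exact h.src_pPermutation _ _

lemma trivSrc_isVertex (hi : 1 ≤ i) (hin : i ≤ n) (α : MulAut (level D p i)) (lam : E →* Fˣ) :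
    (trivSrc α lam : FinRep F (SD E × SD E)).IsVertex (tw α ⊥) := by
  rw [h.trivSrc_eq hi]
  exact h.isVertex_of_iso_src hin (.refl _)

lemma index_eq_of_trivSrc_iso (hi : 1 ≤ i) (hin : i ≤ n) (hj : 1 ≤ j) (hjn : j ≤ n)
    {α : MulAut (level D p i)} {β : MulAut (level D p j)} {lam mu : E →* Fˣ}
    (hiso : (trivSrc α lam : FinRep F (SD E × SD E)).Iso (trivSrc β mu)) : i = j := by
  rw [h.trivSrc_eq hi, h.trivSrc_eq hj] at hiso
  exact h.src_iso_index hin hjn hiso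

lemma trivSrc_iso_iff (hi : 1 ≤ i) (α β : MulAut (level D p i)) (lam mu : E →* Fˣ) :
    (trivSrc α lam : FinRep F (SD E × SD E)).Iso (trivSrc β mu) ↔
      (∃ ρ ∈ E, α = β * resTop p i ρ) ∧ lam = mu := by
  rw [h.trivSrc_eq hi, h.trivSrc_eq hi, h.src_iso_iff]
  refine and_congr_right fun _ => ⟨fun hl => MonoidHom.ext fun ρ =>
    hl (ρ, ρ) ((h.mem_stab_iff hi).2 rfl), ?_⟩
  rintro rfl _ _
  rfl

/-- An indecomposable `p`-permutation module with a twisted diagonal vertex is a `P_{λ,μ}` or an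
`M_{i,α,λ}`, and its vertex determines which. -/
lemma classification {M : FinRep F (SD E × SD E)} (hM : M.Indecomposable)
    (hperm : M.PPermutation p) {X : Subgroup (SD E × SD E)} (hv : M.IsVertex X)
    (hX : IsTwistedDiagonal p X) :
    (X = tw (1 : MulAut (level D p 0)) ⊥ ∧ ∃ lam mu : E →* Fˣ, M.Iso (projBi lam mu)) ∨
    ∃ i, 1 ≤ i ∧ i ≤ n ∧ ∃ α : MulAut (level D p i), X = tw α ⊥ ∧
      ∃ lam : E →* Fˣ, M.Iso (trivSrc α lam) := by
  obtain ⟨k, hk, α, θ, hXα, hiso⟩ := h.exists_iso_src_of_isVertex hM hperm hX hv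
  rcases Nat.eq_zero_or_pos k with rfl | hpos
  · obtain rfl : α = 1 := Subsingleton.elim _ _
    obtain ⟨lam, mu, rfl⟩ := exists_eq_biChar θ
    exact .inl ⟨hXα, lam, mu, hiso.trans (projBi_iso p lam mu).symm⟩
  · exact .inr ⟨k, hpos, hk, α, hXα, _, hiso.trans (h.src_iso_trivSrc hpos α θ)⟩

lemma exists_iso_trivSrc {M : FinRep F (SD E × SD E)} (hM : M.Indecomposable)
    (hperm : M.PPermutation p) (hproj : ¬ M.Projective)
    (hX : ∃ X, M.IsVertex X ∧ IsTwistedDiagonal p X) :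
    ∃ i, 1 ≤ i ∧ i ≤ n ∧ ∃ (α : MulAut (level D p i)) (lam : E →* Fˣ), M.Iso (trivSrc α lam) := by
  obtain ⟨X, hv, hX⟩ := hX
  obtain ⟨-, lam, mu, hiso⟩ | ⟨i, hi, hin, α, -, lam, hiso⟩ := h.classification hM hperm hv hX
  · exact absurd ((h.projBi_projective lam mu).congr hiso.symm) hproj
  · exact ⟨i, hi, hin, α, lam, hiso⟩

end Classification

section Spans

lemma Pr_eq : Pr F (SD E)
    = AddSubgroup.closure (Set.range fun x : (E →* Fˣ) × (E →* Fˣ) => cls (projBi x.1 x.2)) := by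
  refine congrArg AddSubgroup.closure (Set.ext fun x => ⟨?_, ?_⟩)
  · rintro ⟨M, hM, hproj, rfl⟩
    obtain ⟨lam, mu, hiso⟩ := h.exists_iso_projBi hM hproj
    exact ⟨(lam, mu), cls_congr hiso.symm⟩
  · rintro ⟨x, rfl⟩
    exact ⟨_, h.projBi_indecomposable x.1 x.2, h.projBi_projective x.1 x.2, rfl⟩

lemma projBi_vertex (lam mu : E →* Fˣ) : (projBi lam mu : FinRep F (SD E × SD E)).PPermutation p ∧
    (projBi lam mu : FinRep F (SD E × SD E)).IsVertex (tw (1 : MulAut (level D p 0)) ⊥) :=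
  ⟨(h.src_pPermutation _ _).congr (projBi_iso p lam mu).symm,
    h.isVertex_of_iso_src n.zero_le (projBi_iso p lam mu)⟩

lemma TDelta_eq : TDelta F (SD E) p = AddSubgroup.closure
    ((Set.range fun x : (E →* Fˣ) × (E →* Fˣ) => cls (projBi x.1 x.2)) ∪
      {x | ∃ i, 1 ≤ i ∧ i ≤ n ∧ ∃ (α : MulAut (level D p i)) (lam : E →* Fˣ),
        x = cls (trivSrc α lam)}) := by
  refine congrArg AddSubgroup.closure (Set.ext fun x => ⟨?_, ?_⟩)
  · rintro ⟨M, hM, hperm, ⟨X, hv, hX⟩, rfl⟩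
    obtain ⟨-, lam, mu, hiso⟩ | ⟨i, hi, hin, α, -, lam, hiso⟩ := h.classification hM hperm hv hX
    · exact .inl ⟨(lam, mu), cls_congr hiso.symm⟩
    · exact .inr ⟨i, hi, hin, α, lam, cls_congr hiso⟩
  · rintro (⟨x, rfl⟩ | ⟨i, hi, hin, α, lam, rfl⟩)
    · obtain ⟨h1, h2⟩ := h.projBi_vertex x.1 x.2
      exact ⟨_, h.projBi_indecomposable x.1 x.2, h1, ⟨_, h2, h.isTwistedDiagonal_tw _⟩, rfl⟩
    · exact ⟨_, h.trivSrc_indecomposable hi α lam, h.trivSrc_pPermutation hi α lam,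
        ⟨_, h.trivSrc_isVertex hi hin α lam, h.isTwistedDiagonal_tw _⟩, rfl⟩

lemma card_tw_bot_eq (hin : i ≤ n) (α : MulAut (level D p i)) :
    Nat.card (tw (E := E) α ⊥) = p ^ i := by
  rw [card_tw_bot, h.card_level hin]

lemma TDeltaLevel_zero_eq : TDeltaLevel F (SD E) p 0 = Pr F (SD E) := by
  rw [h.Pr_eq]
  refine congrArg AddSubgroup.closure (Set.ext fun x => ⟨?_, ?_⟩)
  · rintro ⟨M, hM, hperm, ⟨X, hv, hX, hc⟩, rfl⟩
    obtain ⟨-, lam, mu, hiso⟩ | ⟨i, hi, hin, α, rfl, lam, hiso⟩ := h.classification hM hperm hv hX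
    · exact ⟨(lam, mu), cls_congr hiso.symm⟩
    · rw [h.card_tw_bot_eq hin] at hc
      exact absurd (Nat.pow_right_injective hp.out.two_le hc) (by omega)
  · rintro ⟨x, rfl⟩
    obtain ⟨h1, h2⟩ := h.projBi_vertex x.1 x.2
    exact ⟨_, h.projBi_indecomposable x.1 x.2, h1, ⟨_, h2, h.isTwistedDiagonal_tw _,
      h.card_tw_bot_eq n.zero_le _⟩, rfl⟩

end Spans

end CoprimeAction

/-- The classes `[M_{i,α,λ}]`, for a fixed `i`, indexed by the cosets `α π_i(E)` and by `λ`. -/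
def levelCls (F : Type u) [Field F] (E : Subgroup (MulAut D)) (p i : ℕ)
    (x : (MulAut (level D p i) ⧸ E.map (resTop p i)) × (E →* Fˣ)) : BimodRing F (SD E) :=
  cls (trivSrc x.1.out x.2)

namespace CoprimeAction

variable (h : CoprimeAction p n E)

include h

lemma levelCls_mk (hi : 1 ≤ i) (α : MulAut (level D p i)) (lam : E →* Fˣ) :
    levelCls F E p i (QuotientGroup.mk α, lam) = cls (trivSrc α lam) := by
  refine cls_congr ((h.trivSrc_iso_iff hi _ _ _ _).2 ⟨?_, rfl⟩)
  obtain ⟨⟨_, ρ, hρ, rfl⟩, hx⟩ := QuotientGroup.mk_out_eq_mul (E.map (resTop p i)) α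
  exact ⟨ρ, hρ, hx⟩

lemma levelCls_mul_levelCls (hi : 1 ≤ i)
    (x y : (MulAut (level D p i) ⧸ E.map (resTop p i)) × (E →* Fˣ)) :
    levelCls F E p i x * levelCls F E p i y = levelCls F E p i (x * y)
      + ∑ ν : E →* Fˣ, Fintype.card (h.Orbits i) • levelCls F E p i ((x * y).1, ν) := by
  obtain ⟨a, lam⟩ := x
  obtain ⟨b, mu⟩ := y
  obtain ⟨α, rfl⟩ := QuotientGroup.mk_surjective a
  obtain ⟨β, rfl⟩ := QuotientGroup.mk_surjective b
  simp only [Prod.mk_mul_mk, ← QuotientGroup.mk_mul, h.levelCls_mk hi]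
  exact h.trivSrc_mul_trivSrc le_rfl le_rfl (.inl rfl) le_rfl le_rfl (.inl rfl) lam mu hi α β

lemma TDeltaLevel_eq (hi : 1 ≤ i) (hin : i ≤ n) : TDeltaLevel F (SD E) p i
    = AddSubgroup.closure (Set.range (levelCls F E p i)) := by
  refine congrArg AddSubgroup.closure (Set.ext fun x => ⟨?_, ?_⟩)
  · rintro ⟨M, hM, hperm, ⟨X, hv, hX, hc⟩, rfl⟩
    obtain ⟨rfl, -⟩ | ⟨k, hk, hkn, α, rfl, lam, hiso⟩ := h.classification hM hperm hv hX
    · rw [h.card_tw_bot_eq n.zero_le] at hc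
      exact absurd (Nat.pow_right_injective hp.out.two_le hc) (by omega)
    · rw [h.card_tw_bot_eq hkn] at hc
      obtain rfl : k = i := Nat.pow_right_injective hp.out.two_le hc
      exact ⟨(QuotientGroup.mk α, lam), (h.levelCls_mk hk α lam).trans (cls_congr hiso.symm)⟩
  · rintro ⟨x, rfl⟩
    exact ⟨_, h.trivSrc_indecomposable hi _ _, h.trivSrc_pPermutation hi _ _,
      ⟨_, h.trivSrc_isVertex hi hin _ _, h.isTwistedDiagonal_tw _, h.card_tw_bot_eq hin _⟩, rfl⟩

end CoprimeAction

/-- The family of all `[P_{λ,μ}]` and `[M_{i,α,λ}]` with `1 ≤ i ≤ n`. -/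
def basisCls (F : Type u) [Field F] (E : Subgroup (MulAut D)) (p n : ℕ) :
    ((E →* Fˣ) × (E →* Fˣ)) ⊕ (Σ i : {i : ℕ // 1 ≤ i ∧ i ≤ n},
      (MulAut (level D p i) ⧸ E.map (resTop p i)) × (E →* Fˣ)) → BimodRing F (SD E) :=
  Sum.elim (fun x => cls (projBi x.1 x.2)) fun x => levelCls F E p x.1 x.2

namespace CoprimeAction

variable (h : CoprimeAction p n E)

include h

theorem linearIndependent_basisCls : LinearIndependent ℤ (basisCls F E p n) := by
  have := linearIndependent_cls (p := p) (F := F) (S := (rightPr E).ker)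
    (ι := ((E →* Fˣ) × (E →* Fˣ)) ⊕ (Σ i : {i : ℕ // 1 ≤ i ∧ i ≤ n},
      (MulAut (level D p i) ⧸ E.map (resTop p i)) × (E →* Fˣ)))
    (Sum.elim (fun _ => tw (1 : MulAut (level D p 0)) ⊥) fun x => tw x.2.1.out ⊥)
    (Sum.elim (fun _ => tw (1 : MulAut (level D p 0)) (stab E p 0))
      fun x => tw x.2.1.out (stab E p x.1))
    (Sum.elim (fun x => (biChar x.1 x.2).comp (rightPr E))
      fun x => (x.2.2.comp (MonoidHom.fst E E)).comp (rightPr E))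
    (by rintro (x | x) <;> exact h.isolates _) (by
      rintro (⟨lam, mu⟩ | ⟨⟨i, hi, hin⟩, a, lam⟩) (⟨lam', mu'⟩ | ⟨⟨j, hj, hjn⟩, b, mu⟩) hiso
      · obtain ⟨rfl, rfl⟩ := (h.src_biChar_iso_iff (F := F) lam mu lam' mu').1 hiso
        rfl
      · have := h.src_iso_index (F := F) n.zero_le hjn hiso
        omega
      · have := h.src_iso_index (F := F) hin n.zero_le hiso
        omega
      · obtain rfl : i = j := h.src_iso_index (F := F) hin hjn hiso
        have hiso' : (trivSrc a.out lam : FinRep F (SD E × SD E)).Iso (trivSrc b.out mu) := by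
          rw [h.trivSrc_eq hi, h.trivSrc_eq hi]
          exact hiso
        obtain ⟨⟨ρ, hρ, hab⟩, rfl⟩ := (h.trivSrc_iso_iff hi _ _ _ _).1 hiso'
        have : a = b := by
          rw [← a.out_eq', ← b.out_eq', hab]
          exact QuotientGroup.mk_mul_of_mem _ (Subgroup.mem_map_of_mem _ hρ)
        rw [this])
  convert this using 1
  funext x
  rcases x with x | x
  · exact cls_projBi _ _
  · exact congrArg cls (h.trivSrc_eq x.1.2.1 _ _)

lemma TDelta_eq_closure_basisCls :
    TDelta F (SD E) p = AddSubgroup.closure (Set.range (basisCls F E p n)) := by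
  rw [h.TDelta_eq]
  congr 1
  ext x
  constructor
  · rintro (⟨x, rfl⟩ | ⟨i, hi, hin, α, lam, rfl⟩)
    · exact ⟨.inl x, rfl⟩
    · exact ⟨.inr ⟨⟨i, hi, hin⟩, (QuotientGroup.mk α, lam)⟩, h.levelCls_mk hi α lam⟩
  · rintro ⟨x | ⟨⟨i, hi, hin⟩, x⟩, rfl⟩
    · exact .inl ⟨x, rfl⟩
    · exact .inr ⟨i, hi, hin, _, _, rfl⟩

lemma linearIndependent_projBi : LinearIndependent ℤ
    fun x : (E →* Fˣ) × (E →* Fˣ) => (cls (projBi x.1 x.2) : BimodRing F (SD E)) :=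
  (h.linearIndependent_basisCls (F := F)).comp Sum.inl Sum.inl_injective

lemma linearIndependent_levelCls (hi : 1 ≤ i) (hin : i ≤ n) :
    LinearIndependent ℤ (levelCls F E p i) :=
  (h.linearIndependent_basisCls (F := F)).comp (fun x => Sum.inr ⟨⟨i, hi, hin⟩, x⟩)
    fun _ _ hxy => by simpa using hxy

section Subrings

lemma cls_projBi_mem (lam mu : E →* Fˣ) :
    (cls (projBi lam mu) : BimodRing F (SD E)) ∈ Pr F (SD E) :=
  AddSubgroup.subset_closure
    ⟨_, h.projBi_indecomposable lam mu, h.projBi_projective lam mu, rfl⟩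

lemma TDelta_mul_Pr {x y : BimodRing F (SD E)} (hx : x ∈ TDelta F (SD E) p)
    (hy : y ∈ Pr F (SD E)) : x * y ∈ Pr F (SD E) := by
  rw [h.TDelta_eq] at hx
  have hP := h.cls_projBi_mem (F := F)
  rw [h.Pr_eq] at hy
  refine mul_mem_of_closure ?_ hx hy
  rintro _ (⟨⟨lam, mu⟩, rfl⟩ | ⟨i, hi, hin, α, lam, rfl⟩) _ ⟨⟨lam', mu'⟩, rfl⟩
  · simp only [h.projBi_mul_projBi]
    refine add_mem ?_ (nsmul_mem (hP _ _) _)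
    split_ifs
    exacts [hP _ _, zero_mem _]
  · simp only [h.trivSrc_mul_projBi _ _ _ hi]
    exact add_mem (hP _ _) (sum_mem fun _ _ => nsmul_mem (hP _ _) _)

lemma Pr_mul_TDelta {x y : BimodRing F (SD E)} (hx : x ∈ Pr F (SD E))
    (hy : y ∈ TDelta F (SD E) p) : x * y ∈ Pr F (SD E) := by
  rw [h.TDelta_eq] at hy
  have hP := h.cls_projBi_mem (F := F)
  rw [h.Pr_eq] at hx
  refine mul_mem_of_closure ?_ hx hy
  rintro _ ⟨⟨lam', mu'⟩, rfl⟩ _ (⟨⟨lam, mu⟩, rfl⟩ | ⟨i, hi, hin, α, lam, rfl⟩)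
  · simp only [h.projBi_mul_projBi]
    refine add_mem ?_ (nsmul_mem (hP _ _) _)
    split_ifs
    exacts [hP _ _, zero_mem _]
  · simp only [h.projBi_mul_trivSrc _ _ _ hi]
    exact add_mem (hP _ _) (sum_mem fun _ _ => nsmul_mem (hP _ _) _)

lemma Pr_le_TDelta : Pr F (SD E) ≤ TDelta F (SD E) p := by
  rw [h.TDelta_eq, h.Pr_eq]
  exact AddSubgroup.closure_mono Set.subset_union_left

lemma cls_trivSrc_mem (hi : 1 ≤ i) (hin : i ≤ n) (α : MulAut (level D p i)) (lam : E →* Fˣ) :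
    (cls (trivSrc α lam) : BimodRing F (SD E)) ∈ TDelta F (SD E) p := by
  rw [h.TDelta_eq]
  exact AddSubgroup.subset_closure (.inr ⟨i, hi, hin, α, lam, rfl⟩)

lemma TDelta_mul_TDelta {x y : BimodRing F (SD E)} (hx : x ∈ TDelta F (SD E) p)
    (hy : y ∈ TDelta F (SD E) p) : x * y ∈ TDelta F (SD E) p := by
  have hP := fun z : (E →* Fˣ) × (E →* Fˣ) => h.cls_projBi_mem (F := F) z.1 z.2
  have hx' := hx
  have hy' := hy
  rw [h.TDelta_eq] at hx' hy'
  refine mul_mem_of_closure ?_ hx' hy'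
  rintro _ (⟨z, rfl⟩ | ⟨i, hi, hin, α, lam, rfl⟩) _ (⟨w, rfl⟩ | ⟨j, hj, hjn, β, mu, rfl⟩)
  · exact h.Pr_le_TDelta (h.Pr_mul_TDelta (hP z) (h.Pr_le_TDelta (hP w)))
  · exact h.Pr_le_TDelta (h.Pr_mul_TDelta (hP z) (h.cls_trivSrc_mem hj hjn β mu))
  · exact h.Pr_le_TDelta (h.TDelta_mul_Pr (h.cls_trivSrc_mem hi hin α lam) (hP w))
  · have hk : 1 ≤ min i j := le_min hi hj
    have hkn : min i j ≤ n := (min_le_left i j).trans hin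
    rw [h.trivSrc_mul_trivSrc (min_le_left i j) (min_le_right i j) (min_choice i j)
      (le_max_left i j) (le_max_right i j) (max_choice i j) lam mu hk]
    exact add_mem (h.cls_trivSrc_mem hk hkn _ _)
      (sum_mem fun _ _ => nsmul_mem (h.cls_trivSrc_mem hk hkn _ _) _)

/-- The `M_{i,α,λ}` commute with each other because `Aut(D_i)` is abelian. -/
lemma commutator_mem_Pr {x y : BimodRing F (SD E)} (hx : x ∈ TDelta F (SD E) p)
    (hy : y ∈ TDelta F (SD E) p) : x * y - y * x ∈ Pr F (SD E) := by
  have hP := fun z : (E →* Fˣ) × (E →* Fˣ) => h.cls_projBi_mem (F := F) z.1 z.2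
  have hx' := hx
  have hy' := hy
  rw [h.TDelta_eq] at hx' hy'
  refine map₂_mem_of_closure (AddMonoidHom.mul - AddMonoidHom.mul.flip)
    (fun a ha b hb => ?_) hx' hy'
  change a * b - b * a ∈ Pr F (SD E)
  rcases ha with ⟨z, rfl⟩ | ⟨i, hi, hin, α, lam, rfl⟩ <;>
    rcases hb with ⟨w, rfl⟩ | ⟨j, hj, hjn, β, mu, rfl⟩
  · have hw := h.Pr_le_TDelta (hP w)
    exact sub_mem (h.Pr_mul_TDelta (hP z) hw) (h.TDelta_mul_Pr hw (hP z))
  · have hw := h.cls_trivSrc_mem (F := F) hj hjn β mu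
    exact sub_mem (h.Pr_mul_TDelta (hP z) hw) (h.TDelta_mul_Pr hw (hP z))
  · have hz := h.cls_trivSrc_mem (F := F) hi hin α lam
    exact sub_mem (h.TDelta_mul_Pr hz (hP w)) (h.Pr_mul_TDelta (hP w) hz)
  · have hk : 1 ≤ min i j := le_min hi hj
    rw [h.trivSrc_mul_trivSrc (min_le_left i j) (min_le_right i j) (min_choice i j)
        (le_max_left i j) (le_max_right i j) (max_choice i j) lam mu hk,
      h.trivSrc_mul_trivSrc (min_le_right i j) (min_le_left i j) (min_choice i j).symm
        (le_max_right i j) (le_max_left i j) (max_choice i j).symm mu lam hk,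
      mulAut_comm (res (min_le_left i j) α), mul_comm lam, sub_self]
    exact zero_mem _

/-- `T^Δ(FG, FG)` is a ring, `Pr(FG, FG)` is an ideal, and the quotient is commutative. -/
theorem exists_subring_TDelta : ∃ S : Subring (BimodRing F (SD E)),
    S.toAddSubgroup = TDelta F (SD E) p ∧ Pr F (SD E) ≤ TDelta F (SD E) p ∧
      ∃ I : TwoSidedIdeal S, (∀ x : S, x ∈ I ↔ (x : BimodRing F (SD E)) ∈ Pr F (SD E)) ∧
        ∀ a b : I.ringCon.Quotient, a * b = b * a := by
  let S : Subring (BimodRing F (SD E)) :=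
    { TDelta F (SD E) p with
      mul_mem' := h.TDelta_mul_TDelta
      one_mem' := h.cls_trivSrc_one (F := F) ▸ h.cls_trivSrc_mem h.pos le_rfl 1 1 }
  let I : TwoSidedIdeal S := .mk' {x | (x : BimodRing F (SD E)) ∈ Pr F (SD E)}
    (Pr F (SD E)).zero_mem
    (fun hx hy => (Pr F (SD E)).add_mem hx hy) (fun hx => (Pr F (SD E)).neg_mem hx)
    (fun {x _} hy => h.TDelta_mul_Pr x.2 hy) (fun {_ y} hx => h.Pr_mul_TDelta hx y.2)
  have hI : ∀ x : S, x ∈ I ↔ (x : BimodRing F (SD E)) ∈ Pr F (SD E) := fun x =>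
    TwoSidedIdeal.mem_mk' _ _ _ _ _ _ x
  refine ⟨S, rfl, h.Pr_le_TDelta, I, hI, ?_⟩
  rintro ⟨a⟩ ⟨b⟩
  refine (RingCon.eq I.ringCon).2 ?_
  rw [TwoSidedIdeal.rel_iff, hI]
  exact h.commutator_mem_Pr a.2 b.2

theorem exists_ringEquiv_Pr : ∃ S : NonUnitalSubring (BimodRing F (SD E)),
    S.toAddSubgroup = Pr F (SD E) ∧
      ∃ e : S ≃+* Twisted (starCartan (E →* Fˣ) (Fintype.card (h.Orbits 0))),
        ∀ lam mu : E →* Fˣ, ∃ h : cls (projBi lam mu) ∈ S,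
          e ⟨cls (projBi lam mu), h⟩ = Twisted.of _ (Matrix.single lam mu 1) := by
  obtain ⟨S, hS, e, he⟩ := exists_ringEquiv_matrix (h.linearIndependent_projBi (F := F))
    (Fintype.card (h.Orbits 0)) (fun a b c d => h.projBi_mul_projBi a b c d) h.Pr_eq
  exact ⟨S, hS, e, fun lam mu => he (lam, mu)⟩

theorem exists_ringEquiv_TDeltaLevel (hi : 1 ≤ i) (hin : i ≤ n) :
    ∃ S : NonUnitalSubring (BimodRing F (SD E)), S.toAddSubgroup = TDeltaLevel F (SD E) p i ∧
      ∃ e : S ≃+* Twisted (twistElt (MulAut (level D p i) ⧸ E.map (resTop p i)) (E →* Fˣ)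
          (Fintype.card (h.Orbits i))),
        ∀ (α : MulAut (level D p i)) (lam : E →* Fˣ), ∃ h : cls (trivSrc α lam) ∈ S,
          e ⟨cls (trivSrc α lam), h⟩
            = Twisted.of _ (MonoidAlgebra.single (QuotientGroup.mk α, lam) 1) := by
  obtain ⟨S, hS, e, he⟩ := exists_ringEquiv_twistElt
    (Γ := MulAut (level D p i) ⧸ E.map (resTop p i)) (Y := E →* Fˣ)
    (h.linearIndependent_levelCls (F := F) hi hin) (Fintype.card (h.Orbits i))
    (fun x y => by rw [h.levelCls_mul_levelCls hi x y]) (h.TDeltaLevel_eq hi hin)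
  refine ⟨S, hS, e, fun α lam => ?_⟩
  obtain ⟨hmem, hx⟩ := he (QuotientGroup.mk α, lam)
  simp only [h.levelCls_mk hi] at hmem hx
  exact ⟨hmem, hx⟩

omit hp in
lemma resTop_bijective : Function.Bijective (resTop p n : MulAut D →* MulAut (level D p n)) := by
  constructor
  · intro a b hab
    ext x
    exact congrArg (fun c : MulAut (level D p n) => (c ⟨x, h.mem_level_top x⟩ : D)) hab
  · intro α
    let e : level D p n ≃* D :=
      (MulEquiv.subgroupCongr ((Subgroup.eq_top_iff' _).2 h.mem_level_top)).trans Subgroup.topEquiv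
    refine ⟨(e.symm.trans α).trans e, ?_⟩
    ext x
    rfl

lemma card_orbits_top : Fintype.card (h.Orbits n) = 0 := by
  rw [h.card_orbits le_rfl, Nat.sub_self, pow_zero, Nat.sub_self, Nat.zero_div]

/-- Here `D_n = D`, and `m_n = 0` makes the multiplication that of the group ring. -/
theorem exists_ringEquiv_TDeltaLevel_top :
    ∃ S : NonUnitalSubring (BimodRing F (SD E)), S.toAddSubgroup = TDeltaLevel F (SD E) p n ∧
      ∃ e : S ≃+* MonoidAlgebra ℤ ((MulAut D ⧸ E) × (E →* Fˣ)),
        ∀ (α : MulAut D) (lam : E →* Fˣ), ∃ h : cls (trivSrc (resTop p n α) lam) ∈ S,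
          e ⟨cls (trivSrc (resTop p n α) lam), h⟩
            = MonoidAlgebra.single (QuotientGroup.mk α, lam) 1 := by
  let q : MulAut D ⧸ E ≃* MulAut (level D p n) ⧸ E.map (resTop p n) :=
    QuotientGroup.congr E _ (MulEquiv.ofBijective (resTop p n) h.resTop_bijective) rfl
  let q' : (MulAut D ⧸ E) × (E →* Fˣ) ≃*
      (MulAut (level D p n) ⧸ E.map (resTop p n)) × (E →* Fˣ) :=
    { q.toEquiv.prodCongr (Equiv.refl _) with
      map_mul' := fun x y => Prod.ext (map_mul q x.1 y.1) rfl }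
  have hmk : ∀ (α : MulAut D) (lam : E →* Fˣ),
      levelCls F E p n (q' (QuotientGroup.mk α, lam)) = cls (trivSrc (resTop p n α) lam) :=
    fun α lam => h.levelCls_mk h.pos _ _
  obtain ⟨S, hS, e, he⟩ := exists_ringEquiv_monoidAlgebra
    ((h.linearIndependent_levelCls (F := F) h.pos le_rfl).comp q' q'.injective)
    (fun x y => by
      simp only [Function.comp_apply, h.levelCls_mul_levelCls h.pos, h.card_orbits_top,
        zero_smul, Finset.sum_const_zero, add_zero, map_mul])
    (A := TDeltaLevel F (SD E) p n)
    (by rw [h.TDeltaLevel_eq h.pos le_rfl, q'.surjective.range_comp])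
  refine ⟨S, hS, e, fun α lam => ?_⟩
  obtain ⟨hmem, hx⟩ := he (QuotientGroup.mk α, lam)
  simp only [Function.comp_apply, hmk] at hmem hx
  exact ⟨hmem, hx⟩

end Subrings

end CoprimeAction

end TrivialSourceRing

end

end TrivialSource

open TrivialSource in
theorem mainTheorem7 {F : Type u} [Field F] (p n : ℕ) (hp : p.Prime) [CharP F p] (hn : 1 ≤ n)
    {D : Type v} [CommGroup D] [IsCyclic D] [Finite D] (hD : Nat.card D = p ^ n)
    (E : Subgroup (MulAut D)) (hE : (Nat.card E).Coprime p)
    (m : ℕ → ℕ) (hm : ∀ i, m i = (p ^ (n - i) - 1) / Nat.card E) :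
    -- the multiplicities are exact quotients, and there are `|E|` linear characters of `E`
    (∀ i, Nat.card E ∣ p ^ (n - i) - 1) ∧
    Nat.card (E →* Fˣ) = Nat.card E ∧
    -- the projective indecomposable modules
    (∀ lam mu : E →* Fˣ, (projBi lam mu).Indecomposable ∧ (projBi lam mu).Projective) ∧
    (∀ M : FinRep F (SD E × SD E), M.Indecomposable → M.Projective →
      ∃ lam mu : E →* Fˣ, M.Iso (projBi lam mu)) ∧
    (∀ lam mu lam' mu' : E →* Fˣ,
      (projBi lam mu).Iso (projBi lam' mu') ↔ lam = lam' ∧ mu = mu') ∧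
    -- the non-projective indecomposable `p`-permutation modules with twisted diagonal vertices
    (∀ i, 1 ≤ i → i ≤ n → ∀ (α : MulAut (level D p i)) (lam : E →* Fˣ),
      (trivSrc α lam).Indecomposable ∧ (trivSrc α lam).PPermutation p ∧
        (trivSrc α lam).IsVertex (diag E α)) ∧
    (∀ M : FinRep F (SD E × SD E), M.Indecomposable → M.PPermutation p → ¬ M.Projective →
      (∃ X, M.IsVertex X ∧ IsTwistedDiagonal p X) →
      ∃ i, 1 ≤ i ∧ i ≤ n ∧ ∃ (α : MulAut (level D p i)) (lam : E →* Fˣ),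
        M.Iso (trivSrc α lam)) ∧
    (∀ i j, 1 ≤ i → i ≤ n → 1 ≤ j → j ≤ n → i ≠ j →
      ∀ (α : MulAut (level D p i)) (β : MulAut (level D p j)) (lam mu : E →* Fˣ),
        ¬ (trivSrc α lam).Iso (trivSrc β mu)) ∧
    (∀ i, 1 ≤ i → i ≤ n → ∀ (α β : MulAut (level D p i)) (lam mu : E →* Fˣ),
      (trivSrc α lam).Iso (trivSrc β mu) ↔
        (∃ ρ ∈ E, α = β * resTop p i ρ) ∧ lam = mu) ∧
    -- the `ℤ`-basis of `T^Δ(FG, FG)`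
    (∃ b : Module.Basis (((E →* Fˣ) × (E →* Fˣ)) ⊕
        (Σ i : {i : ℕ // 1 ≤ i ∧ i ≤ n},
          (MulAut (level D p i) ⧸ E.map (resTop p i)) × (E →* Fˣ))) ℤ (TDelta F (SD E) p),
      (∀ lam mu : E →* Fˣ,
        (b (.inl (lam, mu)) : BimodRing F (SD E)) = cls (projBi lam mu)) ∧
      (∀ (i : {i : ℕ // 1 ≤ i ∧ i ≤ n}) (α : MulAut (level D p i)) (lam : E →* Fˣ),
        (b (.inr ⟨i, (QuotientGroup.mk α, lam)⟩) : BimodRing F (SD E))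
          = cls (trivSrc α lam))) ∧
    -- the multiplication rules
    (∀ lam mu mu' : E →* Fˣ, (cls (projBi lam mu) : BimodRing F (SD E)) * cls (projBi mu mu')
      = (m 0 + 1) • cls (projBi lam mu')) ∧
    (∀ lam mu lam' mu' : E →* Fˣ, mu ≠ lam' →
      (cls (projBi lam mu) : BimodRing F (SD E)) * cls (projBi lam' mu')
        = m 0 • cls (projBi lam mu')) ∧
    (∀ (lam mu mu' : E →* Fˣ) (j : ℕ), 1 ≤ j → j ≤ n → ∀ β : MulAut (level D p j),
      (cls (projBi lam mu) : BimodRing F (SD E)) * cls (trivSrc β mu')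
        = cls (projBi lam (mu * mu'⁻¹)) + ∑ ν : E →* Fˣ, m j • cls (projBi lam ν)) ∧
    (∀ (lam lam' mu' : E →* Fˣ) (i : ℕ), 1 ≤ i → i ≤ n → ∀ α : MulAut (level D p i),
      (cls (trivSrc α lam) : BimodRing F (SD E)) * cls (projBi lam' mu')
        = cls (projBi (lam * lam') mu') + ∑ ν : E →* Fˣ, m i • cls (projBi ν mu')) ∧
    (∀ (lam mu : E →* Fˣ) (i j : ℕ), 1 ≤ i → i ≤ n → 1 ≤ j → j ≤ n →
      ∀ (α : MulAut (level D p i)) (β : MulAut (level D p j)),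
      (cls (trivSrc α lam) : BimodRing F (SD E)) * cls (trivSrc β mu)
        = cls (trivSrc (res (min_le_left i j) α * res (min_le_right i j) β) (lam * mu))
          + ∑ ν : E →* Fˣ, m (max i j) •
              cls (trivSrc (res (min_le_left i j) α * res (min_le_right i j) β) ν)) ∧
    (cls (trivSrc (1 : MulAut (level D p n)) (1 : E →* Fˣ)) : BimodRing F (SD E)) = 1 ∧
    -- `T^Δ(FG, FG)` is a unital ring, `Pr(FG, FG)` is an ideal, and the quotient is commutative
    (∃ S : Subring (BimodRing F (SD E)), S.toAddSubgroup = TDelta F (SD E) p ∧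
      Pr F (SD E) ≤ TDelta F (SD E) p ∧
      ∃ I : TwoSidedIdeal S, (∀ x : S, x ∈ I ↔ (x : BimodRing F (SD E)) ∈ Pr F (SD E)) ∧
        ∀ a b : I.ringCon.Quotient, a * b = b * a) ∧
    -- each `T^Δ_i(FG, FG)` is multiplicatively closed
    (∀ i ≤ n, ∃ S : NonUnitalSubring (BimodRing F (SD E)),
      S.toAddSubgroup = TDeltaLevel F (SD E) p i) ∧
    -- `T^Δ_0(FG, FG) = Pr(FG, FG)` is a twisted matrix ring
    TDeltaLevel F (SD E) p 0 = Pr F (SD E) ∧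
    (∃ S : NonUnitalSubring (BimodRing F (SD E)), S.toAddSubgroup = Pr F (SD E) ∧
      ∃ e : S ≃+* Twisted (starCartan (E →* Fˣ) (m 0)),
        ∀ lam mu : E →* Fˣ, ∃ h : cls (projBi lam mu) ∈ S,
          e ⟨cls (projBi lam mu), h⟩ = Twisted.of _ (Matrix.single lam mu 1)) ∧
    -- `T^Δ_n(FG, FG)` is a group ring
    (∃ S : NonUnitalSubring (BimodRing F (SD E)),
      S.toAddSubgroup = TDeltaLevel F (SD E) p n ∧
      ∃ e : S ≃+* MonoidAlgebra ℤ ((MulAut D ⧸ E) × (E →* Fˣ)),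
        ∀ (α : MulAut D) (lam : E →* Fˣ), ∃ h : cls (trivSrc (resTop p n α) lam) ∈ S,
          e ⟨cls (trivSrc (resTop p n α) lam), h⟩
            = MonoidAlgebra.single (QuotientGroup.mk α, lam) 1) ∧
    -- `T^Δ_i(FG, FG)` is a twisted group ring
    (∀ i, 1 ≤ i → i ≤ n → ∃ S : NonUnitalSubring (BimodRing F (SD E)),
      S.toAddSubgroup = TDeltaLevel F (SD E) p i ∧
      ∃ e : S ≃+* Twisted
          (twistElt (MulAut (level D p i) ⧸ E.map (resTop p i)) (E →* Fˣ) (m i)),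
        ∀ (α : MulAut (level D p i)) (lam : E →* Fˣ), ∃ h : cls (trivSrc α lam) ∈ S,
          e ⟨cls (trivSrc α lam), h⟩
            = Twisted.of _ (MonoidAlgebra.single (QuotientGroup.mk α, lam) 1)) := by
  have : Fact p.Prime := ⟨hp⟩
  have h : CoprimeAction p n E := ⟨hn, hD, hE⟩
  have hm' : ∀ i ≤ n, m i = Fintype.card (h.Orbits i) := fun i hi => by
    rw [hm, h.card_orbits hi]
  refine ⟨h.dvd, h.card_char (F := F), fun lam mu => ⟨h.projBi_indecomposable lam mu,
    h.projBi_projective lam mu⟩, fun M => h.exists_iso_projBi, h.projBi_iso_iff,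
    fun i hi hin α lam => ⟨h.trivSrc_indecomposable hi α lam, h.trivSrc_pPermutation hi α lam,
      tw_bot α ▸ h.trivSrc_isVertex hi hin α lam⟩, fun M => h.exists_iso_trivSrc,
    fun i j hi hin hj hjn hij α β lam mu hiso =>
      hij (h.index_eq_of_trivSrc_iso hi hin hj hjn hiso),
    fun i hi hin => h.trivSrc_iso_iff hi, ?_, fun lam mu mu' => ?_,
    fun lam mu lam' mu' hne => ?_, fun lam mu mu' j hj hjn β => ?_,
    fun lam lam' mu' i hi hin α => ?_, fun lam mu i j hi hin hj hjn α β => ?_,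
    h.cls_trivSrc_one, h.exists_subring_TDelta, fun i hi => ?_, h.TDeltaLevel_zero_eq, ?_,
    h.exists_ringEquiv_TDeltaLevel_top, fun i hi hin => ?_⟩
  · obtain ⟨b, hb⟩ := exists_basis_of_closure (h.linearIndependent_basisCls (F := F))
      h.TDelta_eq_closure_basisCls
    exact ⟨b, fun lam mu => hb (.inl (lam, mu)), fun i α lam =>
      (hb (.inr ⟨i, (QuotientGroup.mk α, lam)⟩)).trans (h.levelCls_mk i.2.1 α lam)⟩
  · rw [h.projBi_mul_projBi, if_pos rfl, hm' 0 n.zero_le, add_comm, add_smul, one_smul]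
  · rw [h.projBi_mul_projBi, if_neg hne, hm' 0 n.zero_le, zero_add]
  · rw [hm' j hjn]
    exact h.projBi_mul_trivSrc lam mu mu' hj β
  · rw [hm' i hin]
    exact h.trivSrc_mul_projBi lam lam' mu' hi α
  · rw [hm' _ (max_le hin hjn)]
    exact h.trivSrc_mul_trivSrc (min_le_left i j) (min_le_right i j) (min_choice i j)
      (le_max_left i j) (le_max_right i j) (max_choice i j) lam mu (le_min hi hj) α β
  · rcases Nat.eq_zero_or_pos i with rfl | hpos
    · obtain ⟨S, hS, -⟩ := h.exists_ringEquiv_Pr (F := F)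
      exact ⟨S, hS.trans h.TDeltaLevel_zero_eq.symm⟩
    · obtain ⟨S, hS, -⟩ := h.exists_ringEquiv_TDeltaLevel (F := F) hpos hi
      exact ⟨S, hS⟩
  · rw [hm' 0 n.zero_le]
    exact h.exists_ringEquiv_Pr
  · rw [hm' i hin]
    exact h.exists_ringEquiv_TDeltaLevel hi hin
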